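/- **Definitions.** Let $k\ge 2$. A $k$-uniform hypergraph is a pair $(V,E)$ with $E\subseteq\binom{V}{k}$; it is *connected* if its shadow graph (the graph on $V$ in which two distinct vertices are adjacent when some edge contains both) is connected. A $k$-uniform *loose cycle* is a hypergraph whose vertices can be cyclically ordered, without repetition, as $v_0,\dots,v_{\ell(k-1)-1}$ for some $\ell\ge 2$, so that its edges are the sets $\{v_{i(k-1)},v_{i(k-1)+1},\dots,v_{i(k-1)+k-1}\}$ for $0\le i<\ell$ (indices modulo $\ell(k-1)$). Thus for $k\ge 3$ the shortest loose cycle ($\ell=2$) consists of two edges that meet in exactly two vertices, and for $k=2$ a single edge counts as a cycle on $2$ vertices. A *connected loose cycle packing on $N$ vertices* in a hypergraph $G$ consists of a connected sub-hypergraph $H\subseteq G$ and pairwise vertex-disjoint loose cycles $C_1,\dots,C_m\subseteq H$ with $\sum_{i}|V(C_i)|=N$. In an $r$-colouring of the edges of $G$, a packing (or a cycle) is *monochromatic* if, for some colour $c$, it is contained in the sub-hypergraph formed by the edges of colour $c$ (for a packing this includes $H$). $\mathcal H^{(k)}(n,p)$ is the random $k$-uniform hypergraph on the vertex set $[n]$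 in which each $k$-element subset of $[n]$ is an edge independently with probability $p$. *Asymptotically almost surely* (a.a.s.) means with probability tending to $1$ as $n\to\infty$. **Theorem.** Let $\psi=\psi(r,k)$ be a real-valued function satisfying the following condition: for all integers $k\ge 2$, $r\ge 1$ and every real $\alpha^*>0$ there exist $\epsilon^*>0$ and $t_0>0$ such that if $G$ is a $k$-uniform hypergraph on $t\ge t_0$ vertices with $e(G)\ge(1-\epsilon^*)\binom{t}{k}$, then every $r$-colouring of the edges of $G$ contains a monochromatic connected loose cycle packing on at least $(\psi(r,k)-\alpha^*)t$ vertices. Then for all integers $k\ge 2$, $r\ge 1$, every real $\alpha>0$, and every sequence $p=p(n)\in[0,1]$ with $p\,n^{k-1}\to\infty$, a.a.s. every $r$-colouring of the edges of $\mathcal H^{(k)}(n,p)$ contains a monochromatic loose cycle on at least $(\psi(r,k)-\alpha)n$ vertices. -/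

import Mathlib

open MeasureTheory ProbabilityTheory Filter
open scoped Topology unitInterval

namespace LooseCycles

variable {V : Type*}

/-- Every edge of `G` has exactly `k` vertices. -/
def IsUniform (k : ℕ) (G : Hypergraph V) : Prop :=
  ∀ e ∈ G.edgeSet, e.ncard = k

/-- `H` is a (not necessarily induced or spanning) sub-hypergraph of `G`. -/
def IsSub (H G : Hypergraph V) : Prop :=
  H.vertexSet ⊆ G.vertexSet ∧ H.edgeSet ⊆ G.edgeSet

/-- The shadow graph of `H`: distinct vertices of `H` are joined when some edge contains both. -/
def shadowGraph (H : Hypergraph V) : SimpleGraph H.vertexSet where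
  Adj x y := x ≠ y ∧ H.Adj (x : V) (y : V)
  symm := ⟨fun _ _ h => ⟨h.1.symm, h.2.symm⟩⟩
  loopless := ⟨fun _ h => h.1 rfl⟩

/-- A hypergraph is connected when its shadow graph is. -/
def IsConnected (H : Hypergraph V) : Prop :=
  (shadowGraph H).Connected

/-- The hypergraph formed by the edges of `G` that `χ` colours with `c`, on the vertices of `G`.
Only the values of `χ` on the edges of `G` matter. -/
def colorClass {r : ℕ} (G : Hypergraph V) (χ : Set V → Fin r) (c : Fin r) : Hypergraph V where
  vertexSet := G.vertexSet
  edgeSet := {e ∈ G.edgeSet | χ e = c}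
  subset_vertexSet_of_mem_edgeSet' := fun _ he => G.subset_vertexSet_of_mem_edgeSet' he.1

/-- `C` is a `k`-uniform loose cycle (for `k ≥ 2`): for some `ℓ ≥ 2`, its vertices can be listed
cyclically without repetition as `v 0, …, v (ℓ (k - 1) - 1)`, so that its edges are the `ℓ` blocks
`{v (i (k - 1)), v (i (k - 1) + 1), …, v (i (k - 1) + (k - 1))}`, `i < ℓ`, of `k` consecutive
vertices, each block sharing its last vertex with the next one.
For `ℓ = 2` and `k ≥ 3` this is the diamond, two edges meeting in exactly two vertices; for
`ℓ = 2` and `k = 2` the two blocks coincide and `C` is a single edge with its two end vertices. -/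
def IsLooseCycle (k : ℕ) (C : Hypergraph V) : Prop :=
  ∃ ℓ : ℕ, 2 ≤ ℓ ∧ ∃ v : ZMod (ℓ * (k - 1)) → V, Function.Injective v ∧
    C.vertexSet = Set.range v ∧
    C.edgeSet = {e | ∃ i < ℓ, e = {x | ∃ j < k, x = v ((i * (k - 1) + j : ℕ))}}

/-- `G` contains a connected loose cycle packing on `N` vertices: pairwise vertex-disjoint loose
cycles, with `N` vertices altogether, inside one connected sub-hypergraph `H` of `G`. -/
def HasConnectedLooseCyclePacking (k : ℕ) (G : Hypergraph V) (N : ℕ) : Prop :=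
  ∃ H : Hypergraph V, IsSub H G ∧ IsConnected H ∧
    ∃ (m : ℕ) (C : Fin m → Hypergraph V),
      (∀ i, IsLooseCycle k (C i) ∧ IsSub (C i) H) ∧
      (∀ i j, i ≠ j → Disjoint (C i).vertexSet (C j).vertexSet) ∧
      ∑ i, (C i).vertexSet.ncard = N

/-- The hypergraph with edge set `E` on all of `V`. -/
def ofEdgeSet (E : Set (Set V)) : Hypergraph V where
  vertexSet := Set.univ
  edgeSet := E
  subset_vertexSet_of_mem_edgeSet' := fun _ _ => Set.subset_univ _

/-- Every set of hypergraphs is an event. -/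
instance : MeasurableSpace (Hypergraph V) := ⊤

/-- The law of the binomial random `k`-uniform hypergraph on the vertex set `Fin n`: each `k`-element
set of vertices is an edge with probability `p`, independently of the others. -/
noncomputable def randomHypergraph (k n : ℕ) (p : I) : Measure (Hypergraph (Fin n)) :=
  (setBernoulli {e : Set (Fin n) | e.ncard = k} p).map ofEdgeSet

theorem measurable_ofEdgeSet (n : ℕ) :
    Measurable (ofEdgeSet : Set (Set (Fin n)) → Hypergraph (Fin n)) :=
  measurable_of_countable _

instance (k n : ℕ) (p : I) : IsProbabilityMeasure (randomHypergraph k n p) :=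
  Measure.isProbabilityMeasure_map (measurable_ofEdgeSet n).aemeasurable

end LooseCycles

/-! The proof combines weak hypergraph regularity with the method of connected matchings, loose
cycles playing the role of matching edges. Write κ = k - 1. A colour hits a `k`-set of parts if any
choice of `h` vertices in each of these parts spans an edge of that colour (`Hits`). This one-sided
property is all that the embedding needs.

Randomness enters once. A lower-tail bound and a union bound show that a.a.s. every `k`-set of
linearly large parts spans at least a quarter of the expected number of edges
(`tendsto_measure_isLowerDense`): the failure exponent is of order p n^k, which outgrows n since p
n^(k-1) tends to infinity. The rest is deterministic (`exists_looseCycle_of_isLowerDense`).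

Regularity (`exists_isRegularPartition`): on each `k`-set of large parts some colour has density at
least d = p / (4r). If no colour hits the `k`-set, that colour has an edgeless witness with many
vertices in each part. The energy sums the positive parts of "d times the number of `k`-sets minus
the number of edges" over all types and colours. It is at most r d n^k however many edges there are,
so no upper bound on edge counts is required, while refining by the witnesses of many bad `k`-sets
raises it by a constant times d n^k. Boundedly many refinements therefore suffice.

The reduced hypergraph of the hit `k`-sets, each coloured by a colour hitting it, is nearly
complete, so the hypothesis on ψ gives a monochromatic connected packing on N vertices
(`exists_links`). Each edge of its cycles becomes a `Link`: a depth-first search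
(`Hits.exists_alternatingPath`) embeds a path with 2u edges whose connecting vertices alternate
between two of the parts. It takes at most u + 1 vertices from each of these two and 2u from each
other part of the edge. A connecting vertex of a packing cycle lies in two blocks and any other
vertex in one, so every part gives at most 2u + 2 vertices, and u can be nearly half the part size
s. The N / κ links yield about sN / κ edges, hence about sN vertices. Short paths through small
reservoirs (`exists_connecting_path`), available because the packing is connected, join everything
into one cycle (`exists_looseCycleSeq`). -/

namespace LooseCycles

/-! ### Loose paths: cutting, gluing, single edges -/

section LoosePaths

variable {V ι : Type*}

/-- Follow `v` up to time `l`, then `w`. -/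
def glue (l : ℕ) (v w : ℕ → V) : ℕ → V := fun i => if i ≤ l then v i else w (i - l)

theorem glue_of_le {l i : ℕ} (v w : ℕ → V) (h : i ≤ l) : glue l v w i = v i := if_pos h

theorem glue_add {l : ℕ} {v w : ℕ → V} (h : v l = w 0) (i : ℕ) : glue l v w (l + i) = w i := by
  unfold glue
  split_ifs with hi
  · obtain rfl : i = 0 := by omega
    simpa using h
  · simp

/-- For transversal edges: an edge of type `e` has exactly one vertex in each part of `e`. -/
theorem injOn_of_image_eq [DecidableEq ι] {π : V → ι} {f : Finset V} {e : Finset ι} (hfe : f.image π = e)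
    (hcard : f.card = e.card) : ∀ x ∈ f, ∀ y ∈ f, π x = π y → x = y := by
  have := Finset.card_image_iff.1 (show (f.image π).card = f.card by rw [hfe, hcard])
  exact fun x hx y hy h => this hx hy h

variable [DecidableEq V] [DecidableEq ι]

/-- The `i`-th block of `κ + 1` consecutive vertices in a sequence. -/
def block (κ : ℕ) (v : ℕ → V) (i : ℕ) : Finset V :=
  (Finset.range (κ + 1)).image fun j => v (i * κ + j)

/-- `v 0, …, v (m * κ)` is a loose path with `m` edges, all in `E`. -/
structure IsLoosePath (κ : ℕ) (E : Set (Finset V)) (m : ℕ) (v : ℕ → V) : Prop where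
  inj : ∀ x y, x ≤ m * κ → y ≤ m * κ → v x = v y → x = y
  edge : ∀ i < m, block κ v i ∈ E

theorem mem_block {κ i : ℕ} {v : ℕ → V} {x : V} :
    x ∈ block κ v i ↔ ∃ j ≤ κ, v (i * κ + j) = x := by
  simp [block]

theorem block_glue_left {κ m i : ℕ} (v w : ℕ → V) (hi : i < m) :
    block κ (glue (m * κ) v w) i = block κ v i := by
  unfold block
  refine Finset.image_congr fun j hj => glue_of_le v w ?_
  have : j ≤ κ := by simpa [Nat.lt_succ_iff] using hj
  nlinarith

theorem block_glue_right {κ m : ℕ} {v w : ℕ → V} (h : v (m * κ) = w 0) (i : ℕ) :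
    block κ (glue (m * κ) v w) (m + i) = block κ w i := by
  unfold block
  refine Finset.image_congr fun j _ => ?_
  show glue (m * κ) v w ((m + i) * κ + j) = w (i * κ + j)
  rw [show (m + i) * κ + j = m * κ + (i * κ + j) by ring, glue_add h]

theorem block_shift (κ s : ℕ) (v : ℕ → V) (i : ℕ) :
    block κ (fun x => v (s * κ + x)) i = block κ v (s + i) := by
  unfold block
  refine Finset.image_congr fun j _ => ?_
  show v (s * κ + (i * κ + j)) = v ((s + i) * κ + j)
  congr 1; ring

theorem block_glue_mem {κ m m' : ℕ} {E : Set (Finset V)} {v w : ℕ → V}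
    (hv : ∀ i < m, block κ v i ∈ E) (hw : ∀ i < m', block κ w i ∈ E) (h : v (m * κ) = w 0) :
    ∀ i < m + m', block κ (glue (m * κ) v w) i ∈ E := by
  intro i hi
  by_cases hm : i < m
  · rw [block_glue_left v w hm]; exact hv i hm
  · obtain ⟨j, rfl⟩ := Nat.exists_eq_add_of_le (not_lt.1 hm)
    rw [block_glue_right h]; exact hw j (by omega)

namespace IsLoosePath

variable {κ m m' : ℕ} {E : Set (Finset V)} {v w : ℕ → V}

theorem mono {E' : Set (Finset V)} (hv : IsLoosePath κ E m v) (h : E ⊆ E') :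
    IsLoosePath κ E' m v := ⟨hv.inj, fun i hi => h (hv.edge i hi)⟩

theorem take (hv : IsLoosePath κ E m v) (h : m' ≤ m) : IsLoosePath κ E m' v := by
  have := Nat.mul_le_mul_right κ h
  exact ⟨fun x y hx hy => hv.inj x y (by omega) (by omega), fun i hi => hv.edge i (by omega)⟩

theorem shift {s : ℕ} (hv : IsLoosePath κ E m v) (h : s + m' ≤ m) :
    IsLoosePath κ E m' fun x => v (s * κ + x) := by
  have := Nat.mul_le_mul_right κ h
  rw [add_mul] at this
  refine ⟨fun x y hx hy hxy => ?_, fun i hi => ?_⟩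
  · have := hv.inj _ _ (by omega) (by omega) hxy
    omega
  · rw [block_shift]; exact hv.edge _ (by omega)

theorem glue (hv : IsLoosePath κ E m v) (hw : IsLoosePath κ E m' w) (h : v (m * κ) = w 0)
    (hd : ∀ i ≤ m * κ, ∀ j, 0 < j → j ≤ m' * κ → v i ≠ w j) :
    IsLoosePath κ E (m + m') (glue (m * κ) v w) := by
  refine ⟨fun x y hx hy hxy => ?_, block_glue_mem hv.edge hw.edge h⟩
  rw [add_mul] at hx hy
  unfold LooseCycles.glue at hxy
  split_ifs at hxy with h1 h2 h2
  · exact hv.inj x y h1 h2 hxy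
  · exact absurd hxy (hd _ h1 _ (by omega) (by omega))
  · exact absurd hxy.symm (hd _ h2 _ (by omega) (by omega))
  · have := hw.inj _ _ (by omega) (by omega) hxy
    omega

/-- The order of the vertices within an edge is free, so any two of them can serve as its ends. -/
theorem single {f : Finset V} {a b : V} (hf : f ∈ E) (hcard : f.card = κ + 1) (ha : a ∈ f)
    (hb : b ∈ f) (hab : a ≠ b) :
    ∃ w : ℕ → V, IsLoosePath κ E 1 w ∧ w 0 = a ∧ w κ = b ∧ block κ w 0 = f := by
  classical
  set R := ((f.erase a).erase b).toList with hR
  set L := a :: (R ++ [b]) with hL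
  have hRl : R.length + 1 = κ := by
    rw [hR, Finset.length_toList, Finset.card_erase_of_mem (by simp [hb, hab.symm]),
      Finset.card_erase_of_mem ha, hcard]
    have : 1 < f.card := Finset.one_lt_card.2 ⟨a, ha, b, hb, hab⟩
    omega
  have hlen : L.length = κ + 1 := by simp [hL, hRl]
  have hnd : L.Nodup := by
    have h1 : R.Nodup := Finset.nodup_toList _
    simp only [hL, List.nodup_cons, List.mem_append, List.nodup_append]
    simp [hR, hab, Finset.nodup_toList]
    intro x h1 _ _; exact h1
  have hmem : ∀ x, x ∈ L ↔ x ∈ f := by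
    intro x
    simp only [hL, hR, List.mem_cons, List.mem_append, Finset.mem_toList, Finset.mem_erase,
      List.not_mem_nil, or_false]
    constructor
    · rintro (rfl | h | rfl)
      exacts [ha, h.2.2, hb]
    · intro hx
      by_cases h1 : x = a
      · simp [h1]
      · by_cases h2 : x = b
        · simp [h2]
        · simp [h1, h2, hx]
  -- The default `a` is reached only beyond index `κ`, where nothing is claimed.
  have hblock : block κ (fun i => L.getD i a) 0 = f := by
    ext x
    rw [mem_block, ← hmem, List.mem_iff_getElem]
    constructor
    · rintro ⟨j, hj, rfl⟩
      refine ⟨j, by omega, ?_⟩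
      simpa only [zero_mul, zero_add] using (List.getD_eq_getElem L a (by omega)).symm
    · rintro ⟨j, hj, rfl⟩
      refine ⟨j, by omega, ?_⟩
      simpa only [zero_mul, zero_add] using List.getD_eq_getElem L a hj
  refine ⟨fun i => L.getD i a, ⟨fun x y hx hy hxy => ?_, fun i hi => ?_⟩, by simp [hL], ?_, hblock⟩
  · rw [one_mul] at hx hy
    have hx' : x < L.length := by omega
    have hy' : y < L.length := by omega
    simp only [List.getD_eq_getElem L a hx', List.getD_eq_getElem L a hy'] at hxy
    exact (List.Nodup.getElem_inj_iff hnd).1 hxy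
  · obtain rfl : i = 0 := by omega
    rw [hblock]; exact hf
  · simp only [hL]
    rw [← hRl]
    simp

end IsLoosePath

/-- Every choice of at least `h` vertices in each of the parts (fibres of `π`) in `e` spans a
member of `E` that has its vertices in the different parts in `e`. -/
def Hits (π : V → ι) (h : ℕ) (E : Set (Finset V)) (e : Finset ι) : Prop :=
  ∀ B : Finset V, (∀ P ∈ e, h ≤ (B.filter fun v => π v = P).card) →
    ∃ f ∈ E, f ⊆ B ∧ f.image π = e

/-- The set tested against `Hits` takes its vertices in `P` from `S`, those in `Q` from `T` and all
others from `N`. The edge found has one vertex per part, so listing it from `P` to `Q` leaves only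
vertices of `N` inside. -/
theorem Hits.exists_link {π : V → ι} {h κ : ℕ} {E : Set (Finset V)} {e : Finset ι}
    (hE : ∀ f ∈ E, f.card = κ + 1) (hit : Hits π h E e) (hcard : e.card = κ + 1) {P Q : ι}
    (hP : P ∈ e) (hQ : Q ∈ e) (hPQ : P ≠ Q) (S T N : Finset V)
    (hS : h ≤ (S.filter fun v => π v = P).card) (hT : h ≤ (T.filter fun v => π v = Q).card)
    (hN : ∀ R ∈ e, R ≠ P → R ≠ Q → h ≤ (N.filter fun v => π v = R).card) :
    ∃ w : ℕ → V, IsLoosePath κ E 1 w ∧ w 0 ∈ S ∧ π (w 0) = P ∧ w κ ∈ T ∧ π (w κ) = Q ∧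
      ∀ i, 0 < i → i < κ → w i ∈ N ∧ π (w i) ∈ e ∧ π (w i) ≠ P ∧ π (w i) ≠ Q := by
  obtain ⟨f, hfE, hfB, hfe⟩ := hit ((S.filter fun v => π v = P) ∪ (T.filter fun v => π v = Q) ∪
      N.filter fun v => π v ≠ P ∧ π v ≠ Q) (by
    intro R hR
    by_cases h1 : R = P
    · subst h1
      refine hS.trans (Finset.card_le_card fun x hx => ?_)
      simp only [Finset.mem_filter, Finset.mem_union] at hx ⊢
      tauto
    by_cases h2 : R = Q
    · subst h2
      refine hT.trans (Finset.card_le_card fun x hx => ?_)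
      simp only [Finset.mem_filter, Finset.mem_union] at hx ⊢
      tauto
    refine (hN R hR h1 h2).trans (Finset.card_le_card fun x hx => ?_)
    simp only [Finset.mem_filter, Finset.mem_union] at hx ⊢
    obtain ⟨hx, rfl⟩ := hx
    tauto)
  have hinj := injOn_of_image_eq hfe (by rw [hE f hfE, hcard])
  obtain ⟨a, ha, haP⟩ := Finset.mem_image.1 (show P ∈ f.image π by rw [hfe]; exact hP)
  obtain ⟨b, hb, hbQ⟩ := Finset.mem_image.1 (show Q ∈ f.image π by rw [hfe]; exact hQ)
  have hab : a ≠ b := fun hab => hPQ (by rw [← haP, ← hbQ, hab])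
  obtain ⟨w, hw, hwa, hwb, hwf⟩ := IsLoosePath.single hfE (hE f hfE) ha hb hab
  have haB := hfB ha
  have hbB := hfB hb
  simp only [Finset.mem_filter, Finset.mem_union] at haB hbB
  refine ⟨w, hw, ?_, hwa ▸ haP, ?_, hwb ▸ hbQ, fun i hi0 hiκ => ?_⟩
  · rw [hwa]; subst haP; tauto
  · rw [hwb]; subst hbQ; tauto
  · have hwi : w i ∈ f := by
      rw [← hwf, mem_block]
      exact ⟨i, hiκ.le, by simp⟩
    have h1 : π (w i) ≠ P := by
      intro hh
      have h2 := hinj _ hwi _ ha (hh.trans haP.symm)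
      rw [← hwa] at h2
      have := hw.inj _ _ (by omega) (by omega) h2
      omega
    have h2 : π (w i) ≠ Q := by
      intro hh
      have h2 := hinj _ hwi _ hb (hh.trans hbQ.symm)
      rw [← hwb] at h2
      have := hw.inj _ _ (by omega) (by omega) h2
      omega
    have h3 := hfB hwi
    simp only [Finset.mem_filter, Finset.mem_union] at h3
    exact ⟨by tauto, hfe ▸ Finset.mem_image_of_mem π hwi, h1, h2⟩

end LoosePaths

/-! ### Long alternating paths by depth-first search -/

section LongPaths

variable {V ι : Type*} [DecidableEq V] [DecidableEq ι]

/-- The first `m * κ + 1` terms of a sequence. -/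
def verts (κ m : ℕ) (v : ℕ → V) : Finset V := (Finset.range (m * κ + 1)).image v

theorem mem_verts {κ m : ℕ} {v : ℕ → V} {x : V} :
    x ∈ verts κ m v ↔ ∃ i ≤ m * κ, v i = x := by
  simp [verts]

/-- A loose path all of whose edges have type `e`, with its connecting vertices alternating between
the parts `a` and `b`. -/
structure IsAlternatingPath (π : V → ι) (κ : ℕ) (E : Set (Finset V)) (e : Finset ι) (a b : ι)
    (m : ℕ) (v : ℕ → V) : Prop where
  path : IsLoosePath κ {f | f ∈ E ∧ f.image π = e} m v
  alt : ∀ i ≤ m, π (v (i * κ)) = if i % 2 = 0 then a else b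

theorem exists_block_index {κ m x : ℕ} (hκ : 1 ≤ κ) (hm : 0 < m) (hx : x ≤ m * κ) :
    ∃ i < m, ∃ j ≤ κ, x = i * κ + j := by
  rcases hx.lt_or_eq with h | rfl
  · exact ⟨x / κ, (Nat.div_lt_iff_lt_mul hκ).2 h, x % κ, (Nat.mod_lt _ hκ).le,
      by rw [mul_comm]; exact (Nat.div_add_mod x κ).symm⟩
  · obtain ⟨m, rfl⟩ := Nat.exists_eq_succ_of_ne_zero hm.ne'
    exact ⟨m, by omega, κ, le_rfl, by rw [Nat.succ_mul]⟩

namespace IsAlternatingPath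

variable {π : V → ι} {κ m : ℕ} {E : Set (Finset V)} {e : Finset ι} {a b : ι} {v : ℕ → V}

theorem eq_of_mem_block (hE : ∀ f ∈ E, f.card = κ + 1) (hcard : e.card = κ + 1)
    (hv : IsAlternatingPath π κ E e a b m v) {i : ℕ} (hi : i < m) {j l : ℕ} (hj : j ≤ κ)
    (hl : l ≤ κ) (h : π (v (i * κ + j)) = π (v (i * κ + l))) :
    v (i * κ + j) = v (i * κ + l) := by
  obtain ⟨h1, h2⟩ := hv.path.edge i hi
  exact injOn_of_image_eq h2 (by rw [hE _ h1, hcard]) _ (mem_block.2 ⟨j, hj, rfl⟩) _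
    (mem_block.2 ⟨l, hl, rfl⟩) h

/-- Each block has one vertex in `c`, and its end whose index has parity `s` already lies there. So
the path meets `c` only in connecting vertices of that parity, about half as many as there are
edges. -/
theorem card_end_le (hE : ∀ f ∈ E, f.card = κ + 1) (hcard : e.card = κ + 1) (hκ : 1 ≤ κ)
    (hv : IsAlternatingPath π κ E e a b m v) (s : ℕ) (hs : s < 2) {c : ι}
    (hc : c = if s = 0 then a else b) (hab : a ≠ b) :
    ((verts κ m v).filter fun x => π x = c).card ≤ m / 2 + 1 := by
  have hsub : (verts κ m v).filter (fun x => π x = c) ⊆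
      (Finset.range (m / 2 + 1)).image fun t => v ((2 * t + s) * κ) := by
    intro x hx
    rw [Finset.mem_filter, mem_verts] at hx
    obtain ⟨⟨i, hi, rfl⟩, hxc⟩ := hx
    rw [Finset.mem_image]
    have key : ∀ q ≤ m, v i = v (q * κ) →
        ∃ t ∈ Finset.range (m / 2 + 1), v ((2 * t + s) * κ) = v i := by
      intro q hq hiq
      have hqs : q % 2 = s := by
        have h1 := hv.alt q hq
        rw [← hiq, hxc, hc] at h1
        split_ifs at h1 with h2 h3 h3
        · omega
        · exact absurd h1 hab
        · exact absurd h1.symm hab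
        · omega
      refine ⟨q / 2, by rw [Finset.mem_range]; omega, ?_⟩
      rw [hiq, show 2 * (q / 2) + s = q by omega]
    rcases Nat.eq_zero_or_pos m with rfl | hm
    · obtain rfl : i = 0 := by simpa using hi
      exact key 0 le_rfl (by simp)
    · obtain ⟨q, hq, j, hj, rfl⟩ := exists_block_index hκ hm hi
      by_cases hqs : q % 2 = s
      · refine key q hq.le ?_
        have := hv.eq_of_mem_block hE hcard hq hj (Nat.zero_le κ) (by
          rw [hxc, add_zero, hv.alt q hq.le, hc, hqs])
        simpa using this
      · refine key (q + 1) hq ?_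
        have := hv.eq_of_mem_block hE hcard hq hj le_rfl (by
          rw [hxc, show q * κ + κ = (q + 1) * κ by ring, hv.alt (q + 1) hq, hc]
          congr 1
          exact propext ⟨fun _ => by omega, fun _ => by omega⟩)
        rw [this]; congr 1; ring
  refine (Finset.card_le_card hsub).trans (Finset.card_image_le.trans ?_)
  simp

/-- One vertex per block. `P ≠ a` only serves the path without edges, whose single vertex lies in
`a`. -/
theorem card_inner_le (hE : ∀ f ∈ E, f.card = κ + 1) (hcard : e.card = κ + 1) (hκ : 1 ≤ κ)
    (hv : IsAlternatingPath π κ E e a b m v) {P : ι} (hPa : P ≠ a) :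
    ((verts κ m v).filter fun x => π x = P).card ≤ m := by
  rcases Nat.eq_zero_or_pos m with rfl | hm
  · rw [Nat.le_zero, Finset.card_eq_zero, Finset.filter_eq_empty_iff]
    intro x hx
    obtain ⟨i, hi, rfl⟩ := mem_verts.1 hx
    obtain rfl : i = 0 := by simpa using hi
    have := hv.alt 0 le_rfl
    simp only [zero_mul, Nat.zero_mod, if_true] at this
    rw [this]; exact hPa.symm
  have hsub : (verts κ m v).filter (fun x => π x = P) ⊆
      (Finset.range m).biUnion fun i => (block κ v i).filter fun x => π x = P := by
    intro x hx
    rw [Finset.mem_filter, mem_verts] at hx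
    obtain ⟨⟨i, hi, rfl⟩, hxc⟩ := hx
    obtain ⟨q, hq, j, hj, rfl⟩ := exists_block_index hκ hm hi
    rw [Finset.mem_biUnion]
    exact ⟨q, Finset.mem_range.2 hq, Finset.mem_filter.2 ⟨mem_block.2 ⟨j, hj, rfl⟩, hxc⟩⟩
  refine (Finset.card_le_card hsub).trans ((Finset.card_biUnion_le_card_mul _ _ 1 ?_).trans ?_)
  · intro i hi
    rw [Finset.card_le_one]
    intro x hx y hy
    rw [Finset.mem_filter] at hx hy
    obtain ⟨h1, h2⟩ := hv.path.edge i (Finset.mem_range.1 hi)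
    exact injOn_of_image_eq h2 (by rw [hE _ h1, hcard]) x hx.1 y hy.1 (hx.2.trans hy.2.symm)
  · simp

theorem mem_of_mem_verts (hκ : 1 ≤ κ) (ha : a ∈ e) (hv : IsAlternatingPath π κ E e a b m v) {x : V}
    (hx : x ∈ verts κ m v) : π x ∈ e := by
  obtain ⟨i, hi, rfl⟩ := mem_verts.1 hx
  rcases Nat.eq_zero_or_pos m with rfl | hm
  · obtain rfl : i = 0 := by simpa using hi
    have := hv.alt 0 le_rfl
    simp only [zero_mul, Nat.zero_mod, if_true] at this
    rwa [this]
  · obtain ⟨q, hq, j, hj, rfl⟩ := exists_block_index hκ hm hi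
    rw [← (hv.path.edge q hq).2]
    exact Finset.mem_image_of_mem π (mem_block.2 ⟨j, hj, rfl⟩)

end IsAlternatingPath

/-- A state of a depth-first search for an alternating path inside `U`: the current path, the set
`D` of the abandoned connecting vertices and the set `W` of the abandoned inner vertices. -/
structure SearchState (π : V → ι) (κ h : ℕ) (E : Set (Finset V)) (e : Finset ι) (a b : ι)
    (U : Finset V) (m : ℕ) (v : ℕ → V) (D W : Finset V) : Prop where
  path : IsAlternatingPath π κ E e a b m v
  sub : verts κ m v ⊆ U
  disjD : Disjoint (verts κ m v) D
  disjW : Disjoint (verts κ m v) W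
  typeD : ∀ x ∈ D, π x = a ∨ π x = b
  cardDa : (D.filter fun x => π x = a).card < h
  cardDb : (D.filter fun x => π x = b).card < h
  cardW : ∀ P, (W.filter fun x => π x = P).card ≤ D.card
  dead : ∀ x ∈ D, ∀ f ∈ E, f.image π = e → x ∈ f →
    ∃ y ∈ f, y ≠ x ∧ y ∉ U \ (verts κ m v ∪ D ∪ W)

/-- Otherwise `Hits`, applied to the dead vertices in `c` and the free ones in the other parts,
gives an edge through a dead vertex whose other vertices are all free. -/
theorem card_lt_of_dead {π : V → ι} {κ h : ℕ} {E : Set (Finset V)} {e : Finset ι}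
    (hE : ∀ f ∈ E, f.card = κ + 1) (hcard : e.card = κ + 1) (hit : Hits π h E e) {c : ι}
    (hc : c ∈ e) {D F : Finset V} (hF : ∀ P ∈ e, h ≤ (F.filter fun x => π x = P).card)
    (dead : ∀ x ∈ D, ∀ f ∈ E, f.image π = e → x ∈ f → ∃ y ∈ f, y ≠ x ∧ y ∉ F) :
    (D.filter fun x => π x = c).card < h := by
  by_contra! hD
  obtain ⟨f, hf, hfB, hfe⟩ := hit ((D.filter fun x => π x = c) ∪ F.filter fun x => π x ≠ c) (by
    intro P hP
    by_cases h1 : P = c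
    · subst h1
      refine hD.trans (Finset.card_le_card fun x hx => ?_)
      simp only [Finset.mem_filter, Finset.mem_union] at hx ⊢
      tauto
    · refine (hF P hP).trans (Finset.card_le_card fun x hx => ?_)
      simp only [Finset.mem_filter, Finset.mem_union] at hx ⊢
      obtain ⟨hx, rfl⟩ := hx
      tauto)
  obtain ⟨x, hxf, hxc⟩ := Finset.mem_image.1 (show c ∈ f.image π by rw [hfe]; exact hc)
  have hx := hfB hxf
  simp only [Finset.mem_filter, Finset.mem_union] at hx
  obtain ⟨y, hyf, hyx, hyF⟩ := dead x (by tauto) f hf hfe hxf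
  have hy := hfB hyf
  simp only [Finset.mem_filter, Finset.mem_union] at hy
  rcases hy with hy | hy
  · exact hyx (injOn_of_image_eq hfe (by rw [hE f hf, hcard]) y hyf x hxf (hy.2.trans hxc.symm))
  · exact hyF hy.1

/-- Since `m < 2 * u`, the path takes at most `u` vertices of `a` or `b` and fewer than `2 * u` of
any other part. `D` has fewer than `2 * h` vertices and `W` at most `D.card` in each part, so more
than `h` of the slack `5 * h` remains. -/
theorem SearchState.card_free {π : V → ι} {κ h : ℕ} {E : Set (Finset V)} {e : Finset ι} {a b : ι}
    {U : Finset V} {m : ℕ} {v : ℕ → V} {D W : Finset V} (hκ : 1 ≤ κ)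
    (hE : ∀ f ∈ E, f.card = κ + 1) (hcard : e.card = κ + 1) (hab : a ≠ b) {u : ℕ}
    (hUa : u + 1 + 5 * h ≤ (U.filter fun x => π x = a).card)
    (hUb : u + 1 + 5 * h ≤ (U.filter fun x => π x = b).card)
    (hUP : ∀ P ∈ e, P ≠ a → P ≠ b → 2 * u + 5 * h ≤ (U.filter fun x => π x = P).card)
    (hs : SearchState π κ h E e a b U m v D W) (hm : m < 2 * u) :
    ∀ P ∈ e, h < ((U \ (verts κ m v ∪ D ∪ W)).filter fun x => π x = P).card := by
  intro P hP
  have hD : D.card < 2 * h := by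
    have : D ⊆ (D.filter fun x => π x = a) ∪ D.filter fun x => π x = b := by
      intro x hx
      have := hs.typeD x hx
      simp only [Finset.mem_union, Finset.mem_filter]
      tauto
    have h1 := (Finset.card_le_card this).trans (Finset.card_union_le _ _)
    have := hs.cardDa
    have := hs.cardDb
    omega
  have hDP : (D.filter fun x => π x = P).card ≤ D.card := Finset.card_filter_le _ _
  have hW := hs.cardW P
  have hcov : (U.filter fun x => π x = P) ⊆
      ((U \ (verts κ m v ∪ D ∪ W)).filter fun x => π x = P) ∪
      ((verts κ m v).filter fun x => π x = P) ∪ (D.filter fun x => π x = P) ∪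
      W.filter fun x => π x = P := by
    intro x hx
    simp only [Finset.mem_union, Finset.mem_filter, Finset.mem_sdiff] at hx ⊢
    tauto
  have h1 := Finset.card_le_card hcov
  have h2 := Finset.card_union_le (((U \ (verts κ m v ∪ D ∪ W)).filter fun x => π x = P) ∪
      ((verts κ m v).filter fun x => π x = P) ∪ (D.filter fun x => π x = P))
      (W.filter fun x => π x = P)
  have h3 := Finset.card_union_le (((U \ (verts κ m v ∪ D ∪ W)).filter fun x => π x = P) ∪
      ((verts κ m v).filter fun x => π x = P)) (D.filter fun x => π x = P)
  have h4 := Finset.card_union_le ((U \ (verts κ m v ∪ D ∪ W)).filter fun x => π x = P)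
      ((verts κ m v).filter fun x => π x = P)
  by_cases hPa : P = a
  · have := hs.path.card_end_le hE hcard hκ 0 (by omega) (c := P) (by simp [hPa]) hab
    rw [← hPa] at hUa
    omega
  by_cases hPb : P = b
  · have := hs.path.card_end_le hE hcard hκ 1 (by omega) (c := P) (by simp [hPb]) hab
    rw [← hPb] at hUb
    omega
  have := hs.path.card_inner_le hE hcard hκ hPa
  have := hUP P hP hPa hPb
  omega

theorem IsAlternatingPath.extend {π : V → ι} {κ : ℕ} {E : Set (Finset V)} {e : Finset ι} {a b : ι}
    {m : ℕ} {v : ℕ → V} (hE : ∀ f ∈ E, f.card = κ + 1)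
    (hab : a ≠ b) (ha : a ∈ e) (hb : b ∈ e) (hv : IsAlternatingPath π κ E e a b m v) {f : Finset V}
    (hf : f ∈ E) (hfe : f.image π = e) (hx : v (m * κ) ∈ f)
    (hdisj : ∀ y ∈ f, y ≠ v (m * κ) → y ∉ verts κ m v) :
    ∃ w, IsAlternatingPath π κ E e a b (m + 1) w ∧ verts κ (m + 1) w = verts κ m v ∪ f := by
  obtain ⟨c, hc, hce⟩ : ∃ c, (c = if (m + 1) % 2 = 0 then a else b) ∧ c ∈ e :=
    ⟨_, rfl, by split_ifs <;> assumption⟩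
  obtain ⟨y, hyf, hyc⟩ := Finset.mem_image.1 (show c ∈ f.image π by rw [hfe]; exact hce)
  have hxy : v (m * κ) ≠ y := by
    intro hxy
    have h1 := hv.alt m le_rfl
    rw [hxy, hyc, hc] at h1
    split_ifs at h1 with h2 h3 h3
    · omega
    · exact hab h1
    · exact hab h1.symm
    · omega
  obtain ⟨w, hw, hw0, hwκ, hwf⟩ := IsLoosePath.single
    (show f ∈ {f | f ∈ E ∧ f.image π = e} from ⟨hf, hfe⟩) (hE f hf) hx hyf hxy
  have hwf' : ∀ j ≤ κ, w j ∈ f := fun j hj => by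
    rw [← hwf, mem_block]; exact ⟨j, hj, by simp⟩
  refine ⟨LooseCycles.glue (m * κ) v w, ⟨hv.path.glue hw hw0.symm ?_, ?_⟩, ?_⟩
  · intro i hi j hj0 hj hij
    rw [one_mul] at hj
    refine hdisj (w j) (hwf' j hj) ?_ (mem_verts.2 ⟨i, hi, hij⟩)
    rw [← hw0]
    intro h
    have := hw.inj j 0 (by omega) (by omega) h
    omega
  · intro i hi
    rcases hi.lt_or_eq with h | rfl
    · rw [glue_of_le _ _ (Nat.mul_le_mul_right κ (by omega : i ≤ m))]
      exact hv.alt i (by omega)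
    · rw [show (m + 1) * κ = m * κ + κ by ring, glue_add hw0.symm, hwκ, hyc, hc]
  · ext z
    rw [Finset.mem_union, mem_verts, mem_verts]
    constructor
    · rintro ⟨i, hi, rfl⟩
      rw [add_mul, one_mul] at hi
      by_cases h : i ≤ m * κ
      · left; exact ⟨i, h, (glue_of_le _ _ h).symm⟩
      · obtain ⟨j, rfl⟩ := Nat.exists_eq_add_of_le (not_le.1 h).le
        right
        rw [glue_add hw0.symm]
        exact hwf' j (by omega)
    · rintro (⟨i, hi, rfl⟩ | hz)
      · exact ⟨i, by rw [add_mul]; omega, glue_of_le _ _ hi⟩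
      · rw [← hwf, mem_block] at hz
        obtain ⟨j, hj, rfl⟩ := hz
        refine ⟨m * κ + j, by rw [add_mul]; omega, ?_⟩
        rw [glue_add hw0.symm]; simp

-- The potential `2 * D.card + m` grows with every move: an extension adds one to `m`, and when the
-- last vertex dies, `D` gains one while `m` drops by at most one.
set_option maxHeartbeats 800000 in
theorem SearchState.step {π : V → ι} {κ h : ℕ} {E : Set (Finset V)} {e : Finset ι} {a b : ι}
    {U : Finset V} {m : ℕ} {v : ℕ → V} {D W : Finset V} (hκ : 1 ≤ κ)
    (hE : ∀ f ∈ E, f.card = κ + 1) (hcard : e.card = κ + 1) (hit : Hits π h E e) (hab : a ≠ b)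
    (ha : a ∈ e) (hb : b ∈ e) {u : ℕ}
    (hUa : u + 1 + 5 * h ≤ (U.filter fun x => π x = a).card)
    (hUb : u + 1 + 5 * h ≤ (U.filter fun x => π x = b).card)
    (hUP : ∀ P ∈ e, P ≠ a → P ≠ b → 2 * u + 5 * h ≤ (U.filter fun x => π x = P).card)
    (hs : SearchState π κ h E e a b U m v D W) (hm : m < 2 * u) :
    (∃ w, IsAlternatingPath π κ E e a b (2 * u) w ∧ verts κ (2 * u) w ⊆ U) ∨
    ∃ m' v' D' W', SearchState π κ h E e a b U m' v' D' W' ∧ m' < 2 * u ∧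
      2 * D.card + m < 2 * D'.card + m' := by
  have hfree := hs.card_free hκ hE hcard hab hUa hUb hUP hm
  set F := U \ (verts κ m v ∪ D ∪ W) with hF
  set x := v (m * κ) with hx
  have hxv : x ∈ verts κ m v := mem_verts.2 ⟨_, le_rfl, rfl⟩
  have hxF : x ∉ F := by simp [hF, hxv]
  by_cases hext : ∃ f ∈ E, f.image π = e ∧ x ∈ f ∧ ∀ y ∈ f, y ≠ x → y ∈ F
  · obtain ⟨f, hf, hfe, hxf, hfF⟩ := hext
    have hfF' : ∀ y ∈ f, y ≠ x → y ∈ U ∧ y ∉ verts κ m v ∧ y ∉ D ∧ y ∉ W := by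
      intro y hy hyx
      have := hfF y hy hyx
      simp only [hF, Finset.mem_sdiff, Finset.mem_union] at this
      tauto
    obtain ⟨w, hw, hwv⟩ := hs.path.extend hE hab ha hb hf hfe hxf fun y hy hyx => (hfF' y hy hyx).2.1
    have hsub : verts κ (m + 1) w ⊆ U := by
      rw [hwv]
      refine Finset.union_subset hs.sub fun y hy => ?_
      by_cases h : y = x
      · rw [h]; exact hs.sub hxv
      · exact (hfF' y hy h).1
    by_cases hmu : m + 1 = 2 * u
    · left; rw [← hmu]; exact ⟨w, hw, hsub⟩
    right
    refine ⟨m + 1, w, D, W, ⟨hw, hsub, ?_, ?_, hs.typeD, hs.cardDa, hs.cardDb, hs.cardW, ?_⟩,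
      by omega, by omega⟩
    · rw [hwv, Finset.disjoint_union_left]
      refine ⟨hs.disjD, Finset.disjoint_left.2 fun y hy => ?_⟩
      by_cases h : y = x
      · rw [h]; exact Finset.disjoint_left.1 hs.disjD hxv
      · exact (hfF' y hy h).2.2.1
    · rw [hwv, Finset.disjoint_union_left]
      refine ⟨hs.disjW, Finset.disjoint_left.2 fun y hy => ?_⟩
      by_cases h : y = x
      · rw [h]; exact Finset.disjoint_left.1 hs.disjW hxv
      · exact (hfF' y hy h).2.2.2
    · intro z hz g hg hge hzg
      obtain ⟨y, hyg, hyz, hyF⟩ := hs.dead z hz g hg hge hzg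
      refine ⟨y, hyg, hyz, fun hy => hyF ?_⟩
      rw [hwv] at hy
      simp only [Finset.mem_sdiff, Finset.mem_union] at hy ⊢
      tauto
  right
  push Not at hext
  have hxD : x ∉ D := Finset.disjoint_left.1 hs.disjD hxv
  -- The end `x` cannot be extended into the free set, so it joins the dead vertices.
  have hdead : ∀ z ∈ insert x D, ∀ f ∈ E, f.image π = e → z ∈ f → ∃ y ∈ f, y ≠ z ∧ y ∉ F := by
    intro z hz f hf hfe hzf
    rcases Finset.mem_insert.1 hz with rfl | hz
    · exact hext f hf hfe hzf
    · exact hs.dead z hz f hf hfe hzf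
  have hF' : ∀ P ∈ e, h ≤ (F.filter fun x => π x = P).card := fun P hP => (hfree P hP).le
  have hDa := card_lt_of_dead hE hcard hit ha hF' hdead
  have hDb := card_lt_of_dead hE hcard hit hb hF' hdead
  have htype : ∀ z ∈ insert x D, π z = a ∨ π z = b := by
    intro z hz
    rcases Finset.mem_insert.1 hz with rfl | hz
    · have := hs.path.alt m le_rfl
      rw [hx, this]; split_ifs <;> simp
    · exact hs.typeD z hz
  have hDcard : (insert x D).card = D.card + 1 := Finset.card_insert_of_notMem hxD
  rcases Nat.eq_zero_or_pos m with rfl | hmpos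
  -- A path consisting of `x` alone is replaced by a fresh free vertex of `a`.
  · obtain ⟨z, hz⟩ := Finset.card_pos.1 (Nat.zero_lt_of_lt (hfree a ha))
    obtain ⟨hzF, hza⟩ := Finset.mem_filter.1 hz
    have hzx : z ≠ x := fun h => hxF (h ▸ hzF)
    have hzF' : z ∈ U ∧ z ∉ D ∧ z ∉ W := by
      simp only [hF, Finset.mem_sdiff, Finset.mem_union] at hzF
      tauto
    have hvz : verts κ 0 (fun _ => z) = {z} := by simp [verts]
    have hvx : verts κ 0 v = {x} := by simp [verts, hx]
    refine ⟨0, fun _ => z, insert x D, W, ⟨⟨⟨?_, fun i hi => absurd hi (by omega)⟩, ?_⟩, ?_, ?_, ?_,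
      htype, hDa, hDb, fun P => ?_, ?_⟩, hm, by omega⟩
    · intro i j hi hj _
      omega
    · intro i hi
      obtain rfl : i = 0 := by omega
      simpa using hza
    · rw [hvz]; simpa using hzF'.1
    · rw [hvz]; simp [hzx, hzF'.2.1]
    · rw [hvz]; simp [hzF'.2.2]
    · have := hs.cardW P
      omega
    · intro y hy f hf hfe hyf
      obtain ⟨y', h1, h2, h3⟩ := hdead y hy f hf hfe hyf
      refine ⟨y', h1, h2, fun h4 => h3 ?_⟩
      rw [hvz] at h4
      rw [hF, hvx]
      simp only [Finset.mem_sdiff, Finset.mem_union, Finset.mem_singleton, Finset.mem_insert]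
        at h4 ⊢
      tauto
  obtain ⟨n, rfl⟩ := Nat.exists_eq_succ_of_ne_zero hmpos.ne'
  have hsucc : n.succ * κ = n * κ + κ := Nat.succ_mul n κ
  have hvv : verts κ n v ⊆ verts κ n.succ v := by
    intro y hy
    obtain ⟨i, hi, rfl⟩ := mem_verts.1 hy
    exact mem_verts.2 ⟨i, by omega, rfl⟩
  have hbv : block κ v n ⊆ verts κ n.succ v := by
    intro y hy
    obtain ⟨i, hi, rfl⟩ := mem_block.1 hy
    exact mem_verts.2 ⟨n * κ + i, by omega, rfl⟩
  have hbn : ∀ y ∈ block κ v n, y ≠ v (n * κ) → y ∉ verts κ n v := by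
    intro y hy hne hyv
    obtain ⟨i, hi, rfl⟩ := mem_block.1 hy
    obtain ⟨j, hj, hji⟩ := mem_verts.1 hyv
    have := hs.path.path.inj _ _ (by omega) (by omega) hji
    exact hne (by congr 1; omega)
  have hxb : x ∈ block κ v n := mem_block.2 ⟨κ, le_rfl, by rw [hx, hsucc]⟩
  have hxn : x ≠ v (n * κ) := by
    intro h
    have := hs.path.path.inj _ _ (by omega) (by omega) h
    omega
  have hvunion : verts κ n.succ v = verts κ n v ∪ block κ v n := by
    refine Finset.Subset.antisymm (fun y hy => ?_) (Finset.union_subset hvv hbv)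
    obtain ⟨i, hi, rfl⟩ := mem_verts.1 hy
    rw [Finset.mem_union, mem_verts, mem_block]
    by_cases h : i ≤ n * κ
    · exact Or.inl ⟨i, h, rfl⟩
    · exact Or.inr ⟨i - n * κ, by omega, by congr 1; omega⟩
  set W' := W ∪ (block κ v n).filter fun y => y ≠ v (n * κ) ∧ y ≠ x with hW'
  -- Backtracking moves the last block, except its first vertex, from the path to `D` and `W`. The
  -- free set does not change, so dead vertices stay dead.
  have hFeq : U \ (verts κ n v ∪ insert x D ∪ W') = F := by
    rw [hF, hvunion, hW']
    ext y
    have h1 : y = v (n * κ) → y ∈ verts κ n v := fun h => mem_verts.2 ⟨_, le_rfl, h.symm⟩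
    have h2 : y = x → y ∈ block κ v n := fun h => h ▸ hxb
    simp only [Finset.mem_sdiff, Finset.mem_union, Finset.mem_insert, Finset.mem_filter]
    tauto
  refine ⟨n, v, insert x D, W', ⟨⟨hs.path.path.take (Nat.le_succ n), fun i hi =>
    hs.path.alt i (by omega)⟩, hvv.trans hs.sub, ?_, ?_, htype, hDa, hDb, fun P => ?_, ?_⟩,
    by omega, by omega⟩
  · rw [Finset.disjoint_insert_right]
    exact ⟨hbn x hxb hxn, hs.disjD.mono_left hvv⟩
  · rw [hW', Finset.disjoint_union_right]
    refine ⟨hs.disjW.mono_left hvv, Finset.disjoint_right.2 fun y hy => ?_⟩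
    rw [Finset.mem_filter] at hy
    exact hbn y hy.1 hy.2.1
  · rw [hW', Finset.filter_union, hDcard]
    refine (Finset.card_union_le _ _).trans (Nat.add_le_add (hs.cardW P) ?_)
    rw [Finset.card_le_one]
    intro y hy z hz
    simp only [Finset.mem_filter] at hy hz
    obtain ⟨h1, h2⟩ := hs.path.path.edge n (Nat.lt_succ_self n)
    exact injOn_of_image_eq h2 (by rw [hE _ h1, hcard]) y hy.1.1 z hz.1.1 (hy.2.trans hz.2.symm)
  · rw [hFeq]; exact hdead

/-- Depth-first search finds a long alternating path in every sufficiently large set. -/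
theorem Hits.exists_alternatingPath {π : V → ι} {κ h : ℕ} {E : Set (Finset V)} {e : Finset ι}
    {a b : ι} {U : Finset V} (hκ : 1 ≤ κ) (hh : 1 ≤ h)
    (hE : ∀ f ∈ E, f.card = κ + 1) (hcard : e.card = κ + 1) (hit : Hits π h E e) (hab : a ≠ b)
    (ha : a ∈ e) (hb : b ∈ e) {u : ℕ} (hu : 1 ≤ u)
    (hUa : u + 1 + 5 * h ≤ (U.filter fun x => π x = a).card)
    (hUb : u + 1 + 5 * h ≤ (U.filter fun x => π x = b).card)
    (hUP : ∀ P ∈ e, P ≠ a → P ≠ b → 2 * u + 5 * h ≤ (U.filter fun x => π x = P).card) :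
    ∃ w, IsAlternatingPath π κ E e a b (2 * u) w ∧ verts κ (2 * u) w ⊆ U := by
  by_contra hno
  have key : ∀ N : ℕ, ∃ m v D W, SearchState π κ h E e a b U m v D W ∧ m < 2 * u ∧
      N ≤ 2 * D.card + m := by
    intro N
    induction N with
    | zero =>
      obtain ⟨z, hz⟩ := Finset.card_pos.1 (show 0 < (U.filter fun x => π x = a).card by omega)
      obtain ⟨hzU, hza⟩ := Finset.mem_filter.1 hz
      refine ⟨0, fun _ => z, ∅, ∅, ⟨⟨⟨fun i j hi hj _ => by omega, fun i hi =>
        absurd hi (by omega)⟩, fun i hi => ?_⟩, ?_, by simp, by simp, by simp, by simpa,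
        by simpa, by simp, by simp⟩, by omega, by omega⟩
      · obtain rfl : i = 0 := by omega
        simpa using hza
      · simpa [verts] using hzU
    | succ N ih =>
      obtain ⟨m, v, D, W, hs, hm, hN⟩ := ih
      rcases hs.step hκ hE hcard hit hab ha hb hUa hUb hUP hm with h | ⟨m', v', D', W', h1, h2, h3⟩
      · exact absurd h hno
      · exact ⟨m', v', D', W', h1, h2, by omega⟩
  -- The potential stays below this value: each of the two parts has fewer than `h` dead vertices,
  -- and `m < 2 * u`.
  obtain ⟨m, v, D, W, hs, hm, hN⟩ := key (4 * h + 2 * u)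
  have : D ⊆ (D.filter fun x => π x = a) ∪ D.filter fun x => π x = b := by
    intro x hx
    have := hs.typeD x hx
    simp only [Finset.mem_union, Finset.mem_filter]
    tauto
  have h1 := (Finset.card_le_card this).trans (Finset.card_union_le _ _)
  have := hs.cardDa
  have := hs.cardDb
  omega

end LongPaths

/-! ### Connecting paths through the reservoirs -/

section Connecting

variable {V ι : Type*}

/-- Distinct parts are joined when a member of `𝓗` contains both. -/
def linkGraph (𝓗 : Set (Finset ι)) : SimpleGraph ι where
  Adj P Q := P ≠ Q ∧ ∃ e ∈ 𝓗, P ∈ e ∧ Q ∈ e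
  symm := ⟨fun _ _ h => ⟨h.1.symm, h.2.imp fun _ he => ⟨he.1, he.2.2, he.2.1⟩⟩⟩
  loopless := ⟨fun _ h => h.1 rfl⟩

/-- The second vertex of a geodesic. As `dist` is `0` between different components, reachability is
carried along separately. -/
theorem exists_adj_dist_eq {G : SimpleGraph ι} {P b : ι} {j : ℕ} (hP : G.Reachable P b)
    (hj : G.dist P b = j + 1) : ∃ Q, G.Adj P Q ∧ G.Reachable Q b ∧ G.dist Q b = j := by
  obtain ⟨p, hp⟩ := hP.exists_walk_length_eq_dist
  rw [hj] at hp
  cases p with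
  | nil => simp at hp
  | cons hadj q =>
    rename_i Q
    refine ⟨Q, hadj, q.reachable, ?_⟩
    have h1 := SimpleGraph.dist_le q
    obtain ⟨q', hq'⟩ := q.reachable.exists_walk_length_eq_dist
    have h2 := SimpleGraph.dist_le (SimpleGraph.Walk.cons hadj q')
    simp only [SimpleGraph.Walk.length_cons] at hp h2
    omega

theorem dist_le_succ_of_adj {G : SimpleGraph ι} {P Q b : ι} (hQ : G.Reachable Q b)
    (h : G.Adj P Q) : G.dist P b ≤ G.dist Q b + 1 := by
  obtain ⟨q', hq'⟩ := hQ.exists_walk_length_eq_dist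
  have h2 := SimpleGraph.dist_le (SimpleGraph.Walk.cons h q')
  rw [← hq']; simpa using h2

theorem dist_lt_card [Fintype ι] {G : SimpleGraph ι} {P b : ι} (hP : G.Reachable P b) :
    G.dist P b < Fintype.card ι := by
  obtain ⟨p, hp, hl⟩ := hP.exists_path_of_dist
  rw [← hl]; exact hp.length_lt

variable [Fintype V] [DecidableEq V] [DecidableEq ι]

/-- The vertices of the part `P` with label `i` that are not in `Z`. -/
def slot (π : V → ι) (ρ : V → ℕ) (Z : Finset V) (P : ι) (i : ℕ) : Finset V :=
  Finset.univ.filter fun x => π x = P ∧ ρ x = i ∧ x ∉ Z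

theorem mem_slot {π : V → ι} {ρ : V → ℕ} {Z : Finset V} {P : ι} {i : ℕ} {x : V} :
    x ∈ slot π ρ Z P i ↔ π x = P ∧ ρ x = i ∧ x ∉ Z := by
  simp [slot]

/-- The vertices that a connecting path may use before its end when it starts in a part at
distance `j` from the target: labels `1` and `2` are for inner vertices, `3` for connecting ones and
`5` for the inner vertices of the last edge. -/
def Allowed (π : V → ι) (ρ : V → ℕ) (Z : Finset V) (d : ι → ℕ) (j : ℕ) (x : V) : Prop :=
  x ∉ Z ∧ (ρ x = 5 ∨ ρ x = 3 ∧ d (π x) ≤ j ∨ ρ x = 1 ∧ d (π x) ≤ j ∨ ρ x = 2 ∧ d (π x) + 1 ≤ j)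

/-- There is a loose path with `j + 1` edges from `z` to `X` that uses only allowed vertices. -/
def Reaches (π : V → ι) (ρ : V → ℕ) (κ : ℕ) (E : Set (Finset V)) (Z X : Finset V) (d : ι → ℕ)
    (j : ℕ) (z : V) : Prop :=
  ∃ w, IsLoosePath κ E (j + 1) w ∧ w 0 = z ∧ w ((j + 1) * κ) ∈ X ∧
    ∀ i < (j + 1) * κ, Allowed π ρ Z d j (w i)

-- Induction on the distance to `b`. Suppose `h` vertices of `P` failed. At least `h` vertices of a
-- part `Q` one step closer do reach `X`, so `Hits` gives an edge from a failing vertex to one of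
-- these, and that edge can be put in front of its path. The labels keep the new edge disjoint from
-- the path behind it.
open Classical in
theorem card_not_reaches_lt {π : V → ι} {ρ : V → ℕ} {h κ : ℕ} {E : Set (Finset V)}
    {𝓗 : Set (Finset ι)} {Z X : Finset V} {a b : ι} {e : Finset ι} (hκ : 1 ≤ κ)
    (hE : ∀ f ∈ E, f.card = κ + 1) (h𝓗 : ∀ e ∈ 𝓗, e.card = κ + 1 ∧ Hits π h E e)
    (hres : ∀ e ∈ 𝓗, ∀ P ∈ e, ∀ i, 1 ≤ i → i ≤ 5 → 2 * h ≤ (slot π ρ Z P i).card)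
    (he : e ∈ 𝓗) (ha : a ∈ e) (hb : b ∈ e) (hab : a ≠ b)
    (hX : ∀ x ∈ X, ρ x = 0 ∧ π x = a) (hXc : h ≤ X.card) (j : ℕ) :
    ∀ P, (linkGraph 𝓗).Reachable P b → (linkGraph 𝓗).dist P b = j →
      ((slot π ρ Z P 3).filter fun z =>
        ¬ Reaches π ρ κ E Z X (fun Q => (linkGraph 𝓗).dist Q b) j z).card < h := by
  have hslot : ∀ e ∈ 𝓗, ∀ P ∈ e, ∀ i, 1 ≤ i → i ≤ 5 →
      h ≤ (slot π ρ Z P i).card := fun e he P hP i h1 h5 => by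
    have := hres e he P hP i h1 h5
    omega
  induction j with
  | zero =>
    intro P hP hPd
    obtain rfl : P = b := by
      rcases SimpleGraph.dist_eq_zero_iff_eq_or_not_reachable.1 hPd with h | h
      exacts [h, absurd hP h]
    by_contra! hbad
    obtain ⟨w, hw, hw0, hw0P, hwX, -, hwN⟩ := (h𝓗 e he).2.exists_link hE (h𝓗 e he).1 hb ha hab.symm
      ((slot π ρ Z P 3).filter fun z =>
        ¬ Reaches π ρ κ E Z X (fun Q => (linkGraph 𝓗).dist Q P) 0 z) X
      (Finset.univ.filter fun x => ρ x = 5 ∧ x ∉ Z)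
      (hbad.trans (Finset.card_le_card fun x hx => by
        simp only [Finset.mem_filter, mem_slot] at hx ⊢
        tauto))
      (hXc.trans (Finset.card_le_card fun x hx => Finset.mem_filter.2 ⟨hx, (hX x hx).2⟩))
      fun R hR _ _ => (hslot e he R hR 5 (by omega) (by omega)).trans
        (Finset.card_le_card fun x hx => by
          simp only [Finset.mem_filter, mem_slot, Finset.mem_univ, true_and] at hx ⊢
          tauto)
    rw [Finset.mem_filter, mem_slot] at hw0
    refine hw0.2 ⟨w, hw, rfl, by simpa using hwX, fun i hi => ?_⟩
    rw [zero_add, one_mul] at hi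
    rcases Nat.eq_zero_or_pos i with rfl | hi0
    · exact ⟨hw0.1.2.2, Or.inr (Or.inl ⟨hw0.1.2.1, by rw [hw0P]; simp⟩)⟩
    · have := (hwN i hi0 hi).1
      rw [Finset.mem_filter] at this
      exact ⟨this.2.2, Or.inl this.2.1⟩
  | succ j ih =>
    intro P hP hPd
    obtain ⟨Q, hPQ, hQ, hQd⟩ := exists_adj_dist_eq hP hPd
    have ihQ := ih Q hQ hQd
    obtain ⟨hne, e', he', hPe, hQe⟩ := hPQ
    set d := fun Q => (linkGraph 𝓗).dist Q b with hd
    by_contra! hbad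
    have hgood : h ≤ ((slot π ρ Z Q 3).filter fun z => Reaches π ρ κ E Z X d j z).card := by
      have h1 := Finset.card_filter_add_card_filter_not (s := slot π ρ Z Q 3)
        (fun z => Reaches π ρ κ E Z X d j z)
      have h2 := hres e' he' Q hQe 3 (by omega) (by omega)
      omega
    -- `R` shares `e'` with both `P` and `Q`, which lie at distances `j + 1` and `j`.
    have hdR : ∀ R ∈ e', R ≠ P → R ≠ Q → d R = j + 1 ∨ d R = j := by
      intro R hR hRP hRQ
      have h1 := dist_le_succ_of_adj hQ (P := R) ⟨hRQ, e', he', hR, hQe⟩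
      have hRr : (linkGraph 𝓗).Reachable R b :=
        (SimpleGraph.Adj.reachable (show (linkGraph 𝓗).Adj R Q from ⟨hRQ, e', he', hR, hQe⟩)).trans
          hQ
      have h2 := dist_le_succ_of_adj hRr (P := P) ⟨hRP.symm, e', he', hPe, hR⟩
      simp only [hd]
      omega
    obtain ⟨w, hw, hw0, hw0P, hwX, hwQ, hwN⟩ := (h𝓗 e' he').2.exists_link hE (h𝓗 e' he').1 hPe hQe
      hne ((slot π ρ Z P 3).filter fun z => ¬ Reaches π ρ κ E Z X d (j + 1) z)
      ((slot π ρ Z Q 3).filter fun z => Reaches π ρ κ E Z X d j z)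
      (Finset.univ.filter fun x => (ρ x = 1 ∧ d (π x) = j + 1 ∨ ρ x = 2 ∧ d (π x) = j) ∧ x ∉ Z)
      (hbad.trans (Finset.card_le_card fun x hx => by
        simp only [Finset.mem_filter, mem_slot] at hx ⊢
        tauto))
      (hgood.trans (Finset.card_le_card fun x hx => by
        simp only [Finset.mem_filter, mem_slot] at hx ⊢
        tauto))
      fun R hR hRP hRQ => by
        rcases hdR R hR hRP hRQ with h1 | h1
        · refine (hslot e' he' R hR 1 (by omega) (by omega)).trans
            (Finset.card_le_card fun x hx => ?_)
          simp only [Finset.mem_filter, mem_slot, Finset.mem_univ, true_and] at hx ⊢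
          exact ⟨⟨Or.inl ⟨hx.2.1, by rw [hx.1, h1]⟩, hx.2.2⟩, hx.1⟩
        · refine (hslot e' he' R hR 2 (by omega) (by omega)).trans
            (Finset.card_le_card fun x hx => ?_)
          simp only [Finset.mem_filter, mem_slot, Finset.mem_univ, true_and] at hx ⊢
          exact ⟨⟨Or.inr ⟨hx.2.1, by rw [hx.1, h1]⟩, hx.2.2⟩, hx.1⟩
    rw [Finset.mem_filter, mem_slot] at hw0
    rw [Finset.mem_filter] at hwX
    obtain ⟨w', hw', hw'0, hw'X, hw'A⟩ := hwX.2
    -- Labels `1` and `3` at distance `j + 1` and label `2` at distance `j` become allowed only at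
    -- stage `j + 1`, so the new edge avoids the tail, which was built at stage `j`.
    have hnew : ∀ i < κ, Allowed π ρ Z d (j + 1) (w i) ∧ ¬ Allowed π ρ Z d j (w i) ∧
        ρ (w i) ≠ 0 := by
      intro i hi
      have hdP : d P = j + 1 := hPd
      unfold Allowed
      rcases Nat.eq_zero_or_pos i with rfl | hi0
      · have h3 := hw0.1.2.1
        rw [hw0P, hdP, h3]
        simp [hw0.1.2.2]
      · have h3 := (hwN i hi0 hi).1
        simp only [Finset.mem_filter, Finset.mem_univ, true_and] at h3
        obtain ⟨⟨h1, h2⟩ | ⟨h1, h2⟩, h4⟩ := h3 <;> rw [h1, h2] <;> simp [h4]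
    have hglue : w (1 * κ) = w' 0 := by rw [one_mul, hw'0]
    refine hw0.2 ⟨glue (1 * κ) w w', ?_, glue_of_le _ _ (by omega), ?_, fun i hi => ?_⟩
    · rw [show j + 1 + 1 = 1 + (j + 1) by ring]
      refine hw.glue hw' hglue fun i hi l hl0 hl hil => ?_
      rw [one_mul] at hi
      rcases hi.lt_or_eq with hi | rfl
      · rcases hl.lt_or_eq with hl | rfl
        · exact (hnew i hi).2.1 (hil ▸ hw'A l hl)
        · exact (hnew i hi).2.2 (hil ▸ (hX _ hw'X).1)
      · rw [← hw'0] at hil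
        have := hw'.inj 0 l (by omega) hl hil
        omega
    · rw [show (j + 1 + 1) * κ = 1 * κ + (j + 1) * κ by ring, glue_add hglue]
      exact hw'X
    · by_cases hik : i < κ
      · rw [glue_of_le _ _ (by omega)]
        exact (hnew i hik).1
      · obtain ⟨l, rfl⟩ := Nat.exists_eq_add_of_le (not_lt.1 hik)
        rw [show κ + l = 1 * κ + l by ring, glue_add hglue]
        have := hw'A l (by rw [add_mul, one_mul] at hi; omega)
        unfold Allowed at this ⊢
        refine ⟨this.1, ?_⟩
        rcases this.2 with h | h | h | h
        · exact Or.inl h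
        · exact Or.inr (Or.inl ⟨h.1, by omega⟩)
        · exact Or.inr (Or.inr (Or.inl ⟨h.1, by omega⟩))
        · exact Or.inr (Or.inr (Or.inr ⟨h.1, by omega⟩))

/-- Two large sets in parts of the same component are joined by a short loose path whose inner
vertices lie in the reservoirs, outside a given small set. -/
theorem exists_connecting_path [Fintype ι] {π : V → ι} {ρ : V → ℕ} {h κ : ℕ} {E : Set (Finset V)}
    {𝓗 : Set (Finset ι)} {Z X Y : Finset V} {a b a' b' : ι} {e e' : Finset ι} (hκ : 1 ≤ κ)
    (hE : ∀ f ∈ E, f.card = κ + 1) (h𝓗 : ∀ e ∈ 𝓗, e.card = κ + 1 ∧ Hits π h E e)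
    (hres : ∀ e ∈ 𝓗, ∀ P ∈ e, ∀ i, 1 ≤ i → i ≤ 5 → 2 * h ≤ (slot π ρ Z P i).card)
    (he : e ∈ 𝓗) (ha : a ∈ e) (hb : b ∈ e) (hab : a ≠ b)
    (he' : e' ∈ 𝓗) (ha' : a' ∈ e') (hb' : b' ∈ e') (hab' : a' ≠ b')
    (hreach : (linkGraph 𝓗).Reachable b b')
    (hX : ∀ x ∈ X, ρ x = 0 ∧ π x = a') (hXc : h ≤ X.card)
    (hY : ∀ x ∈ Y, ρ x = 0 ∧ π x = a) (hYc : h ≤ Y.card) (hXY : Disjoint X Y) :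
    ∃ m w, 1 ≤ m ∧ m ≤ Fintype.card ι + 1 ∧ IsLoosePath κ E m w ∧ w 0 ∈ Y ∧ w (m * κ) ∈ X ∧
      ∀ i, 0 < i → i < m * κ → w i ∉ Z ∧ ρ (w i) ≠ 0 := by
  classical
  set j := (linkGraph 𝓗).dist b b' with hj
  have hbad := card_not_reaches_lt hκ hE h𝓗 hres he' ha' hb' hab' hX hXc j b hreach hj.symm
  set d := fun Q => (linkGraph 𝓗).dist Q b' with hd
  have hgood : h ≤ ((slot π ρ Z b 3).filter fun z => Reaches π ρ κ E Z X d j z).card := by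
    have h1 := Finset.card_filter_add_card_filter_not (s := slot π ρ Z b 3)
      (fun z => Reaches π ρ κ E Z X d j z)
    have h2 := hres e he b hb 3 (by omega) (by omega)
    omega
  -- The first edge has its inner vertices in label `4`, which no path from `Reaches` uses.
  obtain ⟨w, hw, hw0, hw0P, hwX, hwQ, hwN⟩ := (h𝓗 e he).2.exists_link hE (h𝓗 e he).1 ha hb hab Y
    ((slot π ρ Z b 3).filter fun z => Reaches π ρ κ E Z X d j z)
    (Finset.univ.filter fun x => ρ x = 4 ∧ x ∉ Z)
    (hYc.trans (Finset.card_le_card fun x hx => Finset.mem_filter.2 ⟨hx, (hY x hx).2⟩))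
    (hgood.trans (Finset.card_le_card fun x hx => by
      simp only [Finset.mem_filter, mem_slot] at hx ⊢
      tauto))
    fun R hR _ _ => (show h ≤ (slot π ρ Z R 4).card by
      have := hres e he R hR 4 (by omega) (by omega)
      omega).trans (Finset.card_le_card fun x hx => by
        simp only [Finset.mem_filter, mem_slot, Finset.mem_univ, true_and] at hx ⊢
        tauto)
  rw [Finset.mem_filter, mem_slot] at hwX
  obtain ⟨w', hw', hw'0, hw'X, hw'A⟩ := hwX.2
  have hA : ∀ x, Allowed π ρ Z d j x → x ∉ Z ∧ ρ x ≠ 0 ∧ ρ x ≠ 4 := by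
    intro x hx
    refine ⟨hx.1, ?_⟩
    rcases hx.2 with h | h | h | h <;> omega
  have hglue : w (1 * κ) = w' 0 := by rw [one_mul, hw'0]
  refine ⟨1 + (j + 1), glue (1 * κ) w w', by omega, ?_, ?_, ?_, ?_, fun i hi0 hi => ?_⟩
  · have := dist_lt_card hreach
    omega
  · refine hw.glue hw' hglue fun i hi l hl0 hl hil => ?_
    rw [one_mul] at hi
    rcases hi.lt_or_eq with hi | rfl
    · rcases Nat.eq_zero_or_pos i with rfl | hi0
      · rcases hl.lt_or_eq with hl | rfl
        · exact (hA _ (hw'A l hl)).2.1 (hil ▸ (hY _ hw0).1)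
        · exact Finset.disjoint_left.1 hXY hw'X (hil ▸ hw0)
      · have h4 := (hwN i hi0 hi).1
        rw [Finset.mem_filter] at h4
        rcases hl.lt_or_eq with hl | rfl
        · exact (hA _ (hw'A l hl)).2.2 (hil ▸ h4.2.1)
        · have := (hX _ hw'X).1
          rw [← hil] at this
          omega
    · rw [← hw'0] at hil
      have := hw'.inj 0 l (by omega) hl hil
      omega
  · rw [glue_of_le _ _ (by omega)]; exact hw0
  · rw [show (1 + (j + 1)) * κ = 1 * κ + (j + 1) * κ by ring, glue_add hglue]
    exact hw'X
  · by_cases hik : i < κ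
    · rw [glue_of_le _ _ (by omega)]
      have h4 := (hwN i hi0 hik).1
      rw [Finset.mem_filter] at h4
      exact ⟨h4.2.2, by omega⟩
    · obtain ⟨l, rfl⟩ := Nat.exists_eq_add_of_le (not_lt.1 hik)
      rw [show κ + l = 1 * κ + l by ring, glue_add hglue]
      have := hA _ (hw'A l (by rw [add_mul, one_mul] at hi; omega))
      exact ⟨this.1, this.2.1⟩

end Connecting

/-! ### Merging two paths, closing a path to a cycle -/

section Merging

variable {V : Type*} [DecidableEq V]

/-- `x 0, …, x (ℓ * κ - 1)` is the cyclic ordering of a loose cycle with `ℓ` edges in `E`. -/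
structure IsLooseCycleSeq (κ : ℕ) (E : Set (Finset V)) (ℓ : ℕ) (x : ℕ → V) : Prop where
  inj : ∀ i j, i < ℓ * κ → j < ℓ * κ → x i = x j → i = j
  closed : x (ℓ * κ) = x 0
  edge : ∀ i < ℓ, block κ x i ∈ E

namespace IsLoosePath

variable {κ m m' mw : ℕ} {E : Set (Finset V)} {v w p : ℕ → V}

/-- Follow `v` up to connecting vertex `s`, cross by `w` and continue along `p` from connecting
vertex `s'`. The start of `v` and the end of `p` survive, which preserves flexible ends. -/
theorem merge {s s' : ℕ} (hv : IsLoosePath κ E m v) (hp : IsLoosePath κ E m' p)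
    (hw : IsLoosePath κ E mw w) (hdisj : Disjoint (verts κ m v) (verts κ m' p)) (hs : s ≤ m)
    (hs' : s' ≤ m') (h0 : w 0 = v (s * κ)) (h1 : w (mw * κ) = p (s' * κ))
    (hinner : ∀ i, 0 < i → i < mw * κ → w i ∉ verts κ m v ∧ w i ∉ verts κ m' p) :
    ∃ x, IsLoosePath κ E (s + (mw + (m' - s'))) x ∧ (∀ i ≤ s * κ, x i = v i) ∧
      (∀ i ≤ (m' - s') * κ, x ((s + (mw + (m' - s'))) * κ - i) = p (m' * κ - i)) ∧
      ∀ y ∈ verts κ (s + (mw + (m' - s'))) x, y ∈ verts κ m v ∨ y ∈ verts κ m' p ∨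
        ∃ i, 0 < i ∧ i < mw * κ ∧ y = w i := by
  obtain ⟨t, rfl⟩ := Nat.exists_eq_add_of_le hs'
  rw [Nat.add_sub_cancel_left]
  have hsκ := Nat.mul_le_mul_right κ hs
  have hpt : IsLoosePath κ E t fun x => p (s' * κ + x) := hp.shift le_rfl
  have hvmem : ∀ i ≤ s * κ, v i ∈ verts κ m v := fun i hi => mem_verts.2 ⟨i, by omega, rfl⟩
  have hpmem : ∀ i ≤ t * κ, p (s' * κ + i) ∈ verts κ (s' + t) p :=
    fun i hi => mem_verts.2 ⟨_, by rw [add_mul]; omega, rfl⟩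
  have hg1 : w (mw * κ) = (fun x => p (s' * κ + x)) 0 := by simpa using h1
  have hwp := hw.glue hpt hg1 fun i hi j hj0 hj hij => by
    rcases Nat.eq_zero_or_pos i with rfl | hi0
    · rw [h0] at hij
      exact Finset.disjoint_left.1 hdisj (hvmem _ le_rfl) (hij ▸ hpmem j hj)
    · rcases hi.lt_or_eq with hi | rfl
      · exact (hinner i hi0 hi).2 (hij ▸ hpmem j hj)
      · rw [h1] at hij
        have := hp.inj _ _ (by rw [add_mul]; omega) (by rw [add_mul]; omega) hij
        omega
  set q := LooseCycles.glue (mw * κ) w fun x => p (s' * κ + x) with hq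
  have hq0 : q 0 = w 0 := glue_of_le _ _ (Nat.zero_le _)
  have hqmem : ∀ i, 0 < i → i ≤ (mw + t) * κ → (0 < i ∧ i < mw * κ ∧ q i = w i) ∨
      q i ∈ verts κ (s' + t) p := by
    intro i hi0 hi
    rw [add_mul] at hi
    by_cases h : i < mw * κ
    · exact Or.inl ⟨hi0, h, glue_of_le _ _ h.le⟩
    · obtain ⟨j, rfl⟩ := Nat.exists_eq_add_of_le (not_lt.1 h)
      right
      rw [hq, glue_add hg1]
      exact hpmem j (by omega)
  have hg0 : v (s * κ) = q 0 := by rw [hq0, h0]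
  refine ⟨LooseCycles.glue (s * κ) v q, (hv.take hs).glue hwp hg0 fun i hi j hj0 hj hij => ?_,
    fun i hi => glue_of_le _ _ hi, fun i hi => ?_, fun y hy => ?_⟩
  · rcases hqmem j hj0 hj with ⟨h2, h3, h4⟩ | h2
    · rw [h4] at hij
      exact (hinner j h2 h3).1 (hij ▸ hvmem i hi)
    · exact Finset.disjoint_left.1 hdisj (hvmem i hi) (hij ▸ h2)
  · rw [show (s + (mw + t)) * κ - i = s * κ + (mw * κ + (t * κ - i)) by
      rw [add_mul, add_mul]; omega, glue_add hg0, hq, glue_add hg1]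
    show p (s' * κ + (t * κ - i)) = _
    congr 1
    rw [add_mul]; omega
  · obtain ⟨i, hi, rfl⟩ := mem_verts.1 hy
    rw [add_mul] at hi
    by_cases h : i ≤ s * κ
    · left; rw [glue_of_le _ _ h]; exact hvmem i h
    · obtain ⟨j, rfl⟩ := Nat.exists_eq_add_of_le (not_le.1 h).le
      right
      rw [glue_add hg0]
      rcases hqmem j (by omega) (by omega) with ⟨h2, h3, h4⟩ | h2
      · exact Or.inr ⟨j, h2, h3, h4⟩
      · exact Or.inl h2

/-- Only the stretch of `v` between the connecting vertices `s` and `s + t` is kept; `w` leads from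
its end back to its beginning. -/
theorem close {s t : ℕ} (hv : IsLoosePath κ E m v) (hw : IsLoosePath κ E mw w) (hst : s + t ≤ m)
    (h0 : w 0 = v ((s + t) * κ)) (h1 : w (mw * κ) = v (s * κ))
    (hinner : ∀ i, 0 < i → i < mw * κ → w i ∉ verts κ m v) :
    ∃ x, IsLooseCycleSeq κ E (t + mw) x := by
  have hvs := hv.shift hst
  have hg : (fun x => v (s * κ + x)) (t * κ) = w 0 := by
    show v (s * κ + t * κ) = w 0
    rw [h0, add_mul]
  have hstκ := Nat.mul_le_mul_right κ hst
  rw [add_mul] at hstκ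
  refine ⟨LooseCycles.glue (t * κ) (fun x => v (s * κ + x)) w, fun i j hi hj hij => ?_, ?_,
    block_glue_mem hvs.edge hw.edge hg⟩
  · rw [add_mul] at hi hj
    unfold LooseCycles.glue at hij
    split_ifs at hij with h2 h3 h3
    · exact hvs.inj i j h2 h3 hij
    · exact absurd (mem_verts.2 ⟨_, by omega, hij⟩) (hinner (j - t * κ) (by omega) (by omega))
    · exact absurd (mem_verts.2 ⟨_, by omega, hij.symm⟩)
        (hinner (i - t * κ) (by omega) (by omega))
    · have := hw.inj _ _ (by omega) (by omega) hij
      omega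
  · rw [add_mul, glue_add (v := fun x => v (s * κ + x)) hg, h1, glue_of_le _ _ (Nat.zero_le _)]
    simp

end IsLoosePath

/-- The candidate endpoints near each end form sets of size `h`, as `exists_connecting_path`
requires. -/
theorem card_image_flexible {κ m h : ℕ} {E : Set (Finset V)} {v : ℕ → V} (hκ : 1 ≤ κ)
    (hv : IsLoosePath κ E m v) (hm : 4 * h ≤ m) :
    ((Finset.range h).image fun i => v (2 * i * κ)).card = h ∧
      ((Finset.range h).image fun i => v ((m - 2 * i) * κ)).card = h := by
  constructor
  · rw [Finset.card_image_of_injOn, Finset.card_range]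
    intro i hi j hj hij
    simp only [Finset.coe_range, Set.mem_Iio] at hi hj
    have := hv.inj _ _ (Nat.mul_le_mul_right κ (by omega)) (Nat.mul_le_mul_right κ (by omega)) hij
    have := Nat.eq_of_mul_eq_mul_right hκ this
    omega
  · rw [Finset.card_image_of_injOn, Finset.card_range]
    intro i hi j hj hij
    simp only [Finset.coe_range, Set.mem_Iio] at hi hj
    have := hv.inj _ _ (Nat.mul_le_mul_right κ (by omega)) (Nat.mul_le_mul_right κ (by omega)) hij
    have := Nat.eq_of_mul_eq_mul_right hκ this
    omega

end Merging

/-! ### Paths along links, joined into one cycle -/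

section Chaining

variable {V ι : Type*} [Fintype V] [DecidableEq V] [DecidableEq ι]

/-- An edge of the reduced hypergraph together with two parts in it. -/
structure Link (𝓗 : Set (Finset ι)) where
  edge : Finset ι
  src : ι
  tgt : ι
  edge_mem : edge ∈ 𝓗
  src_mem : src ∈ edge
  tgt_mem : tgt ∈ edge
  src_ne_tgt : src ≠ tgt

/-- The number of vertices of the part `P` that a path of `2 * u` edges along the link takes. -/
def Link.load {𝓗 : Set (Finset ι)} (u : ℕ) (B : Link 𝓗) (P : ι) : ℕ :=
  if P = B.src ∨ P = B.tgt then u + 1 else if P ∈ B.edge then 2 * u else 0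

/-- `v` starts and ends with `2 * h` edges for which every other connecting vertex is an unlabelled
vertex of the part `a` (at the start) or `b` (at the end). -/
structure HasFlexibleEnds (π : V → ι) (ρ : V → ℕ) (κ h : ℕ) (a b : ι) (m : ℕ) (v : ℕ → V) :
    Prop where
  start : ∀ i < h, ρ (v (2 * i * κ)) = 0 ∧ π (v (2 * i * κ)) = a
  finish : ∀ i < h, ρ (v ((m - 2 * i) * κ)) = 0 ∧ π (v ((m - 2 * i) * κ)) = b
  long : 4 * h ≤ m

/-- As `2 * u` is even, the path starts and ends in `src`, and every other connecting vertex lies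
there too, so both ends are flexible. -/
theorem exists_link_path {π : V → ι} {ρ : V → ℕ} {h u κ : ℕ} {E : Set (Finset V)}
    {𝓗 : Set (Finset ι)} (hκ : 1 ≤ κ) (hh : 1 ≤ h) (hu : 2 * h ≤ u)
    (hE : ∀ f ∈ E, f.card = κ + 1) (h𝓗 : ∀ e ∈ 𝓗, e.card = κ + 1 ∧ Hits π h E e) (B : Link 𝓗)
    {Z : Finset V} (hZ : ∀ P ∈ B.edge, B.load u P + 5 * h ≤ (slot π ρ Z P 0).card) :
    ∃ v, IsLoosePath κ E (2 * u) v ∧ HasFlexibleEnds π ρ κ h B.src B.src (2 * u) v ∧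
      (∀ x ∈ verts κ (2 * u) v, ρ x = 0 ∧ x ∉ Z) ∧
      ∀ P, ((verts κ (2 * u) v).filter fun x => π x = P).card ≤ B.load u P := by
  obtain ⟨hcard, hit⟩ := h𝓗 _ B.edge_mem
  have hU : ∀ P, slot π ρ Z P 0 ⊆
      (Finset.univ.filter fun x => ρ x = 0 ∧ x ∉ Z).filter fun x => π x = P := by
    intro P x hx
    simp only [Finset.mem_filter, mem_slot, Finset.mem_univ, true_and] at hx ⊢
    tauto
  have hU' := fun P hP => (hZ P hP).trans (Finset.card_le_card (hU P))
  obtain ⟨v, hv, hvU⟩ := hit.exists_alternatingPath hκ hh hE hcard B.src_ne_tgt B.src_mem B.tgt_mem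
    (u := u) (U := Finset.univ.filter fun x => ρ x = 0 ∧ x ∉ Z) (by omega)
    (by simpa [Link.load] using hU' _ B.src_mem) (by simpa [Link.load] using hU' _ B.tgt_mem)
    (fun P hP h1 h2 => by simpa [Link.load, h1, h2, hP] using hU' P hP)
  have hfree : ∀ x ∈ verts κ (2 * u) v, ρ x = 0 ∧ x ∉ Z := fun x hx => by
    have := hvU hx
    simpa using this
  refine ⟨v, hv.path.mono fun f hf => hf.1, ⟨fun i hi => ⟨(hfree _ ?_).1, ?_⟩,
    fun i hi => ⟨(hfree _ ?_).1, ?_⟩, by omega⟩, hfree, fun P => ?_⟩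
  · exact mem_verts.2 ⟨_, Nat.mul_le_mul_right κ (by omega), rfl⟩
  · rw [hv.alt _ (by omega), if_pos (by omega)]
  · exact mem_verts.2 ⟨_, Nat.mul_le_mul_right κ (by omega), rfl⟩
  · rw [hv.alt _ (by omega), if_pos (by omega)]
  · unfold Link.load
    split_ifs with h1 h2
    · rcases h1 with h1 | h1
      · have := hv.card_end_le hE hcard hκ 0 (by omega) (c := P) (by simp [h1]) B.src_ne_tgt
        omega
      · have := hv.card_end_le hE hcard hκ 1 (by omega) (c := P) (by simp [h1]) B.src_ne_tgt
        omega
    · push Not at h1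
      exact hv.card_inner_le hE hcard hκ h1.1
    · rw [Nat.le_zero, Finset.card_eq_zero, Finset.filter_eq_empty_iff]
      rintro x hx rfl
      exact h2 (hv.mem_of_mem_verts hκ B.src_mem hx)

variable [Fintype ι]

/-- A path along the links of `l`, with control on the vertices it uses. -/
structure IsChain (π : V → ι) (ρ : V → ℕ) (κ h u : ℕ) (E : Set (Finset V))
    {𝓗 : Set (Finset ι)} (l : List (Link 𝓗)) (F B : Link 𝓗) (m : ℕ) (v : ℕ → V) : Prop where
  path : IsLoosePath κ E m v
  ends : HasFlexibleEnds π ρ κ h F.src B.src m v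
  first_mem : F ∈ l
  last_mem : B ∈ l
  length : 2 * u * l.length + 4 * h ≤ m + 4 * h * l.length
  main : ∀ P, ((verts κ m v).filter fun x => ρ x = 0 ∧ π x = P).card ≤
    (l.map fun B => B.load u P).sum
  labelled : ((verts κ m v).filter fun x => ρ x ≠ 0).card ≤ l.length * ((Fintype.card ι + 1) * κ)

/-- All connecting paths together use at most `h` labelled vertices, so each reservoir keeps `2 * h`
of its `3 * h`. -/
theorem IsChain.card_slot {π : V → ι} {ρ : V → ℕ} {h u κ : ℕ} {E : Set (Finset V)}
    {𝓗 : Set (Finset ι)} {l : List (Link 𝓗)} {F B : Link 𝓗} {m : ℕ} {v : ℕ → V}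
    (hc : IsChain π ρ κ h u E l F B m v)
    (hres : ∀ e ∈ 𝓗, ∀ P ∈ e, ∀ i, 1 ≤ i → i ≤ 5 → 3 * h ≤ (slot π ρ ∅ P i).card)
    (hlen : l.length * ((Fintype.card ι + 1) * κ) ≤ h) :
    ∀ e ∈ 𝓗, ∀ P ∈ e, ∀ i, 1 ≤ i → i ≤ 5 → 2 * h ≤ (slot π ρ (verts κ m v) P i).card := by
  intro e he P hP i h1 h5
  have hcov : slot π ρ ∅ P i ⊆ slot π ρ (verts κ m v) P i ∪
      (verts κ m v).filter fun x => ρ x ≠ 0 := by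
    intro x hx
    simp only [Finset.mem_union, Finset.mem_filter, mem_slot] at hx ⊢
    by_cases hxv : x ∈ verts κ m v
    · exact Or.inr ⟨hxv, by omega⟩
    · exact Or.inl ⟨hx.1, hx.2.1, hxv⟩
  have h2 := (Finset.card_le_card hcov).trans (Finset.card_union_le _ _)
  have := hres e he P hP i h1 h5
  have := hc.labelled
  omega

/-- Induction on the links. The loads bound what the earlier paths took from the unlabelled vertices
of a part and leave `5 * h` to spare for the search. A path through the reservoirs then joins the
old end to the new start. -/
theorem exists_isChain {π : V → ι} {ρ : V → ℕ} {h u κ : ℕ} {E : Set (Finset V)}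
    {𝓗 : Set (Finset ι)} (hκ : 1 ≤ κ) (hh : 1 ≤ h) (hu : 2 * h ≤ u)
    (hE : ∀ f ∈ E, f.card = κ + 1) (h𝓗 : ∀ e ∈ 𝓗, e.card = κ + 1 ∧ Hits π h E e)
    (hres : ∀ e ∈ 𝓗, ∀ P ∈ e, ∀ i, 1 ≤ i → i ≤ 5 → 3 * h ≤ (slot π ρ ∅ P i).card)
    (hmain : ∀ e ∈ 𝓗, ∀ P ∈ e, 2 * u + 2 + 5 * h ≤ (slot π ρ ∅ P 0).card)
    (l : List (Link 𝓗)) (hl : l ≠ [])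
    (hreach : ∀ B ∈ l, ∀ B' ∈ l, (linkGraph 𝓗).Reachable B.tgt B'.tgt)
    (hload : ∀ P, (l.map fun B => B.load u P).sum ≤ 2 * u + 2)
    (hlen : l.length * ((Fintype.card ι + 1) * κ) ≤ h) :
    ∃ F B m v, IsChain π ρ κ h u E l F B m v := by
  induction l with
  | nil => exact absurd rfl hl
  | cons B₀ l ih =>
    have hload₀ : ∀ P, B₀.load u P + (l.map fun B => B.load u P).sum ≤ 2 * u + 2 := fun P => by
      simpa using hload P
    by_cases hl' : l = []
    · subst hl'
      obtain ⟨v, hv, hends, hfree, hcard⟩ := exists_link_path (π := π) (ρ := ρ) hκ hh hu hE h𝓗 B₀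
        (Z := ∅) fun P hP => by
          have h1 := hload₀ P
          have h2 := hmain _ B₀.edge_mem P hP
          omega
      refine ⟨B₀, B₀, 2 * u, v, hv, hends, by simp, by simp, by simp, fun P => ?_, ?_⟩
      · simp only [List.map_cons, List.map_nil, List.sum_cons, List.sum_nil, add_zero]
        refine le_trans (Finset.card_le_card fun x hx => ?_) (hcard P)
        simp only [Finset.mem_filter] at hx ⊢
        exact ⟨hx.1, hx.2.2⟩
      · rw [Finset.filter_eq_empty_iff.2 fun x hx => not_not.2 (hfree x hx).1]
        simp
    obtain ⟨F, B, m, v, hc⟩ := ih hl'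
      (fun B hB B' hB' => hreach B (List.mem_cons_of_mem _ hB) B' (List.mem_cons_of_mem _ hB'))
      (fun P => le_trans (Nat.le_add_left _ _) (hload₀ P))
      (le_trans (Nat.mul_le_mul_right _ (by simp)) hlen)
    obtain ⟨p, hp, hpends, hpfree, hpcard⟩ := exists_link_path (π := π) (ρ := ρ) hκ hh hu hE h𝓗 B₀
      (Z := verts κ m v) fun P hP => by
        have hcov : slot π ρ ∅ P 0 ⊆ slot π ρ (verts κ m v) P 0 ∪
            (verts κ m v).filter fun x => ρ x = 0 ∧ π x = P := by
          intro x hx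
          simp only [Finset.mem_union, Finset.mem_filter, mem_slot] at hx ⊢
          by_cases hxv : x ∈ verts κ m v
          · exact Or.inr ⟨hxv, hx.2.1, hx.1⟩
          · exact Or.inl ⟨hx.1, hx.2.1, hxv⟩
        have h3 := (Finset.card_le_card hcov).trans (Finset.card_union_le _ _)
        have h1 := hload₀ P
        have h2 := hmain _ B₀.edge_mem P hP
        have h4 := hc.main P
        omega
    have hdisj : Disjoint (verts κ m v) (verts κ (2 * u) p) :=
      Finset.disjoint_right.2 fun x hx => (hpfree x hx).2
    have hYv : (Finset.range h).image (fun i => v ((m - 2 * i) * κ)) ⊆ verts κ m v := by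
      intro x hx
      obtain ⟨i, _, rfl⟩ := Finset.mem_image.1 hx
      exact mem_verts.2 ⟨_, Nat.mul_le_mul_right κ (by omega), rfl⟩
    have hXp : (Finset.range h).image (fun i => p (2 * i * κ)) ⊆ verts κ (2 * u) p := by
      intro x hx
      obtain ⟨i, hi, rfl⟩ := Finset.mem_image.1 hx
      rw [Finset.mem_range] at hi
      exact mem_verts.2 ⟨_, Nat.mul_le_mul_right κ (by omega), rfl⟩
    obtain ⟨mw, w, hmw1, hmw, hw, hw0, hw1, hwi⟩ := exists_connecting_path (Z := verts κ m v) hκ hE h𝓗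
      (hc.card_slot hres (le_trans (Nat.mul_le_mul_right _ (by simp)) hlen))
      B.edge_mem B.src_mem B.tgt_mem B.src_ne_tgt B₀.edge_mem B₀.src_mem B₀.tgt_mem B₀.src_ne_tgt
      (hreach B (List.mem_cons_of_mem _ hc.last_mem) B₀ (by simp))
      (X := (Finset.range h).image fun i => p (2 * i * κ))
      (Y := (Finset.range h).image fun i => v ((m - 2 * i) * κ))
      (fun x hx => by
        obtain ⟨i, hi, rfl⟩ := Finset.mem_image.1 hx
        exact hpends.start i (Finset.mem_range.1 hi))
      (card_image_flexible hκ hp (by omega)).1.ge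
      (fun x hx => by
        obtain ⟨i, hi, rfl⟩ := Finset.mem_image.1 hx
        exact hc.ends.finish i (Finset.mem_range.1 hi))
      (card_image_flexible hκ hc.path hc.ends.long).2.ge
      ((hdisj.mono_left hYv).mono_right hXp).symm
    obtain ⟨i, hi, hwi0⟩ := Finset.mem_image.1 hw0
    obtain ⟨j, hj, hwj⟩ := Finset.mem_image.1 hw1
    rw [Finset.mem_range] at hi hj
    have hlong := hc.ends.long
    -- Both paths are cut back to the ends of the bridge, by fewer than `2 * h` edges each.
    obtain ⟨x, hx, hxv, hxp, hxmem⟩ := hc.path.merge hp hw hdisj (s := m - 2 * i) (s' := 2 * j)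
      (by omega) (by omega) hwi0.symm hwj.symm fun i hi0 hi => ⟨(hwi i hi0 hi).1, fun h =>
        (hwi i hi0 hi).2 (hpfree _ h).1⟩
    refine ⟨F, B₀, _, x, hx, ⟨fun i' hi' => ?_, fun i' hi' => ?_, by omega⟩,
      List.mem_cons_of_mem _ hc.first_mem, by simp, ?_, fun P => ?_, ?_⟩
    · rw [hxv _ (Nat.mul_le_mul_right κ (by omega))]
      exact hc.ends.start i' hi'
    · rw [Nat.sub_mul, hxp _ (Nat.mul_le_mul_right κ (by omega)), ← Nat.sub_mul]
      exact hpends.finish i' hi'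
    · have := hc.length
      rw [List.length_cons, mul_add, mul_add]
      omega
    · simp only [List.map_cons, List.sum_cons]
      have hcov : ((verts κ (m - 2 * i + (mw + (2 * u - 2 * j))) x).filter
          fun x => ρ x = 0 ∧ π x = P) ⊆ ((verts κ (2 * u) p).filter fun x => π x = P) ∪
          (verts κ m v).filter fun x => ρ x = 0 ∧ π x = P := by
        intro y hy
        simp only [Finset.mem_union, Finset.mem_filter] at hy ⊢
        rcases hxmem y hy.1 with h | h | ⟨q, hq0, hq, rfl⟩
        · exact Or.inr ⟨h, hy.2⟩
        · exact Or.inl ⟨h, hy.2.2⟩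
        · exact absurd hy.2.1 (hwi q hq0 hq).2
      exact (Finset.card_le_card hcov).trans ((Finset.card_union_le _ _).trans
        (Nat.add_le_add (hpcard P) (hc.main P)))
    · have hcov : ((verts κ (m - 2 * i + (mw + (2 * u - 2 * j))) x).filter fun x => ρ x ≠ 0) ⊆
          ((verts κ m v).filter fun x => ρ x ≠ 0) ∪ (Finset.range (mw * κ)).image w := by
        intro y hy
        simp only [Finset.mem_union, Finset.mem_filter, Finset.mem_image, Finset.mem_range] at hy ⊢
        rcases hxmem y hy.1 with h | h | ⟨q, hq0, hq, rfl⟩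
        · exact Or.inl ⟨h, hy.2⟩
        · exact absurd (hpfree y h).1 hy.2
        · exact Or.inr ⟨q, hq, rfl⟩
      rw [List.length_cons, add_mul l.length 1, one_mul]
      refine (Finset.card_le_card hcov).trans ((Finset.card_union_le _ _).trans
        (Nat.add_le_add hc.labelled (Finset.card_image_le.trans ?_)))
      rw [Finset.card_range]
      exact Nat.mul_le_mul_right κ hmw

/-- Links of the same component with bounded total load give a long loose cycle. -/
theorem exists_looseCycleSeq {π : V → ι} {ρ : V → ℕ} {h u κ : ℕ} {E : Set (Finset V)}
    {𝓗 : Set (Finset ι)} (hκ : 1 ≤ κ) (hh : 1 ≤ h) (hu : 2 * h ≤ u)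
    (hE : ∀ f ∈ E, f.card = κ + 1) (h𝓗 : ∀ e ∈ 𝓗, e.card = κ + 1 ∧ Hits π h E e)
    (hres : ∀ e ∈ 𝓗, ∀ P ∈ e, ∀ i, 1 ≤ i → i ≤ 5 → 3 * h ≤ (slot π ρ ∅ P i).card)
    (hmain : ∀ e ∈ 𝓗, ∀ P ∈ e, 2 * u + 2 + 5 * h ≤ (slot π ρ ∅ P 0).card)
    (l : List (Link 𝓗)) (hl : l ≠ [])
    (hreach : ∀ B ∈ l, ∀ B' ∈ l, (linkGraph 𝓗).Reachable B.tgt B'.tgt)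
    (hload : ∀ P, (l.map fun B => B.load u P).sum ≤ 2 * u + 2)
    (hlen : l.length * ((Fintype.card ι + 1) * κ) ≤ h) :
    ∃ ℓ x, 2 ≤ ℓ ∧ 2 * u * l.length ≤ ℓ + 4 * h * l.length ∧ IsLooseCycleSeq κ E ℓ x := by
  obtain ⟨F, B, m, v, hc⟩ := exists_isChain hκ hh hu hE h𝓗 hres hmain l hl hreach hload hlen
  have hlong := hc.ends.long
  obtain ⟨mw, w, hmw1, hmw, hw, hw0, hw1, hwi⟩ := exists_connecting_path (Z := verts κ m v) hκ hE h𝓗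
    (hc.card_slot hres hlen)
    B.edge_mem B.src_mem B.tgt_mem B.src_ne_tgt F.edge_mem F.src_mem F.tgt_mem F.src_ne_tgt
    (hreach B hc.last_mem F hc.first_mem)
    (X := (Finset.range h).image fun i => v (2 * i * κ))
    (Y := (Finset.range h).image fun i => v ((m - 2 * i) * κ))
    (fun x hx => by
      obtain ⟨i, hi, rfl⟩ := Finset.mem_image.1 hx
      exact hc.ends.start i (Finset.mem_range.1 hi))
    (card_image_flexible hκ hc.path hlong).1.ge
    (fun x hx => by
      obtain ⟨i, hi, rfl⟩ := Finset.mem_image.1 hx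
      exact hc.ends.finish i (Finset.mem_range.1 hi))
    (card_image_flexible hκ hc.path hlong).2.ge
    (Finset.disjoint_left.2 fun y hy hy' => by
      obtain ⟨i, hi, rfl⟩ := Finset.mem_image.1 hy
      obtain ⟨j, hj, hij⟩ := Finset.mem_image.1 hy'
      rw [Finset.mem_range] at hi hj
      have := hc.path.inj _ _ (Nat.mul_le_mul_right κ (by omega))
        (Nat.mul_le_mul_right κ (by omega)) hij
      have := Nat.eq_of_mul_eq_mul_right hκ this
      omega)
  obtain ⟨i, hi, hwi0⟩ := Finset.mem_image.1 hw0
  obtain ⟨j, hj, hwj⟩ := Finset.mem_image.1 hw1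
  rw [Finset.mem_range] at hi hj
  obtain ⟨x, hx⟩ := hc.path.close hw (s := 2 * j) (t := m - 2 * i - 2 * j) (by omega)
    (by rw [show 2 * j + (m - 2 * i - 2 * j) = m - 2 * i by omega, hwi0]) hwj.symm
    fun i hi0 hi => (hwi i hi0 hi).1
  have := hc.length
  exact ⟨_, x, by omega, by omega, hx⟩

end Chaining

/-! ### Counting transversal sets -/

section Transversals

variable {V ι : Type*} [DecidableEq V] [DecidableEq ι]

/-- A set with one vertex in each of the parts in `e` amounts to a choice of these vertices. -/
theorem card_transversals (π : V → ι) (k : ℕ) (B : Finset V) (e : Finset ι) (he : e.card = k) :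
    ((B.powersetCard k).filter fun f => f.image π = e).card =
      ∏ P ∈ e, (B.filter fun x => π x = P).card := by
  rw [← Finset.card_pi]
  symm
  have himg : ∀ g ∈ e.pi fun P => B.filter fun x => π x = P, ∀ P (hP : P ∈ e),
      g P hP ∈ B ∧ π (g P hP) = P := fun g hg P hP => by
    simpa using Finset.mem_pi.1 hg P hP
  have hinj : ∀ g ∈ e.pi fun P => B.filter fun x => π x = P, ∀ P Q : e,
      g P.1 P.2 = g Q.1 Q.2 → P = Q := fun g hg P Q h => by
    have h1 := (himg g hg P.1 P.2).2
    rw [h, (himg g hg Q.1 Q.2).2] at h1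
    exact Subtype.ext h1.symm
  refine Finset.card_bij (fun g _ => e.attach.image fun P => g P.1 P.2) ?_ ?_ ?_
  · intro g hg
    rw [Finset.mem_filter, Finset.mem_powersetCard]
    refine ⟨⟨fun x hx => ?_, ?_⟩, ?_⟩
    · obtain ⟨P, _, rfl⟩ := Finset.mem_image.1 hx
      exact (himg g hg P.1 P.2).1
    · rw [Finset.card_image_of_injective _ fun P Q => hinj g hg P Q, Finset.card_attach, he]
    · rw [Finset.image_image]
      ext P
      simp only [Finset.mem_image, Finset.mem_attach, true_and, Function.comp, Subtype.exists]
      constructor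
      · rintro ⟨Q, hQ, rfl⟩
        rw [(himg g hg Q hQ).2]; exact hQ
      · exact fun hP => ⟨P, hP, (himg g hg P hP).2⟩
  · intro g hg g' hg' h
    funext P hP
    have h1 : g P hP ∈ e.attach.image fun P => g' P.1 P.2 := by
      rw [← h]
      exact Finset.mem_image.2 ⟨⟨P, hP⟩, Finset.mem_attach _ _, rfl⟩
    obtain ⟨Q, _, hQ⟩ := Finset.mem_image.1 h1
    have h2 := (himg g' hg' Q.1 Q.2).2
    rw [hQ, (himg g hg P hP).2] at h2
    obtain ⟨Q, hQ'⟩ := Q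
    subst h2
    exact hQ.symm
  · intro f hf
    rw [Finset.mem_filter, Finset.mem_powersetCard] at hf
    obtain ⟨⟨hfB, hfk⟩, hfe⟩ := hf
    have hch : ∀ P ∈ e, ∃ x ∈ f, π x = P := fun P hP => Finset.mem_image.1 (hfe ▸ hP)
    choose g hgf hgP using hch
    have hg : g ∈ e.pi fun P => B.filter fun x => π x = P := by
      rw [Finset.mem_pi]
      exact fun P hP => Finset.mem_filter.2 ⟨hfB (hgf P hP), hgP P hP⟩
    refine ⟨g, hg, Finset.eq_of_subset_of_card_le (fun x hx => ?_) ?_⟩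
    · obtain ⟨P, _, rfl⟩ := Finset.mem_image.1 hx
      exact hgf _ _
    · rw [Finset.card_image_of_injective _ fun P Q => hinj g hg P Q, Finset.card_attach, he, hfk]

end Transversals

/-! ### Lower tail for random subsets -/

section LowerTail

variable {α : Type*} [Countable α]

open Classical in
/-- A lower-tail bound for the size of a random subset of a finite set. -/
theorem setBernoulli_lower_tail (u F : Finset α) (hF : F ⊆ u) (p : I) :
    (setBernoulli (u : Set α) p).real
      {S | ((F.filter fun x => x ∈ S).card : ℝ) < p / 4 * F.card} ≤
      Real.exp (-(p / 4 * F.card)) := by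
  have hp0 : (0 : ℝ) ≤ p := p.2.1
  have hp1 : (p : ℝ) ≤ 1 := p.2.2
  set A := {S : Set α | ((F.filter fun x => x ∈ S).card : ℝ) < p / 4 * F.card} with hA
  have h1 : (setBernoulli (u : Set α) p).real A ≤
      ∑ t ∈ u.powerset.filter fun t : Finset α => (t : Set α) ∈ A,
        (setBernoulli (u : Set α) p).real {(t : Set α)} := by
    rw [measureReal_def, setBernoulli_apply_eq_apply_subsets, ← measureReal_def]
    refine le_trans (measureReal_mono ?_ (measure_ne_top _ _)) (measureReal_biUnion_finset_le _ _)
    rintro S ⟨hSA, hSu⟩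
    have hfin : S.Finite := u.finite_toSet.subset hSu
    refine Set.mem_iUnion₂.2 ⟨hfin.toFinset, ?_, by simp⟩
    simp only [Finset.mem_filter, Finset.mem_powerset, Set.Finite.coe_toFinset]
    exact ⟨by simpa using hSu, hSA⟩
  have h2 : ∀ t ∈ u.powerset, (setBernoulli (u : Set α) p).real {(t : Set α)} =
      p ^ t.card * (1 - p) ^ (u \ t).card := by
    intro t ht
    rw [setBernoulli_real_singleton p (by simpa using ht) u.finite_toSet, Set.ncard_coe_finset,
      ← Finset.coe_sdiff, Set.ncard_coe_finset]
  -- The expectation of `(1 / 2) ^ X`, where `X` counts the random elements in `F`, found by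
  -- expanding a product over `u`.
  have h3 : ∑ t ∈ u.powerset, (1 / 2 : ℝ) ^ (F.filter fun x => x ∈ t).card *
      (p ^ t.card * (1 - p) ^ (u \ t).card) = (1 - p / 2) ^ F.card := by
    have h4 := Finset.prod_add (fun x => if x ∈ F then (p : ℝ) / 2 else p) (fun _ => 1 - (p : ℝ)) u
    have h5 : ∏ x ∈ u, ((if x ∈ F then (p : ℝ) / 2 else p) + (1 - p)) = (1 - p / 2) ^ F.card := by
      rw [← Finset.prod_subset hF]
      · rw [← Finset.prod_const]
        refine Finset.prod_congr rfl fun x hx => ?_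
        rw [if_pos hx]; ring
      · intro x _ hx
        rw [if_neg hx]; ring
    rw [← h5, h4]
    refine Finset.sum_congr rfl fun t ht => ?_
    rw [Finset.prod_const, ← mul_assoc]
    congr 1
    have h6 : ∀ x, (if x ∈ F then (p : ℝ) / 2 else p) = (if x ∈ F then 1 / 2 else 1) * p := by
      intro x; split_ifs <;> ring
    rw [Finset.prod_congr rfl fun x _ => h6 x, Finset.prod_mul_distrib, Finset.prod_const,
      Finset.prod_ite, Finset.prod_const_one, mul_one, Finset.prod_const]
    congr 3
    ext x
    simp only [Finset.mem_filter]
    tauto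
  -- Markov's inequality term by term: on the event, `exp (p / 4 * F.card) * (1 / 2) ^ X ≥ 1`,
  -- because `1 / 2 ≥ exp (-1)`.
  have h7 : ∀ t ∈ u.powerset.filter fun t : Finset α => (t : Set α) ∈ A,
      (setBernoulli (u : Set α) p).real {(t : Set α)} ≤ Real.exp (p / 4 * F.card) *
        ((1 / 2 : ℝ) ^ (F.filter fun x => x ∈ t).card * (p ^ t.card * (1 - p) ^ (u \ t).card)) := by
    intro t ht
    rw [Finset.mem_filter] at ht
    rw [h2 t ht.1, ← mul_assoc]
    refine le_mul_of_one_le_left (by have : (0 : ℝ) ≤ 1 - p := by linarith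
                                     positivity) ?_
    have h8 : Real.exp (-((F.filter fun x => x ∈ t).card : ℝ)) ≤
        (1 / 2 : ℝ) ^ (F.filter fun x => x ∈ t).card := by
      rw [show -((F.filter fun x => x ∈ t).card : ℝ) = (F.filter fun x => x ∈ t).card * (-1 : ℝ) by
        ring, Real.exp_nat_mul]
      refine pow_le_pow_left₀ (Real.exp_pos _).le ?_ _
      rw [Real.exp_neg, one_div]
      refine inv_anti₀ two_pos ?_
      have := Real.add_one_le_exp 1
      linarith
    have h9 : ((F.filter fun x => x ∈ t).card : ℝ) < p / 4 * F.card := by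
      simpa [hA] using ht.2
    calc (1 : ℝ) ≤ Real.exp (p / 4 * F.card - (F.filter fun x => x ∈ t).card) :=
          Real.one_le_exp (by linarith)
      _ = Real.exp (p / 4 * F.card) * Real.exp (-((F.filter fun x => x ∈ t).card : ℝ)) := by
          rw [← Real.exp_add]; ring_nf
      _ ≤ _ := mul_le_mul_of_nonneg_left h8 (Real.exp_pos _).le
  calc (setBernoulli (u : Set α) p).real A
      ≤ ∑ t ∈ u.powerset.filter fun t : Finset α => (t : Set α) ∈ A, Real.exp (p / 4 * F.card) *
        ((1 / 2 : ℝ) ^ (F.filter fun x => x ∈ t).card *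
          (p ^ t.card * (1 - p) ^ (u \ t).card)) := h1.trans (Finset.sum_le_sum h7)
    _ ≤ ∑ t ∈ u.powerset, Real.exp (p / 4 * F.card) *
        ((1 / 2 : ℝ) ^ (F.filter fun x => x ∈ t).card *
          (p ^ t.card * (1 - p) ^ (u \ t).card)) := by
        refine Finset.sum_le_sum_of_subset_of_nonneg (Finset.filter_subset _ _) fun t _ _ => ?_
        have : (0 : ℝ) ≤ 1 - p := by linarith
        positivity
    _ = Real.exp (p / 4 * F.card) * (1 - p / 2) ^ F.card := by rw [← Finset.mul_sum, h3]
    _ ≤ Real.exp (p / 4 * F.card) * Real.exp (-(p / 2)) ^ F.card := by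
        refine mul_le_mul_of_nonneg_left (pow_le_pow_left₀ (by linarith) ?_ _) (Real.exp_pos _).le
        have := Real.add_one_le_exp (-(p / 2 : ℝ))
        linarith
    _ = Real.exp (-(p / 4 * F.card)) := by
        rw [← Real.exp_nat_mul, ← Real.exp_add]; congr 1; ring

end LowerTail

/-! ### Lower density of the random hypergraph -/

section RandomHypergraph

open Classical in
/-- All large `k`-tuples of parts of a partition into `M` parts span at least a quarter of the
expected number of edges. -/
def IsLowerDense (k M n : ℕ) (δ p : ℝ) (G : Hypergraph (Fin n)) : Prop :=
  ∀ π : Fin n → Fin M, ∀ e : Finset (Fin M), e.card = k →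
    (∀ P ∈ e, δ * n ≤ ((Finset.univ.filter fun x => π x = P).card : ℝ)) →
    p / 4 * ∏ P ∈ e, ((Finset.univ.filter fun x => π x = P).card : ℝ) ≤
      ((Finset.univ.powersetCard k).filter fun f : Finset (Fin n) =>
        f.image π = e ∧ (f : Set (Fin n)) ∈ G.edgeSet).card

-- Union bound over `M ^ n` maps and `2 ^ M` sets of parts. Each event is a lower tail for at least
-- `(δ * n) ^ k` transversal sets.
open Classical in
theorem measure_not_isLowerDense_le (k M n : ℕ) (δ : ℝ) (hδ : 0 ≤ δ) (p : I) :
    (randomHypergraph k n p).real {G | ¬ IsLowerDense k M n δ p G} ≤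
      M ^ n * 2 ^ M * Real.exp (-(p / 4 * (δ * n) ^ k)) := by
  have hp0 : (0 : ℝ) ≤ p := p.2.1
  let coe : Finset (Fin n) ↪ Set (Fin n) := ⟨fun f => (f : Set (Fin n)), Finset.coe_injective⟩
  set u : Finset (Set (Fin n)) := ((Finset.univ : Finset (Fin n)).powersetCard k).map coe with hu
  have hucoe : (u : Set (Set (Fin n))) = {e | e.ncard = k} := by
    ext e
    simp only [hu, Finset.coe_map, Set.mem_image, Finset.mem_coe, Finset.mem_powersetCard,
      Finset.subset_univ, true_and, coe, Function.Embedding.coeFn_mk, Set.mem_ofPred_eq]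
    constructor
    · rintro ⟨f, hf, rfl⟩
      rw [Set.ncard_coe_finset, hf]
    · intro he
      exact ⟨e.toFinite.toFinset, by rw [← Set.ncard_eq_toFinset_card, he], by simp⟩
  let F : (Fin n → Fin M) → Finset (Fin M) → Finset (Set (Fin n)) := fun π e =>
    (((Finset.univ : Finset (Fin n)).powersetCard k).filter fun f => f.image π = e).map coe
  have hFu : ∀ π e, F π e ⊆ u := fun π e => Finset.map_subset_map.2 (Finset.filter_subset _ _)
  let J : Finset ((Fin n → Fin M) × Finset (Fin M)) := Finset.univ.filter fun J =>
    J.2.card = k ∧ ∀ P ∈ J.2, δ * n ≤ ((Finset.univ.filter fun x => J.1 x = P).card : ℝ)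
  have hFcard : ∀ j ∈ J, ((F j.1 j.2).card : ℝ) =
      ∏ P ∈ j.2, ((Finset.univ.filter fun x => j.1 x = P).card : ℝ) := by
    intro j hj
    have hj' := (Finset.mem_filter.1 hj).2.1
    simp only [F, Finset.card_map]
    rw [card_transversals _ k _ _ hj']
    push_cast; rfl
  have hFle : ∀ j ∈ J, (δ * n) ^ k ≤ ((F j.1 j.2).card : ℝ) := by
    intro j hj
    obtain ⟨-, hj1, hj2⟩ := Finset.mem_filter.1 hj
    rw [hFcard j hj, ← hj1, ← Finset.prod_const]
    exact Finset.prod_le_prod (fun _ _ => by positivity) hj2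
  have hmeas : (randomHypergraph k n p).real {G | ¬ IsLowerDense k M n δ p G} =
      (setBernoulli (u : Set (Set (Fin n))) p).real
        (ofEdgeSet ⁻¹' {G | ¬ IsLowerDense k M n δ p G}) := by
    rw [hucoe, measureReal_def, measureReal_def, randomHypergraph,
      Measure.map_apply (measurable_ofEdgeSet n) trivial]
  have hsub : ofEdgeSet ⁻¹' {G | ¬ IsLowerDense k M n δ p G} ⊆ ⋃ j ∈ J,
      {S : Set (Set (Fin n)) | (((F j.1 j.2).filter fun x => x ∈ S).card : ℝ) <
        p / 4 * (F j.1 j.2).card} := by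
    intro S hS
    simp only [Set.mem_preimage, Set.mem_ofPred_eq, IsLowerDense] at hS
    push Not at hS
    obtain ⟨π, e, he, hlarge, hlt⟩ := hS
    have hj : (π, e) ∈ J := Finset.mem_filter.2 ⟨Finset.mem_univ _, he, hlarge⟩
    refine Set.mem_iUnion₂.2 ⟨(π, e), hj, ?_⟩
    rw [Set.mem_ofPred_eq, hFcard _ hj]
    refine lt_of_eq_of_lt ?_ hlt
    simp only [F, Finset.filter_map, Finset.card_map, Finset.filter_filter]
    rfl
  rw [hmeas]
  refine (measureReal_mono hsub (measure_ne_top _ _)).trans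
    ((measureReal_biUnion_finset_le _ _).trans ?_)
  have hterm : ∀ j ∈ J, (setBernoulli (u : Set (Set (Fin n))) p).real
      {S : Set (Set (Fin n)) | (((F j.1 j.2).filter fun x => x ∈ S).card : ℝ) <
        p / 4 * (F j.1 j.2).card} ≤ Real.exp (-(p / 4 * (δ * n) ^ k)) := by
    intro j hj
    refine le_trans ?_ ((setBernoulli_lower_tail u _ (hFu j.1 j.2) p).trans (Real.exp_le_exp.2 ?_))
    · exact le_of_eq (by congr!)
    · have := mul_le_mul_of_nonneg_left (hFle j hj) (show (0 : ℝ) ≤ p / 4 by positivity)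
      linarith
  refine (Finset.sum_le_card_nsmul _ _ _ hterm).trans ?_
  rw [nsmul_eq_mul]
  refine mul_le_mul_of_nonneg_right ?_ (Real.exp_pos _).le
  have : J.card ≤ M ^ n * 2 ^ M := by
    refine (Finset.card_filter_le _ _).trans (le_of_eq ?_)
    rw [Finset.card_univ, Fintype.card_prod, Fintype.card_fun, Fintype.card_fin, Fintype.card_fin,
      Fintype.card_finset, Fintype.card_fin]
  exact_mod_cast this

/-- The exponent `p / 4 * (δ * n) ^ k` is eventually at least `(M + 1) * n`, which beats the factor
`M ^ n ≤ exp (n * M)`. -/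
theorem tendsto_measure_isLowerDense (k M : ℕ) (hk : 1 ≤ k) (δ : ℝ) (hδ : 0 < δ) (p : ℕ → I)
    (hp : Tendsto (fun n : ℕ => (p n : ℝ) * (n : ℝ) ^ (k - 1)) atTop atTop) :
    Tendsto (fun n : ℕ => randomHypergraph k n (p n) {G | IsLowerDense k M n δ (p n) G})
      atTop (𝓝 1) := by
  have hreal : Tendsto (fun n : ℕ => (randomHypergraph k n (p n)).real
      {G | ¬ IsLowerDense k M n δ (p n) G}) atTop (𝓝 0) := by
    have hexp : Tendsto (fun n : ℕ => (2 : ℝ) ^ M * Real.exp (-(n : ℝ))) atTop (𝓝 0) := by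
      rw [← mul_zero ((2 : ℝ) ^ M)]
      exact (Real.tendsto_exp_neg_atTop_nhds_zero.comp tendsto_natCast_atTop_atTop).const_mul _
    refine tendsto_of_tendsto_of_tendsto_of_le_of_le' tendsto_const_nhds hexp
      (Eventually.of_forall fun n => measureReal_nonneg) ?_
    filter_upwards [hp.eventually_ge_atTop (4 * (M + 1) / δ ^ k)] with n hn
    refine (measure_not_isLowerDense_le k M n δ hδ.le (p n)).trans ?_
    have h1 : (M : ℝ) ^ n ≤ Real.exp (n * M) := by
      rw [Real.exp_nat_mul]
      refine pow_le_pow_left₀ (Nat.cast_nonneg M) ?_ _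
      have := Real.add_one_le_exp (M : ℝ)
      linarith
    have h2 : (M + 1 : ℝ) * n ≤ (p n : ℝ) / 4 * (δ * n) ^ k := by
      rw [div_le_iff₀ (by positivity)] at hn
      have h3 : (p n : ℝ) / 4 * (δ * n) ^ k =
          ((p n : ℝ) * (n : ℝ) ^ (k - 1) * δ ^ k) * n / 4 := by
        obtain ⟨κ, rfl⟩ := Nat.exists_eq_add_of_le' hk
        rw [Nat.add_sub_cancel, mul_pow, pow_succ (n : ℝ)]; ring
      rw [h3]
      have := mul_le_mul_of_nonneg_right hn (Nat.cast_nonneg n : (0 : ℝ) ≤ n)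
      linarith
    calc (M : ℝ) ^ n * 2 ^ M * Real.exp (-((p n : ℝ) / 4 * (δ * n) ^ k))
        ≤ Real.exp (n * M) * 2 ^ M * Real.exp (-((M + 1 : ℝ) * n)) := by
          gcongr
      _ = 2 ^ M * Real.exp (-(n : ℝ)) := by
          rw [mul_comm (Real.exp _), mul_assoc, ← Real.exp_add]; congr 2; ring
  have heq : ∀ n, randomHypergraph k n (p n) {G | IsLowerDense k M n δ (p n) G} =
      ENNReal.ofReal (1 - (randomHypergraph k n (p n)).real
        {G | ¬ IsLowerDense k M n δ (p n) G}) := by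
    intro n
    have h1 : {G | ¬ IsLowerDense k M n δ (p n) G} = {G | IsLowerDense k M n δ (p n) G}ᶜ := rfl
    rw [h1, probReal_compl_eq_one_sub (MeasurableSpace.measurableSet_top), sub_sub_cancel,
      ofReal_measureReal]
  simp_rw [heq]
  have := ENNReal.tendsto_ofReal (hreal.const_sub 1)
  simpa using this

end RandomHypergraph

/-! ### A one-sided energy of partitions -/

section Energy

variable {V ι ι' : Type*}

open Classical in
/-- The amount by which the number of the `k`-sets in `S` that belong to `E` falls short of
`d` times the number of all of them; it may be negative. -/
noncomputable def shortfall (d : ℝ) (E : Set (Finset V)) (S : Finset (Finset V)) : ℝ :=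
  ∑ f ∈ S, (d - if f ∈ E then 1 else 0)

theorem shortfall_le {d : ℝ} (E : Set (Finset V)) (S : Finset (Finset V)) :
    shortfall d E S ≤ d * S.card := by
  unfold shortfall
  rw [mul_comm, ← nsmul_eq_mul, ← Finset.sum_const]
  refine Finset.sum_le_sum fun f _ => ?_
  split_ifs <;> linarith

variable [Fintype V] [DecidableEq ι] [DecidableEq ι']

/-- The `k`-sets of vertices with type `e`. -/
def ofType (π : V → ι) (k : ℕ) (e : Finset ι) : Finset (Finset V) :=
  (Finset.univ.powersetCard k).filter fun f => f.image π = e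

theorem mem_ofType {π : V → ι} {k : ℕ} {e : Finset ι} {f : Finset V} :
    f ∈ ofType π k e ↔ f.card = k ∧ f.image π = e := by
  simp [ofType]

/-- Refining a partition does not decrease the contribution of a type to the energy, and a union of
types of the refinement bounds it from below. -/
theorem shortfall_le_sum_fiber [Fintype ι'] {π : V → ι} {π' : V → ι'} {q : ι' → ι} (hq : ∀ x, q (π' x) = π x)
    (k : ℕ) (d : ℝ) (E : Set (Finset V)) (e : Finset ι) (L : Finset ι') :
    shortfall d E ((ofType π k e).filter fun f => f.image π' ⊆ L) ≤
      ∑ e' ∈ Finset.univ.filter (fun e' : Finset ι' => e'.image q = e),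
        max 0 (shortfall d E (ofType π' k e')) := by
  have himg : ∀ f : Finset V, (f.image π').image q = f.image π := fun f => by
    rw [Finset.image_image]; exact Finset.image_congr fun x _ => hq x
  have h1 : shortfall d E ((ofType π k e).filter fun f => f.image π' ⊆ L) =
      ∑ e' ∈ Finset.univ.filter (fun e' : Finset ι' => e'.image q = e ∧ e' ⊆ L),
        shortfall d E (ofType π' k e') := by
    unfold shortfall
    rw [← Finset.sum_fiberwise_of_maps_to (g := fun f : Finset V => f.image π')
      (t := Finset.univ.filter (fun e' : Finset ι' => e'.image q = e ∧ e' ⊆ L))]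
    · refine Finset.sum_congr rfl fun e' he' => Finset.sum_congr ?_ fun _ _ => rfl
      ext f
      simp only [Finset.mem_filter, mem_ofType, Finset.mem_univ, true_and] at he' ⊢
      constructor
      · rintro ⟨⟨⟨h1, -⟩, -⟩, h2⟩
        exact ⟨h1, h2⟩
      · rintro ⟨h1, rfl⟩
        exact ⟨⟨⟨h1, by rw [← himg, he'.1]⟩, he'.2⟩, rfl⟩
    · intro f hf
      simp only [Finset.mem_filter, mem_ofType, Finset.mem_univ, true_and] at hf ⊢
      exact ⟨by rw [himg, hf.1.2], hf.2⟩
  rw [h1]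
  refine (Finset.sum_le_sum fun e' _ => le_max_right 0 _).trans
    (Finset.sum_le_sum_of_subset_of_nonneg ?_ fun _ _ _ => le_max_left _ _)
  intro e' he'
  simp only [Finset.mem_filter, Finset.mem_univ, true_and] at he' ⊢
  exact he'.1

variable [Fintype ι] [Fintype ι'] {r : ℕ}

/-- The energy of a partition: the total positive shortfall over all types and colours. -/
noncomputable def energy (k : ℕ) (d : ℝ) (E : Fin r → Set (Finset V)) (π : V → ι) : ℝ :=
  ∑ c, ∑ e : Finset ι, max 0 (shortfall d (E c) (ofType π k e))

theorem energy_nonneg (k : ℕ) (d : ℝ) (E : Fin r → Set (Finset V)) (π : V → ι) :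
    0 ≤ energy k d E π :=
  Finset.sum_nonneg fun _ _ => Finset.sum_nonneg fun _ _ => le_max_left _ _

/-- A shortfall is at most `d` times the number of `k`-sets, whatever `E` is. This replaces the
upper-regularity assumption usual for sparse hypergraphs. -/
theorem energy_le (k : ℕ) {d : ℝ} (hd : 0 ≤ d) (E : Fin r → Set (Finset V)) (π : V → ι) :
    energy k d E π ≤ r * (d * (Fintype.card V : ℝ) ^ k) := by
  have h1 : ∀ c, ∑ e : Finset ι, max 0 (shortfall d (E c) (ofType π k e)) ≤
      d * (Fintype.card V : ℝ) ^ k := by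
    intro c
    calc ∑ e : Finset ι, max 0 (shortfall d (E c) (ofType π k e))
        ≤ ∑ e : Finset ι, d * ((ofType π k e).card : ℝ) :=
          Finset.sum_le_sum fun e _ => max_le (by positivity) (shortfall_le _ _)
      _ = d * (((Finset.univ : Finset V).powersetCard k).card : ℝ) := by
          rw [← Finset.mul_sum]
          congr 1
          rw [Finset.card_eq_sum_card_fiberwise (f := fun f : Finset V => f.image π)
            (t := Finset.univ) fun _ _ => Finset.mem_coe.2 (Finset.mem_univ _)]
          push_cast; rfl
      _ ≤ d * (Fintype.card V : ℝ) ^ k := by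
          refine mul_le_mul_of_nonneg_left ?_ hd
          rw [Finset.card_powersetCard, Finset.card_univ]
          exact_mod_cast Nat.choose_le_pow _ _
  refine (Finset.sum_le_sum fun c _ => h1 c).trans ?_
  simp

/-- The positive part of a sum is at most the sum of the positive parts, so no type loses by
refinement. A type in `S` contributes `0` in colour `c` before and at least `g` afterwards, thanks
to the finer types inside `L`. -/
theorem energy_gain {π : V → ι} {π' : V → ι'} {q : ι' → ι} (hq : ∀ x, q (π' x) = π x)
    (k : ℕ) (d : ℝ) (E : Fin r → Set (Finset V)) (S : Finset (Finset ι)) (g : ℝ)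
    (hS : ∀ e ∈ S, ∃ c, ∃ L : Finset ι', shortfall d (E c) (ofType π k e) ≤ 0 ∧
      g ≤ shortfall d (E c) ((ofType π k e).filter fun f => f.image π' ⊆ L)) :
    energy k d E π + S.card * g ≤ energy k d E π' := by
  set D : Fin r → Finset ι → ℝ := fun c e =>
    ∑ e' ∈ Finset.univ.filter (fun e' : Finset ι' => e'.image q = e),
      max 0 (shortfall d (E c) (ofType π' k e')) with hD
  have hE' : energy k d E π' = ∑ e : Finset ι, ∑ c, D c e := by
    rw [Finset.sum_comm]
    unfold energy
    refine Finset.sum_congr rfl fun c _ => ?_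
    exact (Finset.sum_fiberwise _ _ _).symm
  have hmono : ∀ c e, max 0 (shortfall d (E c) (ofType π k e)) ≤ D c e := by
    intro c e
    refine max_le (Finset.sum_nonneg fun _ _ => le_max_left _ _) ?_
    have := shortfall_le_sum_fiber hq k d (E c) e Finset.univ
    rwa [Finset.filter_true_of_mem fun f _ => Finset.subset_univ _] at this
  have hgain : ∀ e ∈ S, g ≤ ∑ c, (D c e - max 0 (shortfall d (E c) (ofType π k e))) := by
    intro e he
    obtain ⟨c, L, h1, h2⟩ := hS e he
    refine le_trans ?_ (Finset.single_le_sum (fun c _ => sub_nonneg.2 (hmono c e))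
      (Finset.mem_univ c))
    rw [max_eq_left h1, sub_zero]
    exact h2.trans (shortfall_le_sum_fiber hq k d (E c) e L)
  have htot : (S.card : ℝ) * g ≤
      ∑ e : Finset ι, ∑ c, (D c e - max 0 (shortfall d (E c) (ofType π k e))) := by
    calc (S.card : ℝ) * g = ∑ _e ∈ S, g := by rw [Finset.sum_const, nsmul_eq_mul]
      _ ≤ ∑ e ∈ S, ∑ c, (D c e - max 0 (shortfall d (E c) (ofType π k e))) :=
        Finset.sum_le_sum hgain
      _ ≤ _ := Finset.sum_le_sum_of_subset_of_nonneg (Finset.subset_univ _) fun e _ _ =>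
        Finset.sum_nonneg fun c _ => sub_nonneg.2 (hmono c e)
  have hE : energy k d E π = ∑ e : Finset ι, ∑ c, max 0 (shortfall d (E c) (ofType π k e)) :=
    Finset.sum_comm
  simp only [Finset.sum_sub_distrib] at htot
  rw [hE, hE']
  linarith

theorem energy_mono {π : V → ι} {π' : V → ι'} {q : ι' → ι} (hq : ∀ x, q (π' x) = π x)
    (k : ℕ) (d : ℝ) (E : Fin r → Set (Finset V)) : energy k d E π ≤ energy k d E π' := by
  simpa using energy_gain hq k d E ∅ 0 (by simp)

end Energy

/-! ### Cutting parts into equal pieces -/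

section Splitting

variable {V ι : Type*} [DecidableEq V]

/-- A set can be cut into pieces of size `s`, numbered from `0`, and a smaller remainder. -/
theorem exists_pieces (A : Finset V) {s : ℕ} (hs : 1 ≤ s) : ∃ g : V → ℕ,
    (∀ j, (j + 1) * s ≤ A.card → (A.filter fun x => g x = j).card = s) ∧
    (∀ x ∈ A, g x * s ≤ A.card) ∧ (A.filter fun x => A.card < (g x + 1) * s).card ≤ s := by
  induction hn : A.card using Nat.strong_induction_on generalizing A with
  | _ n ih =>
    by_cases hA : n < s
    · refine ⟨fun _ => 0, fun j hj => ?_, fun x _ => by simp, ?_⟩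
      · have : s ≤ (j + 1) * s := Nat.le_mul_of_pos_left _ (by omega)
        omega
      · exact (Finset.card_filter_le _ _).trans (by omega)
    · obtain ⟨A₀, hA₀, hc⟩ := Finset.exists_subset_card_eq (show s ≤ A.card by omega)
      have hcard : (A \ A₀).card = n - s := by rw [Finset.card_sdiff_of_subset hA₀, hn, hc]
      obtain ⟨g, h1, h2, h3⟩ := ih (n - s) (by omega) (A \ A₀) hcard
      refine ⟨fun x => if x ∈ A₀ then 0 else g x + 1, fun j hj => ?_, fun x hx => ?_, ?_⟩
      · cases j with
        | zero =>
          rw [← hc]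
          congr 1
          ext x
          rw [Finset.mem_filter]
          constructor
          · rintro ⟨_, h⟩
            by_contra hx
            simp [hx] at h
          · exact fun hx => ⟨hA₀ hx, by simp [hx]⟩
        | succ j =>
          rw [← h1 j (by rw [add_mul, one_mul] at hj; omega)]
          congr 1
          ext x
          simp only [Finset.mem_filter, Finset.mem_sdiff]
          by_cases hx : x ∈ A₀ <;> simp [hx]
      · by_cases hx₀ : x ∈ A₀
        · simp [hx₀]
        · have := h2 x (Finset.mem_sdiff.2 ⟨hx, hx₀⟩)
          simp only [hx₀, if_false, add_mul, one_mul]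
          omega
      · refine le_trans (Finset.card_le_card fun x hx => ?_) h3
        simp only [Finset.mem_filter, Finset.mem_sdiff] at hx ⊢
        by_cases hx₀ : x ∈ A₀
        · simp [hx₀] at hx
          omega
        · simp only [hx₀, if_false] at hx
          refine ⟨⟨hx.1, hx₀⟩, ?_⟩
          have := hx.2
          rw [add_mul _ 1, one_mul] at this
          omega

/-- The simultaneous version of `exists_pieces` for all parts of a partition. -/
theorem exists_pieces_of_parts [Fintype V] [DecidableEq ι] (π : V → ι) {s : ℕ} (hs : 1 ≤ s) :
    ∃ g : V → ℕ,
      (∀ P j, (j + 1) * s ≤ (Finset.univ.filter fun x => π x = P).card →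
        (Finset.univ.filter fun x => π x = P ∧ g x = j).card = s) ∧
      (∀ x, g x * s ≤ (Finset.univ.filter fun y => π y = π x).card) ∧
      ∀ P, (Finset.univ.filter fun x => π x = P ∧
        (Finset.univ.filter fun y => π y = P).card < (g x + 1) * s).card ≤ s := by
  choose g h1 h2 h3 using fun P => exists_pieces (Finset.univ.filter fun x => π x = P) hs
  refine ⟨fun x => g (π x) x, fun P j hj => ?_, fun x => h2 _ x (by simp), fun P => ?_⟩
  · rw [← h1 P j hj, Finset.filter_filter]
    congr 1
    ext x
    simp only [Finset.mem_filter, Finset.mem_univ, true_and]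
    exact and_congr_right fun h => by rw [h]
  · refine le_trans (le_of_eq ?_) (h3 P)
    rw [Finset.filter_filter]
    congr 1
    ext x
    simp only [Finset.mem_filter, Finset.mem_univ, true_and]
    exact and_congr_right fun h => by rw [h]

end Splitting

/-! ### The regularity lemma -/

section Regularity

open Classical in
/-- `J` indexes parts of the same size `s` that cover most vertices, and most `k`-sets of these parts
are hit by some colour. -/
structure IsRegularPartition {n m r : ℕ} (k : ℕ) (ε ε' η : ℝ)
    (E : Fin r → Set (Finset (Fin n))) (π : Fin n → Fin m) (J : Finset (Fin m)) (s : ℕ) : Prop where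
  card_part : ∀ P ∈ J, (Finset.univ.filter fun x => π x = P).card = s
  size_le : (s : ℝ) ≤ η * n
  cover : (1 - η) * n ≤ J.card * s
  few_bad : (((J.powersetCard k).filter fun e => ∀ c, ¬ Hits π ⌈ε * s⌉₊ (E c) e).card : ℝ) ≤
    ε' * J.card.choose k

open Classical in
/-- The colour classes together have density at least `r * d` on tuples of large parts. -/
def IsJointlyDense {n r : ℕ} (k m : ℕ) (δ d : ℝ) (E : Fin r → Set (Finset (Fin n))) : Prop :=
  ∀ π : Fin n → Fin m, ∀ e : Finset (Fin m), e.card = k →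
    (∀ P ∈ e, δ * n ≤ ((Finset.univ.filter fun x => π x = P).card : ℝ)) →
    r * d * ∏ P ∈ e, ((Finset.univ.filter fun x => π x = P).card : ℝ) ≤
      ∑ c, (((ofType π k e).filter fun f => f ∈ E c).card : ℝ)

/-- A map to fewer parts is a map to more parts, some of them empty. -/
theorem IsJointlyDense.mono {n r k m m' : ℕ} {δ δ' d : ℝ} {E : Fin r → Set (Finset (Fin n))}
    (h : IsJointlyDense k m δ d E) (hm : m' ≤ m) (hδ : δ ≤ δ') : IsJointlyDense k m' δ' d E := by
  intro π e he hlarge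
  have hpart : ∀ P, (Finset.univ.filter fun x => Fin.castLE hm (π x) = Fin.castLE hm P) =
      Finset.univ.filter fun x => π x = P := fun P => by
    ext x; simp
  have htype : ofType (fun x => Fin.castLE hm (π x)) k (e.map (Fin.castLEEmb hm)) = ofType π k e := by
    ext f
    rw [mem_ofType, mem_ofType, ← Finset.map_inj (f := Fin.castLEEmb hm), Finset.map_eq_image,
      Finset.map_eq_image, Finset.image_image]
    rfl
  have := h (fun x => Fin.castLE hm (π x)) (e.map (Fin.castLEEmb hm)) (by rw [Finset.card_map, he])
    (by
      intro P hP
      obtain ⟨P, hP', rfl⟩ := Finset.mem_map.1 hP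
      refine le_trans (mul_le_mul_of_nonneg_right hδ (Nat.cast_nonneg n)) ((hlarge P hP').trans ?_)
      exact_mod_cast (congrArg Finset.card (hpart P)).ge)
  rw [Finset.prod_map, htype] at this
  convert this using 4
  rename_i P _
  exact congrArg Finset.card (hpart P).symm

theorem shortfall_eq {V : Type*} {d : ℝ} {E : Set (Finset V)} {S : Finset (Finset V)}
    [DecidablePred (· ∈ E)] :
    shortfall d E S = d * S.card - (S.filter fun f => f ∈ E).card := by
  unfold shortfall
  rw [Finset.sum_sub_distrib, Finset.sum_const, nsmul_eq_mul, mul_comm, ← Finset.sum_boole]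
  congr!

/-- A `k`-set of large parts that no colour hits has a colour with non-positive shortfall and a
witness on which the shortfall is large. -/
theorem exists_witness {n m r k h s : ℕ} (hr : 1 ≤ r) {δ d : ℝ} (hd : 0 < d)
    {E : Fin r → Set (Finset (Fin n))} (hdense : IsJointlyDense k m δ d E) (π : Fin n → Fin m)
    {e : Finset (Fin m)} (he : e.card = k)
    (hs : ∀ P ∈ e, (Finset.univ.filter fun x => π x = P).card = s) (hδs : δ * n ≤ s)
    (hbad : ∀ c, ¬ Hits π h (E c) e) :
    ∃ c B, shortfall d (E c) (ofType π k e) ≤ 0 ∧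
      d * (h : ℝ) ^ k ≤ shortfall d (E c) ((ofType π k e).filter fun f => f ⊆ B) := by
  classical
  have hcard : (ofType π k e).card = s ^ k := by
    rw [ofType, card_transversals π k _ e he, Finset.prod_congr rfl hs, Finset.prod_const, he]
  -- By averaging, some colour has density at least `d` on these parts; its witness is the one to
  -- use.
  obtain ⟨c, hc⟩ : ∃ c, d * s ^ k ≤ (((ofType π k e).filter fun f => f ∈ E c).card : ℝ) := by
    by_contra! hno
    have h1 := hdense π e he fun P hP => by rw [hs P hP]; exact hδs
    rw [Finset.prod_congr rfl fun P hP => by rw [hs P hP], Finset.prod_const, he] at h1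
    have h2 : ∑ c, (((ofType π k e).filter fun f => f ∈ E c).card : ℝ) <
        ∑ _c : Fin r, d * (s : ℝ) ^ k :=
      Finset.sum_lt_sum_of_nonempty ⟨⟨0, hr⟩, Finset.mem_univ _⟩ fun c _ => hno c
    rw [Finset.sum_const, Finset.card_univ, Fintype.card_fin, nsmul_eq_mul, ← mul_assoc] at h2
    refine absurd h1 (not_le.2 (lt_of_eq_of_lt ?_ h2))
    congr!
  have hb := hbad c
  unfold Hits at hb
  push Not at hb
  obtain ⟨B, hB, hBE⟩ := hb
  refine ⟨c, B, ?_, ?_⟩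
  · rw [shortfall_eq, hcard]; push_cast; linarith
  · have hempty : ((ofType π k e).filter fun f => f ⊆ B).filter (fun f => f ∈ E c) = ∅ := by
      rw [Finset.filter_eq_empty_iff]
      intro f hf hfE
      rw [Finset.mem_filter, mem_ofType] at hf
      exact hBE f hfE hf.2 hf.1.2
    have hset : ((ofType π k e).filter fun f => f ⊆ B) =
        (B.powersetCard k).filter fun f => f.image π = e := by
      ext f
      simp only [Finset.mem_filter, mem_ofType, Finset.mem_powersetCard]
      tauto
    rw [shortfall_eq, hempty, hset, card_transversals π k B e he, Finset.card_empty, Nat.cast_zero,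
      sub_zero]
    refine mul_le_mul_of_nonneg_left ?_ hd.le
    rw [← he, ← Finset.prod_const]
    push_cast
    exact Finset.prod_le_prod (fun _ _ => by positivity) fun P hP => by exact_mod_cast hB P hP

/-- Cutting all parts into pieces of the same size, up to few leftover vertices. -/
theorem exists_equal_parts {n m Q s : ℕ} (hs : 1 ≤ s) (hn : n ≤ Q * s) (π : Fin n → Fin m) :
    ∃ π' : Fin n → Fin (m * (Q + 1)), ∃ q : Fin (m * (Q + 1)) → Fin m, (∀ x, q (π' x) = π x) ∧
      ∃ J : Finset (Fin (m * (Q + 1))), (∀ P ∈ J, (Finset.univ.filter fun x => π' x = P).card = s) ∧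
        n ≤ J.card * s + m * s := by
  obtain ⟨g, h1, h2, h3⟩ := exists_pieces_of_parts π hs
  have hg : ∀ x, g x < Q + 1 := by
    intro x
    have h4 := h2 x
    have h5 : (Finset.univ.filter fun y => π y = π x).card ≤ n := by
      simpa using Finset.card_filter_le (Finset.univ : Finset (Fin n)) fun y => π y = π x
    have h6 : g x * s ≤ Q * s := by omega
    exact Nat.lt_succ_of_le (Nat.le_of_mul_le_mul_right h6 hs)
  set π' : Fin n → Fin (m * (Q + 1)) := fun x => finProdFinEquiv (π x, ⟨g x, hg x⟩) with hπ'
  set J := Finset.univ.filter fun P => (Finset.univ.filter fun x => π' x = P).card = s with hJ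
  refine ⟨π', fun P => (finProdFinEquiv.symm P).1, fun x => by simp [hπ'], J,
    fun P hP => (Finset.mem_filter.1 hP).2, ?_⟩
  have hin : (Finset.univ.filter fun x => π' x ∈ J).card = J.card * s := by
    rw [Finset.card_eq_sum_card_fiberwise (f := π') (t := J) fun x hx => by simpa using hx]
    rw [Finset.sum_congr rfl (g := fun _ => s), Finset.sum_const, smul_eq_mul]
    intro P hP
    rw [← (Finset.mem_filter.1 hP).2, Finset.filter_filter]
    congr 1
    ext x
    simp only [Finset.mem_filter, Finset.mem_univ, true_and]
    exact ⟨fun h => h.2, fun h => ⟨h ▸ hP, h⟩⟩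
  have hout : (Finset.univ.filter fun x => ¬ π' x ∈ J).card ≤ m * s := by
    have hsub : (Finset.univ.filter fun x => ¬ π' x ∈ J) ⊆ Finset.univ.biUnion fun P =>
        Finset.univ.filter fun x => π x = P ∧
          (Finset.univ.filter fun y => π y = P).card < (g x + 1) * s := by
      intro x hx
      simp only [Finset.mem_filter, Finset.mem_univ, true_and, Finset.mem_biUnion] at hx ⊢
      refine ⟨π x, rfl, ?_⟩
      by_contra! hle
      apply hx
      rw [hJ, Finset.mem_filter]
      refine ⟨Finset.mem_univ _, ?_⟩
      rw [← h1 (π x) (g x) hle]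
      congr 1
      ext y
      simp [hπ', Fin.ext_iff]
    refine (Finset.card_le_card hsub).trans ((Finset.card_biUnion_le_card_mul _ _ s fun P _ =>
      h3 P).trans ?_)
    simp
  have := Finset.card_filter_add_card_filter_not (s := (Finset.univ : Finset (Fin n)))
    (fun x => π' x ∈ J)
  rw [Finset.card_univ, Fintype.card_fin] at this
  omega

/-- Turns a proportion of the `k`-sets of parts into a proportion of `n ^ k`, using `t + 1 - k ≥ t /
2`. -/
theorem pow_le_choose_mul_pow {k t s n : ℕ} (ht : 2 * k ≤ t) (hn : (n : ℝ) ≤ 2 * (t * s)) :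
    ((n : ℝ) / 4) ^ k / k.factorial ≤ t.choose k * (s : ℝ) ^ k := by
  have h1 := Nat.pow_le_choose (α := ℝ) k t
  have h2 : (t : ℝ) / 2 ≤ ((t + 1 - k : ℕ) : ℝ) := by
    rw [Nat.cast_sub (by omega)]
    push_cast
    have : (2 * k : ℝ) ≤ t := by exact_mod_cast ht
    linarith
  calc ((n : ℝ) / 4) ^ k / k.factorial ≤ ((t : ℝ) / 2 * s) ^ k / k.factorial := by
        gcongr
        linarith
    _ = ((t : ℝ) / 2) ^ k / k.factorial * (s : ℝ) ^ k := by rw [mul_pow]; ring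
    _ ≤ ((t + 1 - k : ℕ) : ℝ) ^ k / k.factorial * (s : ℝ) ^ k := by gcongr
    _ ≤ _ := by gcongr

/-- Cut the parts of `π` into equal pieces, which costs no energy. If too many sets of pieces are
bad, refine by all their witnesses at once: each bad set gains at least `d * (ε * s) ^ k`. -/
theorem regularity_step (k r m : ℕ) (hr : 1 ≤ r) (hm : 1 ≤ m) {ε ε' η : ℝ}
    (hε : 0 < ε) (hε' : 0 < ε') (hη : 0 < η) (hη' : (2 * k + 1) * η ≤ 1) (hη2 : η ≤ 1 / 2) :
    ∃ M₁ M₂ n₀ : ℕ, ∃ δ : ℝ, 0 < δ ∧ 1 ≤ M₂ ∧ ∀ n, n₀ ≤ n → ∀ d : ℝ, 0 < d →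
      ∀ E : Fin r → Set (Finset (Fin n)), IsJointlyDense k M₁ δ d E → ∀ π : Fin n → Fin m,
      (∃ π' : Fin n → Fin M₁, ∃ J s, IsRegularPartition k ε ε' η E π' J s ∧ δ * n ≤ s) ∨
      ∃ π' : Fin n → Fin M₂, energy k d E π +
        ε' * (ε / 4) ^ k / k.factorial * (d * (n : ℝ) ^ k) ≤ energy k d E π' := by
  classical
  have hm0 : (0 : ℝ) < m := by exact_mod_cast hm
  -- Pieces have size about `η * n / m`, at least half of that after rounding, so the piece numbers
  -- are at most `Q`.
  set Q := ⌈2 * m / η⌉₊ with hQ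
  have hQ1 : 2 * m / η ≤ Q := Nat.le_ceil _
  set M₁ := m * (Q + 1) with hM₁
  refine ⟨M₁, Fintype.card (Fin M₁ × (Finset (Fin M₁) → Bool)), Q, η / (2 * m), by positivity, ?_,
    fun n hn d hd E hdense π => ?_⟩
  · have : 0 < M₁ := by positivity
    have : Nonempty (Fin M₁) := ⟨⟨0, this⟩⟩
    exact Fintype.card_pos
  set s := ⌊η * n / m⌋₊ with hs
  have hnQ : 2 * m / η ≤ n := hQ1.trans (by exact_mod_cast hn)
  have hn2 : 2 ≤ η * n / m := by
    rw [le_div_iff₀ hm0]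
    rw [div_le_iff₀ hη] at hnQ
    linarith
  have hs_le : (s : ℝ) ≤ η * n / m := Nat.floor_le (by positivity)
  have hs_ge : η * n / (2 * m) ≤ s := by
    have h1 := Nat.lt_floor_add_one (η * n / m)
    have h2 : η * n / (2 * m) = η * n / m / 2 := by field_simp
    rw [h2]; linarith
  have hs1 : 1 ≤ s := by
    rw [hs, Nat.le_floor_iff (by positivity)]
    push_cast; linarith
  have hsη : (s : ℝ) ≤ η * n := by
    refine hs_le.trans (div_le_self (by positivity) ?_)
    exact_mod_cast hm
  have hδs : η / (2 * m) * n ≤ s := by rw [div_mul_eq_mul_div]; exact hs_ge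
  have hnQs : n ≤ Q * s := by
    have h1 : (n : ℝ) ≤ Q * s := by
      calc (n : ℝ) = 2 * m / η * (η * n / (2 * m)) := by field_simp
        _ ≤ Q * s := by gcongr
    exact_mod_cast h1
  obtain ⟨π₁, q, hq, J, hJ, hcov⟩ := exists_equal_parts hs1 hnQs π
  have hcover : (1 - η) * n ≤ (J.card : ℝ) * s := by
    have h1 : (n : ℝ) ≤ J.card * s + m * s := by exact_mod_cast hcov
    have h2 : (m : ℝ) * s ≤ η * n := by
      rw [le_div_iff₀ hm0] at hs_le
      linarith
    linarith
  by_cases hfew : (((J.powersetCard k).filter fun e => ∀ c, ¬ Hits π₁ ⌈ε * s⌉₊ (E c) e).card : ℝ) ≤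
      ε' * J.card.choose k
  · left
    refine ⟨π₁, J, s, ⟨fun P hP => ?_, hsη, hcover, ?_⟩, hδs⟩
    · rw [← hJ P hP]
    · convert hfew
  right
  push Not at hfew
  set S := (J.powersetCard k).filter fun e => ∀ c, ¬ Hits π₁ ⌈ε * s⌉₊ (E c) e with hS
  have hwit : ∀ e : Finset (Fin M₁), ∃ B c, e ∈ S → shortfall d (E c) (ofType π₁ k e) ≤ 0 ∧
      d * (⌈ε * s⌉₊ : ℝ) ^ k ≤ shortfall d (E c) ((ofType π₁ k e).filter fun f => f ⊆ B) := by
    intro e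
    by_cases he : e ∈ S
    · obtain ⟨heI, hebad⟩ := Finset.mem_filter.1 he
      rw [Finset.mem_powersetCard] at heI
      obtain ⟨c, B, h⟩ := exists_witness hr hd hdense π₁ heI.2 (fun P hP => hJ P (heI.1 hP)) hδs hebad
      exact ⟨B, c, fun _ => h⟩
    · exact ⟨∅, ⟨0, hr⟩, fun h => absurd h he⟩
  choose B c hBc using hwit
  let φ := Fintype.equivFin (Fin M₁ × (Finset (Fin M₁) → Bool))
  -- The new part of a vertex records which witnesses contain it, so within each old part a witness
  -- is a union of new parts.
  let π₂ : Fin n → Fin (Fintype.card (Fin M₁ × (Finset (Fin M₁) → Bool))) := fun x =>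
    φ (π₁ x, fun e => decide (x ∈ B e))
  refine ⟨π₂, ?_⟩
  have hgain := energy_gain (π := π₁) (π' := π₂) (q := fun y => (φ.symm y).1)
    (fun x => by simp [π₂]) k d E S (d * (⌈ε * s⌉₊ : ℝ) ^ k) (by
      intro e he
      obtain ⟨h1, h2⟩ := hBc e he
      refine ⟨c e, Finset.univ.filter fun y => (φ.symm y).2 e = true, h1, h2.trans (le_of_eq ?_)⟩
      congr 1
      refine Finset.filter_congr fun f _ => ?_
      rw [Finset.image_subset_iff]
      simp [π₂, Finset.subset_iff])
  have hmono := energy_mono hq k d E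
  have ht : 2 * k ≤ J.card := by
    have hn0 : (0 : ℝ) < n := lt_of_lt_of_le (by positivity) hnQ
    have h1 : (2 * k : ℝ) * (η * n) ≤ J.card * (η * n) := by
      calc (2 * k : ℝ) * (η * n) ≤ (1 - η) * n := by nlinarith
        _ ≤ J.card * s := hcover
        _ ≤ J.card * (η * n) := by gcongr
    have := le_of_mul_le_mul_right h1 (by positivity)
    exact_mod_cast this
  have hchoose := pow_le_choose_mul_pow (k := k) (s := s) (n := n) ht (by nlinarith)
  have hfinal : ε' * (ε / 4) ^ k / k.factorial * (d * (n : ℝ) ^ k) ≤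
      S.card * (d * (⌈ε * s⌉₊ : ℝ) ^ k) := by
    calc ε' * (ε / 4) ^ k / k.factorial * (d * (n : ℝ) ^ k)
        = ε' * d * ε ^ k * (((n : ℝ) / 4) ^ k / k.factorial) := by
          rw [div_pow, div_pow]; ring
      _ ≤ ε' * d * ε ^ k * (J.card.choose k * (s : ℝ) ^ k) := by gcongr
      _ = ε' * J.card.choose k * (d * (ε * s) ^ k) := by rw [mul_pow]; ring
      _ ≤ S.card * (d * (⌈ε * s⌉₊ : ℝ) ^ k) := by
          gcongr
          exact Nat.le_ceil _
  linarith

/-- A sparse weak hypergraph regularity lemma, for several colours. -/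
theorem exists_isRegularPartition (k r : ℕ) (hr : 1 ≤ r) {ε ε' η : ℝ}
    (hε : 0 < ε) (hε' : 0 < ε') (hη : 0 < η) (hη' : (2 * k + 1) * η ≤ 1) (hη2 : η ≤ 1 / 2) :
    ∃ M n₀ : ℕ, ∃ δ : ℝ, 0 < δ ∧ ∀ n, n₀ ≤ n → ∀ d : ℝ, 0 < d →
      ∀ E : Fin r → Set (Finset (Fin n)), IsJointlyDense k M δ d E →
      ∃ m ≤ M, ∃ π : Fin n → Fin m, ∃ J s, IsRegularPartition k ε ε' η E π J s ∧ δ * n ≤ s := by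
  set γ := ε' * (ε / 4) ^ k / k.factorial with hγ
  have hγ0 : 0 < γ := by positivity
  -- `N` bounds the refinements that the remaining energy allows. The constants are fixed before
  -- `n`, `d` and the partition.
  have key : ∀ N : ℕ, ∀ m, 1 ≤ m → ∃ M n₀ : ℕ, ∃ δ : ℝ, 0 < δ ∧ ∀ n, n₀ ≤ n → ∀ d : ℝ, 0 < d →
      ∀ E : Fin r → Set (Finset (Fin n)), IsJointlyDense k M δ d E → ∀ π₀ : Fin n → Fin m,
      r * (d * (n : ℝ) ^ k) ≤ energy k d E π₀ + N * γ * (d * (n : ℝ) ^ k) →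
      ∃ m ≤ M, ∃ π : Fin n → Fin m, ∃ J s, IsRegularPartition k ε ε' η E π J s ∧ δ * n ≤ s := by
    intro N
    induction N with
    | zero =>
      intro m hm
      obtain ⟨M₁, M₂, n₀, δ, hδ, -, h⟩ := regularity_step k r m hr hm hε hε' hη hη' hη2
      -- `n ≥ 1` makes a further gain strictly positive, which contradicts `energy_le`.
      refine ⟨M₁, n₀ + 1, δ, hδ, fun n hn d hd E hdense π₀ henergy => ?_⟩
      rcases h n (by omega) d hd E hdense π₀ with h | ⟨π', h⟩
      · exact ⟨M₁, le_rfl, h⟩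
      · have h1 := energy_le k hd.le E π'
        rw [Fintype.card_fin] at h1
        have hn0 : (0 : ℝ) < n := by exact_mod_cast (by omega : 0 < n)
        have h2 : 0 < γ * (d * (n : ℝ) ^ k) := by positivity
        simp only [Nat.cast_zero, zero_mul, add_zero] at henergy
        linarith
    | succ N ih =>
      intro m hm
      obtain ⟨M₁, M₂, n₀, δ, hδ, hM₂, h⟩ := regularity_step k r m hr hm hε hε' hη hη' hη2
      obtain ⟨M, n₁, δ', hδ', h'⟩ := ih M₂ hM₂
      refine ⟨max M₁ M, max n₀ n₁, min δ δ', lt_min hδ hδ', fun n hn d hd E hdense π₀ henergy => ?_⟩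
      have hn0 : (0 : ℝ) ≤ n := Nat.cast_nonneg n
      rcases h n (le_trans (le_max_left _ _) hn) d hd E
        (hdense.mono (le_max_left _ _) (min_le_left _ _)) π₀ with ⟨π, J, s, h1, h2⟩ | ⟨π', h1⟩
      · exact ⟨M₁, le_max_left _ _, π, J, s, h1,
          (mul_le_mul_of_nonneg_right (min_le_left _ _) hn0).trans h2⟩
      · obtain ⟨m', hm', π, J, s, h3, h4⟩ := h' n (le_trans (le_max_right _ _) hn) d hd E
          (hdense.mono (le_max_right _ _) (min_le_right _ _)) π' (by
            push_cast at henergy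
            linarith)
        exact ⟨m', le_trans hm' (le_max_right _ _), π, J, s, h3,
          (mul_le_mul_of_nonneg_right (min_le_right _ _) hn0).trans h4⟩
  obtain ⟨N, hN⟩ := exists_nat_ge (r / γ)
  obtain ⟨M, n₀, δ, hδ, h⟩ := key N 1 le_rfl
  refine ⟨M, n₀, δ, hδ, fun n hn d hd E hdense => h n hn d hd E hdense (fun _ => 0) ?_⟩
  have h1 := energy_nonneg k d E (fun _ : Fin n => (0 : Fin 1))
  rw [div_le_iff₀ hγ0] at hN
  have h2 : (r : ℝ) * (d * (n : ℝ) ^ k) ≤ N * γ * (d * (n : ℝ) ^ k) := by gcongr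
  linarith

end Regularity

/-! ### From cyclic sequences to loose cycles -/

section CycleOfSeq

variable {V : Type*} [DecidableEq V]

/-- A cyclic sequence of blocks gives a loose cycle in a hypergraph that contains the blocks. -/
theorem IsLooseCycleSeq.exists_isLooseCycle {κ ℓ : ℕ} {E : Set (Finset V)} {x : ℕ → V}
    {G : Hypergraph V} (hκ : 1 ≤ κ) (hℓ : 2 ≤ ℓ) (hx : IsLooseCycleSeq κ E ℓ x)
    (hE : ∀ f ∈ E, (f : Set V) ∈ G.edgeSet) :
    ∃ C : Hypergraph V, IsLooseCycle (κ + 1) C ∧ IsSub C G ∧ C.vertexSet.ncard = ℓ * κ := by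
  have hpos : 0 < ℓ * κ := by positivity
  have : NeZero (ℓ * κ) := ⟨hpos.ne'⟩
  set v : ZMod (ℓ * κ) → V := fun z => x z.val with hv
  have hvinj : Function.Injective v := fun y z h =>
    ZMod.val_injective _ (hx.inj _ _ (ZMod.val_lt y) (ZMod.val_lt z) h)
  -- The case `i = ℓ * κ` is included because the last block wraps around to the first vertex.
  have hvx : ∀ i ≤ ℓ * κ, v (i : ℕ) = x i := by
    intro i hi
    simp only [hv, ZMod.val_natCast]
    rcases hi.lt_or_eq with h | rfl
    · rw [Nat.mod_eq_of_lt h]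
    · rw [Nat.mod_self, hx.closed]
  have hblock : ∀ i < ℓ, {y | ∃ j < κ + 1, y = v ((i * κ + j : ℕ))} = (block κ x i : Set V) := by
    intro i hi
    ext y
    rw [Finset.mem_coe, mem_block]
    have hle : ∀ j ≤ κ, i * κ + j ≤ ℓ * κ := fun j hj => by
      have := Nat.mul_le_mul_right κ (show i + 1 ≤ ℓ from hi)
      rw [add_mul, one_mul] at this
      omega
    constructor
    · rintro ⟨j, hj, rfl⟩
      exact ⟨j, by omega, (hvx _ (hle j (by omega))).symm⟩
    · rintro ⟨j, hj, rfl⟩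
      exact ⟨j, by omega, (hvx _ (hle j hj)).symm⟩
  have hrange : ∀ i < ℓ, (block κ x i : Set V) ⊆ Set.range v := by
    intro i hi y hy
    rw [← hblock i hi] at hy
    obtain ⟨j, _, rfl⟩ := hy
    exact ⟨_, rfl⟩
  refine ⟨⟨Set.range v, {e | ∃ i < ℓ, e = (block κ x i : Set V)}, ?_⟩,
    ⟨ℓ, hℓ, v, hvinj, rfl, ?_⟩, ⟨?_, ?_⟩, ?_⟩
  · rintro e ⟨i, hi, rfl⟩
    exact hrange i hi
  · ext e
    simp only [Set.mem_ofPred_eq, Nat.add_sub_cancel]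
    constructor
    · rintro ⟨i, hi, rfl⟩
      exact ⟨i, hi, (hblock i hi).symm⟩
    · rintro ⟨i, hi, rfl⟩
      exact ⟨i, hi, hblock i hi⟩
  · rintro _ ⟨z, rfl⟩
    have hz := ZMod.val_lt z
    have hz' : z.val / κ < ℓ := (Nat.div_lt_iff_lt_mul hκ).2 hz
    refine G.subset_vertexSet_of_mem_edgeSet' (hE _ (hx.edge _ hz')) ?_
    rw [Finset.mem_coe, mem_block]
    refine ⟨z.val % κ, (Nat.mod_lt _ hκ).le, ?_⟩
    rw [mul_comm, Nat.div_add_mod]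
  · rintro _ ⟨i, hi, rfl⟩
    exact hE _ (hx.edge i hi)
  · show (Set.range v).ncard = ℓ * κ
    rw [← Set.image_univ, Set.ncard_image_of_injective _ hvinj, Set.ncard_univ, Nat.card_zmod]

end CycleOfSeq

/-! ### Links from a packing -/

section LinksOfPacking

variable {V : Type*} [DecidableEq V]

/-- The finite edges of a hypergraph. -/
def finsetEdges (G : Hypergraph V) : Set (Finset V) := {e | (e : Set V) ∈ G.edgeSet}

/-- The cyclic ordering of a loose cycle turns every block into a link. -/
def cycleLink {G : Hypergraph V} {κ ℓ : ℕ} (hκ : 1 ≤ κ) (hℓ : 2 ≤ ℓ) (v : ZMod (ℓ * κ) → V)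
    (hv : Function.Injective v)
    (hE : ∀ i < ℓ, (((Finset.range (κ + 1)).image fun j => v ((i * κ + j : ℕ)) : Finset V) : Set V) ∈
      G.edgeSet) (i : Fin ℓ) : Link (finsetEdges G) where
  edge := (Finset.range (κ + 1)).image fun j => v ((i * κ + j : ℕ))
  src := v ((i * κ : ℕ))
  tgt := v (((i + 1) * κ : ℕ))
  edge_mem := hE i i.2
  src_mem := Finset.mem_image.2 ⟨0, by simp, by simp⟩
  tgt_mem := Finset.mem_image.2 ⟨κ, by simp, by rw [add_mul, one_mul]⟩
  src_ne_tgt := fun h => by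
    have h1 := (ZMod.natCast_eq_natCast_iff' _ _ _).1 (hv h)
    have h2 : κ < ℓ * κ := by nlinarith
    have h3 : (i : ℕ) * κ + κ ≤ ℓ * κ := by
      have := Nat.mul_le_mul_right κ i.2
      rwa [Nat.succ_mul] at this
    rw [add_mul, one_mul, Nat.mod_eq_of_lt (by omega : (i : ℕ) * κ < ℓ * κ)] at h1
    rcases h3.lt_or_eq with h4 | h4
    · rw [Nat.mod_eq_of_lt h4] at h1
      omega
    · rw [h4, Nat.mod_self] at h1
      omega

theorem sum_load_cycleLink_le {G : Hypergraph V} {κ ℓ : ℕ} (hκ : 1 ≤ κ) (hℓ : 2 ≤ ℓ)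
    (v : ZMod (ℓ * κ) → V) (hv : Function.Injective v)
    (hE : ∀ i < ℓ, (((Finset.range (κ + 1)).image fun j => v ((i * κ + j : ℕ)) : Finset V) : Set V) ∈
      G.edgeSet) (u : ℕ) (P : V) :
    ∑ i, (cycleLink hκ hℓ v hv hE i).load u P ≤ 2 * u + 2 := by
  classical
  -- Discharging: each block moves a charge `u + 1` from its last vertex to its first. It then
  -- charges at most `2 * u + 2`, and only to its first `κ` vertices; over all blocks these sets
  -- partition the cycle.
  have h1 : ∀ i : Fin ℓ, (cycleLink hκ hℓ v hv hE i).load u P +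
      (if P = v ((i * κ : ℕ)) then u + 1 else 0) ≤
      (if ∃ j < κ, P = v ((i * κ + j : ℕ)) then 2 * u + 2 else 0) +
      if P = v (((i + 1) * κ : ℕ)) then u + 1 else 0 := by
    intro i
    have hne := (cycleLink hκ hℓ v hv hE i).src_ne_tgt
    have hsrc : P = v ((i * κ : ℕ)) → ∃ j < κ, P = v ((i * κ + j : ℕ)) := fun h => ⟨0, hκ, by rw [add_zero]; exact h⟩
    have hmem : P ∈ (cycleLink hκ hℓ v hv hE i).edge → P = v (((i + 1) * κ : ℕ)) ∨
        ∃ j < κ, P = v ((i * κ + j : ℕ)) := by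
      intro h
      obtain ⟨j, hj, rfl⟩ := Finset.mem_image.1 h
      rw [Finset.mem_range] at hj
      rcases (Nat.lt_succ_iff.1 hj).lt_or_eq with hj | rfl
      · exact Or.inr ⟨j, hj, rfl⟩
      · left; rw [add_mul, one_mul]
    unfold Link.load
    have e1 : (cycleLink hκ hℓ v hv hE i).src = v ((i * κ : ℕ)) := rfl
    have e2 : (cycleLink hκ hℓ v hv hE i).tgt = v (((i + 1) * κ : ℕ)) := rfl
    rw [e1, e2] at hne ⊢
    by_cases hs : P = v ((i * κ : ℕ))
    · have ht : P ≠ v (((i + 1) * κ : ℕ)) := fun h => hne (hs ▸ h)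
      rw [if_pos (Or.inl hs), if_pos hs, if_pos (hsrc hs), if_neg ht]
      omega
    · by_cases ht : P = v (((i + 1) * κ : ℕ))
      · rw [if_pos (Or.inr ht), if_neg hs, if_pos ht]
        omega
      · rw [if_neg (not_or.2 ⟨hs, ht⟩), if_neg hs, if_neg ht]
        by_cases he : P ∈ (cycleLink hκ hℓ v hv hE i).edge
        · rw [if_pos he, if_pos ((hmem he).resolve_left ht)]
          omega
        · rw [if_neg he]
          omega
  -- The last vertex of a block is the first of the next one, so the moved charges cancel around the
  -- cycle.
  have h2 : ∑ i : Fin ℓ, (if P = v ((i * κ : ℕ)) then u + 1 else 0) =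
      ∑ i : Fin ℓ, if P = v (((i + 1) * κ : ℕ)) then u + 1 else 0 := by
    rw [Fin.sum_univ_eq_sum_range (fun i => if P = v ((i * κ : ℕ)) then u + 1 else 0) ℓ,
      Fin.sum_univ_eq_sum_range (fun i => if P = v (((i + 1) * κ : ℕ)) then u + 1 else 0) ℓ]
    have h3 := Finset.sum_range_succ (fun i => if P = v ((i * κ : ℕ)) then u + 1 else 0) ℓ
    have h4 := Finset.sum_range_succ' (fun i => if P = v ((i * κ : ℕ)) then u + 1 else 0) ℓ
    have h5 : v ((ℓ * κ : ℕ)) = v ((0 * κ : ℕ)) := by simp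
    rw [h4] at h3
    simp only [h5] at h3
    omega
  have h3 : ∑ i : Fin ℓ, (if ∃ j < κ, P = v ((i * κ + j : ℕ)) then 2 * u + 2 else 0) ≤
      2 * u + 2 := by
    rw [← Finset.sum_filter, Finset.sum_const, smul_eq_mul]
    refine Nat.mul_le_of_le_div _ _ _ ?_
    rw [Nat.div_self (by omega), Finset.card_le_one]
    intro i hi i' hi'
    obtain ⟨j, hj, hP⟩ := (Finset.mem_filter.1 hi).2
    obtain ⟨j', hj', hP'⟩ := (Finset.mem_filter.1 hi').2
    have h4 := (ZMod.natCast_eq_natCast_iff' _ _ _).1 (hv (hP.symm.trans hP'))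
    have hlt : ∀ (i : Fin ℓ) (j : ℕ), j < κ → (i : ℕ) * κ + j < ℓ * κ := fun i j hj => by
      have := Nat.mul_le_mul_right κ i.2
      rw [Nat.succ_mul] at this
      omega
    rw [Nat.mod_eq_of_lt (hlt i j hj), Nat.mod_eq_of_lt (hlt i' j' hj')] at h4
    have h5 : ∀ (i : Fin ℓ) (j : ℕ), j < κ → ((i : ℕ) * κ + j) / κ = i := fun i j hj => by
      rw [mul_comm, Nat.mul_add_div hκ, Nat.div_eq_of_lt hj, add_zero]
    exact Fin.ext (by rw [← h5 i j hj, h4, h5 i' j' hj'])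
  have h4 := Finset.sum_le_sum fun i (_ : i ∈ (Finset.univ : Finset (Fin ℓ))) => h1 i
  rw [Finset.sum_add_distrib, Finset.sum_add_distrib, h2] at h4
  omega

theorem load_eq_zero {G : Hypergraph V} {u : ℕ} (B : Link (finsetEdges G)) {P : V}
    (hP : P ∉ B.edge) : B.load u P = 0 := by
  unfold Link.load
  rw [if_neg, if_neg hP]
  rintro (rfl | rfl)
  exacts [hP B.src_mem, hP B.tgt_mem]

/-- A connected packing decomposes into links of one component, with bounded load. -/
theorem exists_links_of_packing [Finite V] {G : Hypergraph V} {κ N : ℕ} (hκ : 1 ≤ κ)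
    (hN : HasConnectedLooseCyclePacking (κ + 1) G N) :
    ∃ l : List (Link (finsetEdges G)), N = l.length * κ ∧
      (∀ B ∈ l, ∀ B' ∈ l, (linkGraph (finsetEdges G)).Reachable B.tgt B'.tgt) ∧
      ∀ u P, (l.map fun B => B.load u P).sum ≤ 2 * u + 2 := by
  classical
  obtain ⟨H, hHG, hconn, m, C, hC, hdisj, hsum⟩ := hN
  choose ℓ hℓ v hv hvert hedge using fun i => (hC i).1
  simp only [Nat.add_sub_cancel] at v hv hvert hedge
  have hblock : ∀ i, ∀ j < ℓ i,
      (((Finset.range (κ + 1)).image fun j' => v i ((j * κ + j' : ℕ)) : Finset V) : Set V) ∈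
        (C i).edgeSet := by
    intro i j hj
    rw [hedge i]
    refine ⟨j, hj, ?_⟩
    ext y
    simp only [Finset.coe_image, Set.mem_image, Finset.mem_coe, Finset.mem_range,
      Set.mem_ofPred_eq]
    exact ⟨fun ⟨a, h1, h2⟩ => ⟨a, h1, h2.symm⟩, fun ⟨a, h1, h2⟩ => ⟨a, h1, h2.symm⟩⟩
  have hblockG : ∀ i, ∀ j < ℓ i,
      (((Finset.range (κ + 1)).image fun j' => v i ((j * κ + j' : ℕ)) : Finset V) : Set V) ∈
        G.edgeSet := fun i j hj => hHG.2 ((hC i).2.2 (hblock i j hj))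
  let L : (Σ i, Fin (ℓ i)) → Link (finsetEdges G) := fun z =>
    cycleLink hκ (hℓ z.1) (v z.1) (hv z.1) (hblockG z.1) z.2
  have hLvert : ∀ i (j : Fin (ℓ i)) P, P ∈ (L ⟨i, j⟩).edge → P ∈ (C i).vertexSet := by
    intro i j P hP
    rw [hvert i]
    obtain ⟨j', _, rfl⟩ := Finset.mem_image.1 hP
    exact ⟨_, rfl⟩
  refine ⟨(Finset.univ : Finset (Σ i, Fin (ℓ i))).toList.map L, ?_, ?_, ?_⟩
  · rw [List.length_map, Finset.length_toList, Finset.card_univ, Fintype.card_sigma, Finset.sum_mul,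
      ← hsum]
    refine Finset.sum_congr rfl fun i _ => ?_
    rw [hvert i, ← Set.image_univ, Set.ncard_image_of_injective _ (hv i), Set.ncard_univ,
      Nat.card_zmod, Fintype.card_fin, Nat.add_sub_cancel]
  · intro B hB B' hB'
    obtain ⟨⟨i, j⟩, -, rfl⟩ := List.mem_map.1 hB
    obtain ⟨⟨i', j'⟩, -, rfl⟩ := List.mem_map.1 hB'
    -- Edges of `H` are edges of `G`, so connectedness of the shadow graph carries over to the link
    -- graph.
    let F : shadowGraph H →g linkGraph (finsetEdges G) :=
      { toFun := fun x => x.1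
        map_rel' := by
          rintro x y ⟨hne, e, he, hx, hy⟩
          refine ⟨fun h => hne (Subtype.ext h), (e.toFinite).toFinset, ?_, by simpa, by simpa⟩
          show ((e.toFinite.toFinset : Finset V) : Set V) ∈ G.edgeSet
          rw [Set.Finite.coe_toFinset]
          exact hHG.2 he }
    exact (hconn.preconnected ⟨_, (hC i).2.1 (hLvert i j _ (L ⟨i, j⟩).tgt_mem)⟩
      ⟨_, (hC i').2.1 (hLvert i' j' _ (L ⟨i', j'⟩).tgt_mem)⟩).map F
  · intro u P
    rw [List.map_map, Finset.sum_map_toList, Fintype.sum_sigma]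
    by_cases hP : ∃ i, P ∈ (C i).vertexSet
    · obtain ⟨i₀, hi₀⟩ := hP
      rw [Finset.sum_eq_single_of_mem i₀ (Finset.mem_univ _)]
      · exact sum_load_cycleLink_le hκ (hℓ i₀) (v i₀) (hv i₀) (hblockG i₀) u P
      · intro i _ hi
        refine Finset.sum_eq_zero fun j _ => load_eq_zero _ fun hmem => ?_
        exact Set.disjoint_left.1 (hdisj i i₀ hi) (hLvert i j P hmem) hi₀
    · push Not at hP
      rw [Finset.sum_eq_zero]
      · omega
      · intro i _
        exact Finset.sum_eq_zero fun j _ => load_eq_zero _ fun hmem => hP i (hLvert i j P hmem)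

end LinksOfPacking

/-! ### The reduced hypergraph -/

section ReducedHypergraph

variable {V ι : Type*} [DecidableEq ι]

/-- Transport of a link along an embedding. -/
def Link.map {𝓗 : Set (Finset V)} {𝓗' : Set (Finset ι)} (φ : V ↪ ι) (h : ∀ e ∈ 𝓗, e.map φ ∈ 𝓗')
    (B : Link 𝓗) : Link 𝓗' where
  edge := B.edge.map φ
  src := φ B.src
  tgt := φ B.tgt
  edge_mem := h _ B.edge_mem
  src_mem := Finset.mem_map_of_mem φ B.src_mem
  tgt_mem := Finset.mem_map_of_mem φ B.tgt_mem
  src_ne_tgt := fun heq => B.src_ne_tgt (φ.injective heq)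

theorem Link.load_map_apply [DecidableEq V] {𝓗 : Set (Finset V)} {𝓗' : Set (Finset ι)} (φ : V ↪ ι)
    (h : ∀ e ∈ 𝓗, e.map φ ∈ 𝓗') (B : Link 𝓗) (u : ℕ) (P : V) :
    (B.map φ h).load u (φ P) = B.load u P := by
  simp [Link.load, Link.map]

theorem Link.load_map_of_notMem_range {𝓗 : Set (Finset V)} {𝓗' : Set (Finset ι)} (φ : V ↪ ι)
    (h : ∀ e ∈ 𝓗, e.map φ ∈ 𝓗') (B : Link 𝓗) (u : ℕ) {P : ι} (hP : P ∉ Set.range φ) :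
    (B.map φ h).load u P = 0 := by
  have h1 : ∀ x, P ≠ φ x := fun x hx => hP ⟨x, hx.symm⟩
  have h2 : ∀ x, φ x ≠ P := fun x hx => hP ⟨x, hx⟩
  simp [Link.load, Link.map, h1, h2]

theorem Link.load_le {𝓗 : Set (Finset ι)} (B : Link 𝓗) (u : ℕ) (P : ι) :
    B.load u P ≤ 2 * u + 2 := by
  unfold Link.load
  split_ifs <;> omega

open Classical in
/-- Applying the packing property of nearly complete hypergraphs to the reduced hypergraph. -/
theorem exists_links {m r κ : ℕ} (hκ : 1 ≤ κ) (hr : 1 ≤ r) (J : Finset (Fin m))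
    (hJ : κ + 1 ≤ J.card) (hit : Fin r → Finset (Fin m) → Prop) {ε' εs x : ℝ} (hε' : ε' < 1)
    (hεs : ε' ≤ εs)
    (hbad : (((J.powersetCard (κ + 1)).filter fun e => ∀ c, ¬ hit c e).card : ℝ) ≤
      ε' * J.card.choose (κ + 1))
    (hpack : ∀ G : Hypergraph (Fin J.card), G.vertexSet = Set.univ → IsUniform (κ + 1) G →
      (1 - εs) * (J.card.choose (κ + 1) : ℝ) ≤ (G.edgeSet.ncard : ℝ) →
      ∀ χ : Set (Fin J.card) → Fin r, ∃ (c : Fin r) (N : ℕ),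
        HasConnectedLooseCyclePacking (κ + 1) (colorClass G χ c) N ∧ x ≤ (N : ℝ)) :
    ∃ c, ∃ l : List (Link {e : Finset (Fin m) | e ⊆ J ∧ e.card = κ + 1 ∧ hit c e}), l ≠ [] ∧
      (∀ B ∈ l, ∀ B' ∈ l,
        (linkGraph {e : Finset (Fin m) | e ⊆ J ∧ e.card = κ + 1 ∧ hit c e}).Reachable
          B.tgt B'.tgt) ∧
      (∀ u P, (l.map fun B => B.load u P).sum ≤ 2 * u + 2) ∧ x ≤ l.length * κ := by
  set t := J.card with ht
  let φ : Fin t ↪ Fin m := (J.orderEmbOfFin ht.symm).toEmbedding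
  have hφ : ∀ e : Finset (Fin t), e.map φ ⊆ J := fun e y hy => by
    obtain ⟨a, _, rfl⟩ := Finset.mem_map.1 hy
    exact J.orderEmbOfFin_mem _ a
  set good := ((Finset.univ : Finset (Fin t)).powersetCard (κ + 1)).filter
    fun e => ∃ c, hit c (e.map φ) with hgood
  have hgood_card : (1 - ε') * (t.choose (κ + 1) : ℝ) ≤ good.card := by
    have h1 := Finset.card_filter_add_card_filter_not
      (s := (Finset.univ : Finset (Fin t)).powersetCard (κ + 1)) fun e => ∃ c, hit c (e.map φ)
    rw [Finset.card_powersetCard, Finset.card_univ, Fintype.card_fin] at h1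
    have h2 : (((Finset.univ : Finset (Fin t)).powersetCard (κ + 1)).filter
        fun e => ¬ ∃ c, hit c (e.map φ)).card ≤
        ((J.powersetCard (κ + 1)).filter fun e => ∀ c, ¬ hit c e).card := by
      refine Finset.card_le_card_of_injOn (fun e => e.map φ) (fun e he => ?_)
        (Finset.map_injective φ).injOn
      simp only [Finset.coe_filter, Set.mem_ofPred_eq, Finset.mem_powersetCard, not_exists] at he ⊢
      exact ⟨⟨hφ e, by rw [Finset.card_map, he.1.2]⟩, he.2⟩
    have h3 : (t.choose (κ + 1) : ℝ) ≤ good.card +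
        ((J.powersetCard (κ + 1)).filter fun e => ∀ c, ¬ hit c e).card := by
      rw [← h1]
      exact_mod_cast Nat.add_le_add_left h2 _
    linarith
  -- The default colour never matters, since only hit sets become edges.
  let col : Finset (Fin t) → Fin r := fun e =>
    if h : ∃ c, hit c (e.map φ) then h.choose else ⟨0, hr⟩
  have hcol : ∀ e, (∃ c, hit c (e.map φ)) → hit (col e) (e.map φ) := fun e he => by
    simp only [col, dif_pos he]
    exact he.choose_spec
  let G : Hypergraph (Fin t) :=
    ⟨Set.univ, {A | A.toFinite.toFinset ∈ good}, fun _ _ => Set.subset_univ _⟩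
  let χ : Set (Fin t) → Fin r := fun A => col A.toFinite.toFinset
  have hcoe : ∀ e : Finset (Fin t), (e : Set (Fin t)).toFinite.toFinset = e := fun e =>
    Finset.coe_injective (Set.Finite.coe_toFinset _)
  have hGcard : G.edgeSet.ncard = good.card := by
    rw [← Set.ncard_coe_finset]
    have : G.edgeSet = (fun e : Finset (Fin t) => (e : Set (Fin t))) '' (good : Set _) := by
      ext A
      constructor
      · intro hA
        exact ⟨A.toFinite.toFinset, hA, by simp⟩
      · rintro ⟨e, he, rfl⟩
        show (e : Set (Fin t)).toFinite.toFinset ∈ good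
        rwa [hcoe]
    rw [this, Set.ncard_image_of_injective _ Finset.coe_injective]
  have hmem : ∀ c, ∀ e ∈ finsetEdges (colorClass G χ c),
      e.map φ ∈ {e : Finset (Fin m) | e ⊆ J ∧ e.card = κ + 1 ∧ hit c e} := by
    rintro c e ⟨he, hc⟩
    have he' : e ∈ good := by
      have : (e : Set (Fin t)).toFinite.toFinset ∈ good := he
      rwa [hcoe] at this
    have hc' : col e = c := by
      have : col (e : Set (Fin t)).toFinite.toFinset = c := hc
      rwa [hcoe] at this
    simp only [hgood, Finset.mem_filter, Finset.mem_powersetCard] at he'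
    exact ⟨hφ e, by rw [Finset.card_map, he'.1.2], hc' ▸ hcol e he'.2⟩
  have hchoose : (0 : ℝ) < t.choose (κ + 1) := by exact_mod_cast Nat.choose_pos hJ
  obtain ⟨c, N, hN, hx⟩ := hpack G rfl (by
    intro A hA
    have hA' := (Finset.mem_filter.1 (show A.toFinite.toFinset ∈ good from hA)).1
    rw [Finset.mem_powersetCard] at hA'
    rw [Set.ncard_eq_toFinset_card A, hA'.2]) (by
    rw [hGcard]
    refine le_trans ?_ hgood_card
    exact mul_le_mul_of_nonneg_right (by linarith) hchoose.le) χ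
  obtain ⟨l, hl, hreach, hload⟩ := exists_links_of_packing hκ hN
  -- The packing may be empty, but then `x ≤ 0`, and any single link will do; one exists because `ε'
  -- < 1`.
  by_cases hl0 : l = []
  · have hpos : 0 < good.card := by
      have h1 : (0 : ℝ) < good.card :=
        lt_of_lt_of_le (mul_pos (by linarith) hchoose) hgood_card
      exact_mod_cast h1
    obtain ⟨e, he⟩ := Finset.card_pos.1 hpos
    simp only [hgood, Finset.mem_filter, Finset.mem_powersetCard] at he
    have hecard : (e.map φ).card = κ + 1 := by rw [Finset.card_map, he.1.2]
    obtain ⟨a, ha, b, hb, hab⟩ := Finset.one_lt_card.1 (show 1 < (e.map φ).card by omega)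
    refine ⟨col e, [⟨e.map φ, a, b, ⟨hφ e, hecard, hcol e he.2⟩, ha, hb, hab⟩], by simp, ?_, ?_, ?_⟩
    · intro B hB B' hB'
      rw [List.mem_singleton] at hB hB'
      rw [hB, hB']
    · intro u P
      simpa using Link.load_le _ u P
    · refine hx.trans ?_
      rw [hl, hl0]
      simp
  refine ⟨c, l.map (Link.map φ (hmem c)), by simpa using hl0, ?_, ?_, ?_⟩
  · intro B hB B' hB'
    obtain ⟨B, hBl, rfl⟩ := List.mem_map.1 hB
    obtain ⟨B', hBl', rfl⟩ := List.mem_map.1 hB'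
    let F : linkGraph (finsetEdges (colorClass G χ c)) →g
        linkGraph {e : Finset (Fin m) | e ⊆ J ∧ e.card = κ + 1 ∧ hit c e} :=
      { toFun := φ
        map_rel' := by
          rintro y z ⟨hne, e, he, hy, hz⟩
          exact ⟨fun h => hne (φ.injective h), e.map φ, hmem c e he,
            Finset.mem_map_of_mem φ hy, Finset.mem_map_of_mem φ hz⟩ }
    exact (hreach B hBl B' hBl').map F
  · intro u P
    rw [List.map_map]
    by_cases hP : P ∈ Set.range φ
    · obtain ⟨P, rfl⟩ := hP
      refine le_trans (le_of_eq ?_) (hload u P)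
      congr 1
      exact List.map_congr_left fun B _ => B.load_map_apply φ (hmem c) u P
    · rw [List.map_congr_left (g := fun _ => 0) fun B _ =>
        B.load_map_of_notMem_range φ (hmem c) u hP]
      simp
  · rw [List.length_map]
    refine hx.trans ?_
    rw [hl]; push_cast; rfl

end ReducedHypergraph

/-! ### Embedding with reservoirs -/

section Embedding

variable {V ι : Type*} [Fintype V] [DecidableEq V] [DecidableEq ι]

/-- Five reservoirs of `3 * h` vertices in each part of size `s`. -/
theorem exists_reservoirs (π : V → ι) {h s : ℕ} (hh : 1 ≤ h) (hs : 15 * h ≤ s) :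
    ∃ ρ : V → ℕ, ∀ P, (Finset.univ.filter fun x => π x = P).card = s →
      (∀ i, 1 ≤ i → i ≤ 5 → 3 * h ≤ (slot π ρ ∅ P i).card) ∧
      s - 15 * h ≤ (slot π ρ ∅ P 0).card := by
  obtain ⟨g, hg, -, -⟩ := exists_pieces_of_parts π (show 1 ≤ 3 * h by omega)
  -- The first five pieces of each part get labels `1` to `5`, everything else gets label `0`.
  refine ⟨fun x => if g x < 5 then g x + 1 else 0, fun P hP => ?_⟩
  have hpiece : ∀ i, 1 ≤ i → i ≤ 5 →
      (slot π (fun x => if g x < 5 then g x + 1 else 0) ∅ P i).card = 3 * h := by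
    intro i h1 h5
    obtain ⟨j, rfl⟩ := Nat.exists_eq_add_of_le' h1
    have h6 : (j + 1) * (3 * h) ≤ 5 * (3 * h) := Nat.mul_le_mul_right _ h5
    rw [← hg P j (by rw [hP]; omega)]
    congr 1
    ext x
    simp only [mem_slot, Finset.mem_filter, Finset.mem_univ, true_and, Finset.notMem_empty,
      not_false_eq_true, and_true]
    refine and_congr_right fun _ => ?_
    by_cases h7 : g x < 5
    · rw [if_pos h7, Nat.add_right_cancel_iff]
    · rw [if_neg h7]
      exact ⟨fun h8 => by omega, fun h8 => by omega⟩
  refine ⟨fun i h1 h5 => (hpiece i h1 h5).ge, ?_⟩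
  have hcov : (Finset.univ.filter fun x => π x = P) ⊆
      slot π (fun x => if g x < 5 then g x + 1 else 0) ∅ P 0 ∪
      (Finset.Icc 1 5).biUnion fun i => slot π (fun x => if g x < 5 then g x + 1 else 0) ∅ P i := by
    intro x hx
    simp only [Finset.mem_filter, Finset.mem_univ, true_and] at hx
    simp only [Finset.mem_union, Finset.mem_biUnion, mem_slot, Finset.notMem_empty,
      not_false_eq_true, and_true, hx, true_and, Finset.mem_Icc]
    by_cases h5 : g x < 5
    · right
      exact ⟨g x + 1, by omega, by rw [if_pos h5]⟩
    · left
      rw [if_neg h5]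
  have h1 := (Finset.card_le_card hcov).trans (Finset.card_union_le _ _)
  have h2 := Finset.card_biUnion_le_card_mul (Finset.Icc 1 5)
    (fun i => slot π (fun x => if g x < 5 then g x + 1 else 0) ∅ P i) (3 * h) fun i hi => by
      rw [Finset.mem_Icc] at hi
      exact (hpiece i hi.1 hi.2).le
  rw [hP] at h1
  simp only [Nat.card_Icc] at h2
  omega

variable [Fintype ι]

/-- For `u = 0` every link has load `1` at its source. This bounds the number of links independently
of the part sizes. -/
theorem length_le_of_load {𝓗 : Set (Finset ι)} (l : List (Link 𝓗))
    (hload : ∀ P, (l.map fun B => B.load 0 P).sum ≤ 2) : l.length ≤ 2 * Fintype.card ι := by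
  have h1 : ∀ l : List (Link 𝓗), l.length ≤ ∑ P, (l.map fun B => B.load 0 P).sum := by
    intro l
    induction l with
    | nil => simp
    | cons B l ih =>
      simp only [List.map_cons, List.sum_cons, List.length_cons, Finset.sum_add_distrib]
      have h2 : 1 ≤ ∑ P, B.load 0 P := by
        refine le_trans ?_ (Finset.single_le_sum (f := fun P => B.load 0 P)
          (fun _ _ => Nat.zero_le _) (Finset.mem_univ B.src))
        simp [Link.load]
      omega
  refine (h1 l).trans ((Finset.sum_le_sum fun P _ => hload P).trans ?_)
  simp [mul_comm]

/-- Links of a component of the reduced hypergraph on parts of size `s` give a loose cycle that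
covers most of the corresponding vertices. -/
theorem exists_looseCycleSeq_of_links {π : V → ι} {h s κ : ℕ} {E : Set (Finset V)} (hκ : 1 ≤ κ)
    (hh : 1 ≤ h) (hs : 24 * h + 3 ≤ s) (hE : ∀ f ∈ E, f.card = κ + 1) (J : Finset ι)
    (hJ : ∀ P ∈ J, (Finset.univ.filter fun x => π x = P).card = s)
    (l : List (Link {e : Finset ι | e ⊆ J ∧ e.card = κ + 1 ∧ Hits π h E e})) (hl : l ≠ [])
    (hreach : ∀ B ∈ l, ∀ B' ∈ l,
      (linkGraph {e : Finset ι | e ⊆ J ∧ e.card = κ + 1 ∧ Hits π h E e}).Reachable B.tgt B'.tgt)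
    (hload : ∀ u P, (l.map fun B => B.load u P).sum ≤ 2 * u + 2)
    (hsmall : 2 * Fintype.card ι * ((Fintype.card ι + 1) * κ) ≤ h) :
    ∃ ℓ x, 2 ≤ ℓ ∧ (s - 24 * h - 3) * l.length ≤ ℓ ∧ IsLooseCycleSeq κ E ℓ x := by
  obtain ⟨ρ, hρ⟩ := exists_reservoirs π hh (show 15 * h ≤ s by omega)
  -- Of `s` vertices, `15 * h` go to reservoirs, `5 * h` are slack for the search and `2` come from
  -- the load `2 * u + 2`, which leaves this `u`. Flexible ends cost `4 * h` edges per link and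
  -- rounding one more, hence `24 * h + 3`.
  obtain ⟨ℓ, x, hℓ, hlen, hx⟩ := exists_looseCycleSeq (π := π) (ρ := ρ) (u := (s - 20 * h - 2) / 2)
    hκ hh (by omega) hE (𝓗 := {e : Finset ι | e ⊆ J ∧ e.card = κ + 1 ∧ Hits π h E e})
    (fun e he => he.2) (fun e he P hP => (hρ P (hJ P (he.1 hP))).1)
    (fun e he P hP => by
      have := (hρ P (hJ P (he.1 hP))).2
      omega) l hl hreach (hload _)
    ((Nat.mul_le_mul_right _ (length_le_of_load l (hload 0))).trans hsmall)
  refine ⟨ℓ, x, hℓ, ?_, hx⟩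
  have h1 : (s - 24 * h - 3 + 4 * h) * l.length ≤ 2 * ((s - 20 * h - 2) / 2) * l.length :=
    Nat.mul_le_mul_right _ (by omega)
  rw [add_mul] at h1
  omega

end Embedding

/-! ### The deterministic theorem and the conclusion -/

section Main

/-- The colour classes partition the edges of `G`, so their densities add up to at least `p / 4`. -/
theorem IsLowerDense.isJointlyDense {k M n r : ℕ} (hr : 1 ≤ r) {δ p : ℝ} {G : Hypergraph (Fin n)}
    (hG : IsLowerDense k M n δ p G) (χ : Set (Fin n) → Fin r) :
    IsJointlyDense k M δ (p / (4 * r)) fun c =>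
      {f : Finset (Fin n) | f.card = k ∧ (f : Set (Fin n)) ∈ (colorClass G χ c).edgeSet} := by
  classical
  intro π e he hlarge
  have h1 := hG π e he hlarge
  have hr0 : (0 : ℝ) < r := by exact_mod_cast hr
  rw [show (r : ℝ) * (p / (4 * r)) = p / 4 by field_simp]
  refine h1.trans (le_of_eq ?_)
  norm_cast
  rw [Finset.card_eq_sum_card_fiberwise (f := fun f : Finset (Fin n) => χ (f : Set (Fin n)))
    (t := Finset.univ) fun _ _ => Finset.mem_coe.2 (Finset.mem_univ _)]
  refine Finset.sum_congr rfl fun c _ => ?_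
  congr 1
  ext f
  refine Iff.trans ?_ (@Finset.mem_filter _ _ (_) _ _).symm
  rw [Finset.mem_filter, Finset.mem_filter, mem_ofType, Finset.mem_powersetCard]
  simp only [Finset.subset_univ, true_and, Set.mem_ofPred_eq, colorClass]
  tauto

/-- Here `x` stands for ψ(r, k). Half of `α` is spent on the packing, the other half on vertices
that the embedding misses. -/
theorem exists_looseCycle_of_isLowerDense {k r : ℕ} (hk : 2 ≤ k) (hr : 1 ≤ r) {x α : ℝ}
    (hα : 0 < α)
    (hpack : ∃ εs : ℝ, 0 < εs ∧ ∃ t₀ : ℕ, 0 < t₀ ∧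
        ∀ t : ℕ, t₀ ≤ t → ∀ G : Hypergraph (Fin t), G.vertexSet = Set.univ →
          IsUniform k G → (1 - εs) * (t.choose k : ℝ) ≤ (G.edgeSet.ncard : ℝ) →
          ∀ χ : Set (Fin t) → Fin r, ∃ (c : Fin r) (N : ℕ),
            HasConnectedLooseCyclePacking k (colorClass G χ c) N ∧ (x - α / 2) * (t : ℝ) ≤ (N : ℝ)) :
    ∃ M n₀ : ℕ, ∃ δ : ℝ, 0 < δ ∧ ∀ n, n₀ ≤ n → ∀ p : ℝ, 0 < p → ∀ G : Hypergraph (Fin n),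
      IsLowerDense k M n δ p G → ∀ χ : Set (Fin n) → Fin r, ∃ (c : Fin r) (C : Hypergraph (Fin n)),
        IsLooseCycle k C ∧ IsSub C (colorClass G χ c) ∧
          (x - α) * (n : ℝ) ≤ (C.vertexSet.ncard : ℝ) := by
  classical
  obtain ⟨κ, rfl⟩ := Nat.exists_eq_add_of_le' (show 1 ≤ k by omega)
  have hκ : 1 ≤ κ := by omega
  obtain ⟨εs, hεs, t₀, -, hpack⟩ := hpack
  have hr0 : (0 : ℝ) < r := by exact_mod_cast hr
  set K := |x| + 1 with hK
  have hK0 : 0 < K := by positivity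
  -- The proportions lost inside and outside the parts are `25 * ε` and `η`; each costs at most `α /
  -- 4` because `x - α / 2 ≤ K`.
  obtain ⟨ε, hε, hε1, hε2⟩ : ∃ ε : ℝ, 0 < ε ∧ ε ≤ 1 / 50 ∧ ε ≤ α / (100 * K) :=
    ⟨min (1 / 50) (α / (100 * K)), by positivity, min_le_left _ _, min_le_right _ _⟩
  -- Parts have at most `η * n` vertices, so `η ≤ 1 / (t₀ + 1)` ensures at least `t₀` of them.
  obtain ⟨η, hη, hη1, hη2, hη3, hη4⟩ : ∃ η : ℝ, 0 < η ∧ η ≤ 1 / (2 * (κ + 1 : ℕ) + 1) ∧ η ≤ 1 / 2 ∧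
      η ≤ 1 / (t₀ + 1) ∧ η ≤ α / (4 * K) :=
    ⟨min (min (1 / (2 * (κ + 1 : ℕ) + 1)) (1 / 2)) (min (1 / (t₀ + 1)) (α / (4 * K))), by positivity,
      (min_le_left _ _).trans (min_le_left _ _), (min_le_left _ _).trans (min_le_right _ _),
      (min_le_right _ _).trans (min_le_left _ _), (min_le_right _ _).trans (min_le_right _ _)⟩
  rw [le_div_iff₀ (by positivity)] at hη1 hη3 hη4 hε2
  obtain ⟨M, n₁, δ, hδ, hreg⟩ := exists_isRegularPartition (κ + 1) r hr hε
    (show 0 < min εs (1 / 2) by positivity) hη (by linarith) hη2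
  -- `R ≤ h` leaves room for all connecting paths, and the `27` absorbs the rounding in `24 * h + 3
  -- ≤ 25 * ε * s`.
  set R := 2 * M * ((M + 1) * κ) + 27 with hR
  obtain ⟨n₂, hn₂⟩ := exists_nat_ge (R / (δ * ε))
  refine ⟨M, max n₁ n₂, δ, hδ, fun n hn p hp G hG χ => ?_⟩
  obtain ⟨m, hmM, π, J, s, hπ, hδs⟩ := hreg n (le_trans (le_max_left _ _) hn) (p / (4 * r))
    (by positivity) _ (hG.isJointlyDense hr χ)
  have hRs : (R : ℝ) ≤ ε * s := by
    rw [div_le_iff₀ (by positivity)] at hn₂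
    have h1 : (n₂ : ℝ) ≤ n := by exact_mod_cast le_trans (le_max_right _ _) hn
    calc (R : ℝ) ≤ n₂ * (δ * ε) := hn₂
      _ ≤ n * (δ * ε) := by gcongr
      _ = ε * (δ * n) := by ring
      _ ≤ ε * s := by gcongr
  have hR27 : (27 : ℝ) ≤ R := by
    have : 27 ≤ R := by omega
    exact_mod_cast this
  have hs0 : (0 : ℝ) < s := by
    by_contra! hs
    nlinarith
  have hn0 : (0 : ℝ) < n := by
    by_contra! h
    have := hπ.size_le
    nlinarith
  have hJt : ∀ y : ℝ, (y + 1) * η ≤ 1 → y ≤ J.card := by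
    intro y hy
    have h1 : (1 - η) * n ≤ J.card * (η * n) := hπ.cover.trans (by gcongr; exact hπ.size_le)
    have h2 : y * (η * n) ≤ J.card * (η * n) := by nlinarith
    exact le_of_mul_le_mul_right h2 (by positivity)
  have hJt₀ : t₀ ≤ J.card := by
    have := hJt t₀ (by linarith)
    exact_mod_cast this
  have hJk : κ + 1 ≤ J.card := by
    have h1 := hJt (2 * (κ + 1 : ℕ)) (by linarith)
    have h2 : 2 * (κ + 1) ≤ J.card := by exact_mod_cast h1
    omega
  set E : Fin r → Set (Finset (Fin n)) := fun c =>
    {f : Finset (Fin n) | f.card = κ + 1 ∧ (f : Set (Fin n)) ∈ (colorClass G χ c).edgeSet} with hE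
  have hfew := hπ.few_bad
  set h := ⌈ε * s⌉₊ with hh
  obtain ⟨c, l, hl, hreach, hload, hlen⟩ := exists_links hκ hr J hJk
    (fun c e => Hits π h (E c) e) (x := (x - α / 2) * (J.card : ℝ))
    (lt_of_le_of_lt (min_le_right εs (1 / 2 : ℝ)) (by norm_num)) (min_le_left εs (1 / 2 : ℝ))
    (by convert hfew) (hpack J.card hJt₀)
  have hh_ge : ε * s ≤ h := Nat.le_ceil _
  have hh_le : (h : ℝ) < ε * s + 1 := Nat.ceil_lt_add_one (by positivity)
  have hRh : R ≤ h := by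
    have : (R : ℝ) ≤ h := hRs.trans hh_ge
    exact_mod_cast this
  have hsh : (24 * h + 3 : ℝ) ≤ 25 * ε * s := by linarith
  have hsh' : 24 * h + 3 ≤ s := by
    have : (24 * h + 3 : ℝ) ≤ s := hsh.trans (by nlinarith)
    exact_mod_cast this
  obtain ⟨ℓ, y, hℓ, hℓlen, hy⟩ := exists_looseCycleSeq_of_links hκ (by omega) hsh'
    (fun f hf => hf.1) J (fun P hP => by rw [← hπ.card_part P hP]) l hl hreach hload (by
      rw [Fintype.card_fin]
      have : 2 * m * ((m + 1) * κ) ≤ 2 * M * ((M + 1) * κ) := by gcongr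
      omega)
  obtain ⟨C, hC, hCG, hCcard⟩ := hy.exists_isLooseCycle (G := colorClass G χ c) hκ hℓ
    fun f hf => hf.2
  refine ⟨c, C, hC, hCG, ?_⟩
  rw [hCcard]
  push_cast
  by_cases hx : x - α / 2 ≤ 0
  · have h1 : (x - α) * n ≤ 0 := mul_nonpos_of_nonpos_of_nonneg (by linarith) hn0.le
    exact h1.trans (by positivity)
  push Not at hx
  have h1 : ((1 - 25 * ε) * s) * (l.length : ℝ) ≤ ℓ := by
    have h2 : (((s - 24 * h - 3 : ℕ) : ℝ)) * l.length ≤ ℓ := by exact_mod_cast hℓlen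
    refine le_trans ?_ h2
    gcongr
    rw [Nat.cast_sub (by omega), Nat.cast_sub (by omega)]
    push_cast
    linarith
  have hε0 : 0 ≤ 1 - 25 * ε := by linarith
  have hxK : x - α / 2 ≤ K := by
    have := le_abs_self x
    linarith
  calc (x - α) * n ≤ (1 - 25 * ε) * (x - α / 2) * ((1 - η) * n) := by
        have h3 : (x - α / 2) * (25 * ε + η) ≤ K * (25 * ε + η) := by gcongr
        have h4 : K * (25 * ε + η) ≤ α / 2 := by linarith
        have h5 : 0 ≤ (x - α / 2) * (25 * ε * η) := by positivity
        have h6 : x - α ≤ (1 - 25 * ε) * (x - α / 2) * (1 - η) := by linarith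
        rw [← mul_assoc]
        gcongr
    _ ≤ (1 - 25 * ε) * (x - α / 2) * (J.card * s) := by
        exact mul_le_mul_of_nonneg_left hπ.cover (mul_nonneg hε0 hx.le)
    _ = (1 - 25 * ε) * s * ((x - α / 2) * J.card) := by ring
    _ ≤ (1 - 25 * ε) * s * (l.length * κ) :=
        mul_le_mul_of_nonneg_left hlen (mul_nonneg hε0 hs0.le)
    _ = (1 - 25 * ε) * s * l.length * κ := by ring
    _ ≤ ℓ * κ := by gcongr

end Main

end LooseCycles

theorem theorem1p5 (ψ : ℕ → ℕ → ℝ)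
    (hψ : ∀ k r : ℕ, 2 ≤ k → 1 ≤ r → ∀ αs : ℝ, 0 < αs →
      ∃ εs : ℝ, 0 < εs ∧ ∃ t₀ : ℕ, 0 < t₀ ∧
        ∀ t : ℕ, t₀ ≤ t → ∀ G : Hypergraph (Fin t), G.vertexSet = Set.univ →
          LooseCycles.IsUniform k G →
          (1 - εs) * (t.choose k : ℝ) ≤ (G.edgeSet.ncard : ℝ) →
          ∀ χ : Set (Fin t) → Fin r, ∃ (c : Fin r) (N : ℕ),
            LooseCycles.HasConnectedLooseCyclePacking k (LooseCycles.colorClass G χ c) N ∧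
            (ψ r k - αs) * (t : ℝ) ≤ (N : ℝ))
    (k r : ℕ) (hk : 2 ≤ k) (hr : 1 ≤ r) (α : ℝ) (hα : 0 < α) (p : ℕ → I)
    (hp : Tendsto (fun n : ℕ => (p n : ℝ) * (n : ℝ) ^ (k - 1)) atTop atTop) :
    Tendsto
      (fun n : ℕ => LooseCycles.randomHypergraph k n (p n)
        {G | ∀ χ : Set (Fin n) → Fin r, ∃ (c : Fin r) (C : Hypergraph (Fin n)),
          LooseCycles.IsLooseCycle k C ∧
          LooseCycles.IsSub C (LooseCycles.colorClass G χ c) ∧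
          (ψ r k - α) * (n : ℝ) ≤ (C.vertexSet.ncard : ℝ)})
      atTop (𝓝 1) := by
  obtain ⟨M, n₀, δ, hδ, hdet⟩ := LooseCycles.exists_looseCycle_of_isLowerDense hk hr hα
    (hψ k r hk hr (α / 2) (half_pos hα))
  refine tendsto_of_tendsto_of_tendsto_of_le_of_le'
    (LooseCycles.tendsto_measure_isLowerDense k M (by omega) δ hδ p hp) tendsto_const_nhds ?_
    (Eventually.of_forall fun n => prob_le_one)
  filter_upwards [eventually_ge_atTop n₀, hp.eventually_gt_atTop 0] with n hn hpn
  refine measure_mono fun G hG => hdet n hn (p n) ?_ G hG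
  exact pos_of_mul_pos_left hpn (by positivity)
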